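/- Let $d\ge 1$, $W>0$, $\sigma>0$, $p\in(2,\infty]$ and $r\in\left(\frac{dp}{p-2},\infty\right]$, where $\frac{dp}{p-2}$ means $d$ if $p=\infty$, and let $r^*$ be the conjugate exponent, $\frac1r+\frac1{r^*}=1$. Let $V$ be a Hilbert space of vector fields on $\mathbb R^d$ continuously embedded in the space $C^1(\mathbb R^d,\mathbb R^d)$ of continuously differentiable vector fields that are bounded together with their first derivatives. Put $$I(\xi)=W\,\xi^2(\xi-1)^2(\xi-\tfrac12)\,\mathbf 1_{[0,1]}(\xi),\qquad \eta_\tau(x)=\frac{\exp(-|x|^2/2\tau^2)}{(2\pi)^{d/2}\tau^d}\quad(\tau>0).$$ Let $f_0\in L^{r^*}(\mathbb R^d)$, $u\in L^p([0,1],L^r(\mathbb R^d))$ and $v\in L^p([0,1],V)$ (Bochner spaces). A function $f\in C^0([0,1],L^{r^*}(\mathbb R^d))\cap C^0((0,1],W^{1,r^*}(\mathbb R^d))$ is called a mild solution of $$\partial_t f=\frac{\sigma^2}{2}\Delta f+I(f)+u|\nabla f|-v^T\nabla f$$ on $[0,1]$ with initial datum $f_0$ if, for every $t\in(0,1]$,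 the integrand below is Bochner integrable on $(0,t)$ with values in $L^{r^*}(\mathbb R^d)$ and $$f(t)=\eta_{\sigma\sqrt t}\star f_0+\int_0^t\eta_{\sigma\sqrt{t-s}}\star\bigl(I(f(s))+u(s)|\nabla f(s)|-v(s)^T\nabla f(s)\bigr)\,ds .$$ Then there is exactly one mild solution $f$ in $C^0([0,1],L^{r^*}(\mathbb R^d))\cap C^0((0,1],W^{1,r^*}(\mathbb R^d))$. It satisfies $$\max\Bigl(\sup_{t\in[0,1]}\|f(t)\|_{L^{r^*}},\ \sup_{t\in(0,1]}\sqrt t\,\|f(t)\|_{W^{1,r^*}}\Bigr)<\infty,$$ where $\|h\|_{W^{1,r^*}}=\bigl(\|h\|_{L^{r^*}}^{r^*}+\sum_{i=1}^d\|\partial_i h\|_{L^{r^*}}^{r^*}\bigr)^{1/r^*}$. Moreover, $f(0)=f_0$ and $\lim_{t\to0}f(t)=f_0$ in $L^{r^*}(\mathbb R^d)$. -/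

import Mathlib

open MeasureTheory Set Filter Topology
open scoped ENNReal ContDiff

noncomputable section

namespace AllenCahn

/-- Euclidean space `ℝ^d`. -/
abbrev Space (d : ℕ) : Type := EuclideanSpace ℝ (Fin d)

/-- The real-valued Lebesgue space `L^q(ℝ^d)`. -/
abbrev LSpace (d : ℕ) (q : ℝ≥0∞) : Type := Lp ℝ q (volume : Measure (Space d))

/-- The reaction term `I(ξ) = W ξ² (ξ - 1)² (ξ - 1/2) 1_{[0,1]}(ξ)`. -/
def reaction (W ξ : ℝ) : ℝ :=
  (Icc (0 : ℝ) 1).indicator (fun z => W * z ^ 2 * (z - 1) ^ 2 * (z - 1 / 2)) ξ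

/-- The Gaussian `η_τ(x) = exp(-|x|² / (2τ²)) / ((2π)^{d/2} τ^d)`. -/
def gaussian {d : ℕ} (τ : ℝ) (x : Space d) : ℝ :=
  Real.exp (-‖x‖ ^ 2 / (2 * τ ^ 2)) / ((2 * Real.pi) ^ ((d : ℝ) / 2) * τ ^ d)

/-- The convolution `η_τ ⋆ g` on `ℝ^d`. -/
def heatConv {d : ℕ} (τ : ℝ) (g : Space d → ℝ) : Space d → ℝ :=
  convolution (gaussian τ) g (ContinuousLinearMap.mul ℝ ℝ) volume

/-- `g` is the weak `i`-th partial derivative of `f`. -/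
def HasWeakPartial {d : ℕ} {q : ℝ≥0∞} (i : Fin d) (f g : LSpace d q) : Prop :=
  ∀ φ : Space d → ℝ, ContDiff ℝ ∞ φ → HasCompactSupport φ →
    ∫ x, f x * fderiv ℝ φ x (EuclideanSpace.single i 1) = - ∫ x, g x * φ x

/-- `f` belongs to the Sobolev space `W^{1,q}(ℝ^d)`. -/
def MemW1 {d : ℕ} {q : ℝ≥0∞} (f : LSpace d q) : Prop :=
  ∀ i : Fin d, ∃ g : LSpace d q, HasWeakPartial i f g

open Classical in
/-- The weak partial derivative `∂_i f` (only meaningful where it exists in `L^q`; it is then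
unique, and the value is `0` otherwise). -/
def weakPartial {d : ℕ} {q : ℝ≥0∞} (i : Fin d) (f : LSpace d q) : LSpace d q :=
  if h : ∃ g : LSpace d q, HasWeakPartial i f g then h.choose else 0

/-- The weak gradient `∇f`, as a vector field on `ℝ^d`. -/
def weakGrad {d : ℕ} {q : ℝ≥0∞} (f : LSpace d q) (x : Space d) : Space d :=
  WithLp.toLp 2 (fun i => weakPartial i f x)

/-- The norm `(‖f‖_q^q + ∑_i ‖∂_i f‖_q^q)^{1/q}` of `W^{1,q}`, for `q < ∞` and `f ∈ W^{1,q}`. -/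
def sobolevNorm {d : ℕ} {q : ℝ≥0∞} (f : LSpace d q) : ℝ :=
  (‖f‖ ^ q.toReal + ∑ i : Fin d, ‖weakPartial i f‖ ^ q.toReal) ^ (1 / q.toReal)

/-- The class `C⁰([0,1], L^q) ∩ C⁰((0,1], W^{1,q})`. -/
structure InPathClass {d : ℕ} {q : ℝ≥0∞} [Fact (1 ≤ q)] (f : ℝ → LSpace d q) : Prop where
  continuousOn : ContinuousOn f (Icc 0 1)
  memW1 : ∀ t ∈ Ioc (0 : ℝ) 1, MemW1 (f t)
  continuousW1 : ∀ t₀ ∈ Ioc (0 : ℝ) 1,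
    Tendsto (fun t => sobolevNorm (f t - f t₀)) (𝓝[Ioc 0 1] t₀) (𝓝 0)

/-- `‖f‖_P = max (sup_{[0,1]} ‖f(t)‖_{L^q}, sup_{(0,1]} √t ‖f(t)‖_{W^{1,q}})` in `[0,∞]`. -/
def pathNorm {d : ℕ} {q : ℝ≥0∞} (f : ℝ → LSpace d q) : ℝ≥0∞ :=
  max (⨆ t ∈ Icc (0 : ℝ) 1, ENNReal.ofReal ‖f t‖)
    (⨆ t ∈ Ioc (0 : ℝ) 1, ENNReal.ofReal (√t * sobolevNorm (f t)))

/-- The linear map `ι` realizes `V` as a space of vector fields continuously embedded in the space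
`C¹(ℝ^d, ℝ^d)` of continuously differentiable fields that are bounded with their derivative. -/
structure IsC1Embedding {d : ℕ} {V : Type*} [NormedAddCommGroup V] [InnerProductSpace ℝ V]
    (ι : V →ₗ[ℝ] (Space d → Space d)) : Prop where
  injective : Function.Injective ι
  contDiff : ∀ w, ContDiff ℝ 1 (ι w)
  bound : ∃ C : ℝ, ∀ w x, ‖ι w x‖ ≤ C * ‖w‖ ∧ ‖fderiv ℝ (ι w) x‖ ≤ C * ‖w‖

/-- The nonlinearity `I(f) + u |∇f| - vᵀ ∇f` at a fixed time. -/
def nonlinearity {d : ℕ} {q r : ℝ≥0∞} (W : ℝ) (u : LSpace d r) (v : Space d → Space d)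
    (f : LSpace d q) (x : Space d) : ℝ :=
  reaction W (f x) + u x * ‖weakGrad f x‖ - inner ℝ (v x) (weakGrad f x)

/-- `f` is a mild solution on `[0,1]` of
`∂_t f = (σ²/2) Δf + I(f) + u |∇f| - vᵀ ∇f` with initial datum `f₀`: for every `t ∈ (0,1]`,
`f(t) = η_{σ√t} ⋆ f₀ + ∫₀ᵗ η_{σ√(t-s)} ⋆ (I(f(s)) + u(s) |∇f(s)| - v(s)ᵀ ∇f(s)) ds`.
The integrand `F` takes its values in `L^q` for almost every `s` and has to be Bochner integrable.
No equation is imposed at `t = 0`, where the Gaussian degenerates. -/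
def IsMildSolution {d : ℕ} {q r : ℝ≥0∞} [Fact (1 ≤ q)] (σ W : ℝ) (f₀ : LSpace d q)
    (u : ℝ → LSpace d r) (v : ℝ → Space d → Space d) (f : ℝ → LSpace d q) : Prop :=
  ∀ t ∈ Ioc (0 : ℝ) 1, ∃ F : ℝ → LSpace d q,
    (∀ᵐ s : ℝ, s ∈ Ioo 0 t →
      F s =ᵐ[volume] heatConv (σ * √(t - s)) (nonlinearity W (u s) (v s) (f s))) ∧
    IntervalIntegrable F volume 0 t ∧
    f t =ᵐ[volume] fun x => heatConv (σ * √t) f₀ x + (∫ s in (0 : ℝ)..t, F s) x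

end AllenCahn

end

noncomputable section

namespace AllenCahn

/-! ### Singular scalar integrals -/

/-! Write q = r*. The equation is solved for a pair (y, h), with h in the place of the gradient of
y. By Hölder the product u|h| lies only in L¹, while I(y) - v·h stays in L^q, so the nonlinearity
takes values in L^q × L¹ and the heat semigroup is regarded as a map from this product to L^q.
Scaling of the Gaussian (`norm_lpOf_dilate`) gives it norm of order t^(-ρ/2) with ρ = d - d/q = d/r,
and its gradient norm of order t^(-γ) with γ = 1/2 + ρ/2. The nonlinearity is Lipschitz in (y, h)
with a constant w(s) that lies in L^p in time, because the reaction is globally Lipschitz and the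
other terms are positively homogeneous in h.

The natural space has y bounded and h of order t^(-1/2). In it the Duhamel integral is controlled by
the integral of (t-s)^(-γ) s^(-1/2) w(s). By Hölder in time this is finite exactly in the range of
the hypotheses: p > 2 makes s^(-1/2) p'-integrable, and r > dp/(p-2) says γ < 1 - 1/p. As this
inequality is strict, a weight exp(lt) with l large makes the constant as small as desired
(`weighted_singular_integral_bound`), so the Duhamel map is a contraction on all of [0,1] at once
(`SingularSystem.duhamel_contraction`, `SingularSystem.exists_duhamel`). The second component of the
fixed point is the weak gradient of the first, since weak derivatives commute with Bochner integrals
(`hasWeakPartial_duhamel`).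

Uniqueness needs one more argument: a competing mild solution has a continuous gradient on (0,1],
but no rate at 0 is assumed. By the semigroup law it solves the equation restarted at any a > 0
(`IsMildSolution.restart`). On [a,1] its gradient is bounded, and iterating the weighted estimate
replaces this bound by one that depends only on the supremum of the L^q norm
(`SingularSystem.norm_snd_le_of_restart`). Taking a = t/2 yields the rate t^(-1/2), after which the
contraction estimate gives equality (`SingularSystem.eqOn_of_duhamel`). -/

theorem integrableOn_sub_rpow {a t β : ℝ} (hat : a < t) (hβ : β < 1) :
    IntegrableOn (fun s : ℝ => (s - a) ^ (-β)) (Ioo a t) ∧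
      ∫ s in Ioo a t, (s - a) ^ (-β) = (t - a) ^ (1 - β) / (1 - β) := by
  have h1 : IntervalIntegrable (fun x : ℝ => x ^ (-β)) volume 0 (t - a) :=
    intervalIntegral.intervalIntegrable_rpow' (by linarith)
  have h2 := h1.comp_sub_right a
  simp only [zero_add, sub_add_cancel] at h2
  refine ⟨?_, ?_⟩
  · rw [intervalIntegrable_iff_integrableOn_Ioo_of_le hat.le] at h2
    exact h2
  · rw [← integral_Ioc_eq_integral_Ioo, ← intervalIntegral.integral_of_le hat.le,
      intervalIntegral.integral_comp_sub_right (fun x : ℝ => x ^ (-β)) a, sub_self,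
      integral_rpow (Or.inl (by linarith)), Real.zero_rpow (by linarith)]
    ring_nf

theorem integrableOn_rsub_rpow {a t β : ℝ} (hat : a < t) (hβ : β < 1) :
    IntegrableOn (fun s : ℝ => (t - s) ^ (-β)) (Ioo a t) ∧
      ∫ s in Ioo a t, (t - s) ^ (-β) = (t - a) ^ (1 - β) / (1 - β) := by
  have h1 : IntervalIntegrable (fun x : ℝ => x ^ (-β)) volume 0 (t - a) :=
    intervalIntegral.intervalIntegrable_rpow' (by linarith)
  have h2 := (h1.comp_sub_left t).symm
  simp only [sub_zero, sub_sub_cancel] at h2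
  refine ⟨?_, ?_⟩
  · rw [intervalIntegrable_iff_integrableOn_Ioo_of_le hat.le] at h2
    exact h2
  · rw [← integral_Ioc_eq_integral_Ioo, ← intervalIntegral.integral_of_le hat.le,
      intervalIntegral.integral_comp_sub_left (fun x : ℝ => x ^ (-β)) t, sub_self,
      integral_rpow (Or.inl (by linarith)), Real.zero_rpow (by linarith)]
    ring_nf

/-- At every s one of the distances t - s and s - a is at least half the length of the interval.
Bounding the corresponding factor by its value at that half length leaves two integrals with a
single endpoint singularity. -/
theorem beta_integral_bound {α β : ℝ} (hα : 0 ≤ α) (hα1 : α < 1) (hβ : 0 ≤ β) (hβ1 : β < 1)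
    {a t : ℝ} (hat : a < t) :
    IntegrableOn (fun s : ℝ => (t - s) ^ (-α) * (s - a) ^ (-β)) (Ioo a t) ∧
      ∫ s in Ioo a t, (t - s) ^ (-α) * (s - a) ^ (-β)
        ≤ (2 ^ α / (1 - β) + 2 ^ β / (1 - α)) * (t - a) ^ (1 - α - β) := by
  obtain ⟨i1, e1⟩ := integrableOn_sub_rpow hat hβ1
  obtain ⟨i2, e2⟩ := integrableOn_rsub_rpow hat hα1
  set L := t - a with hL
  have hLpos : 0 < L := by simp only [hL]; linarith
  have hb : ∀ s ∈ Ioo a t, (t - s) ^ (-α) * (s - a) ^ (-β) ≤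
      (L / 2) ^ (-α) * (s - a) ^ (-β) + (L / 2) ^ (-β) * (t - s) ^ (-α) := by
    rintro s ⟨h1, h2⟩
    have p1 : 0 ≤ (s - a) ^ (-β) := Real.rpow_nonneg (by linarith) _
    have p2 : 0 ≤ (t - s) ^ (-α) := Real.rpow_nonneg (by linarith) _
    rcases le_total (L / 2) (t - s) with h | h
    · have : (t - s) ^ (-α) ≤ (L / 2) ^ (-α) :=
        Real.rpow_le_rpow_of_nonpos (by linarith) h (by linarith)
      have := mul_le_mul_of_nonneg_right this p1
      have : 0 ≤ (L / 2) ^ (-β) * (t - s) ^ (-α) := by positivity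
      linarith
    · have : (s - a) ^ (-β) ≤ (L / 2) ^ (-β) :=
        Real.rpow_le_rpow_of_nonpos (by linarith) (by linarith) (by linarith)
      have := mul_le_mul_of_nonneg_left this p2
      have : 0 ≤ (L / 2) ^ (-α) * (s - a) ^ (-β) := by positivity
      linarith
  have hi : IntegrableOn (fun s : ℝ => (L / 2) ^ (-α) * (s - a) ^ (-β)
      + (L / 2) ^ (-β) * (t - s) ^ (-α)) (Ioo a t) := (i1.const_mul _).add (i2.const_mul _)
  have hint : IntegrableOn (fun s : ℝ => (t - s) ^ (-α) * (s - a) ^ (-β)) (Ioo a t) := by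
    refine Integrable.mono' hi (by fun_prop) ?_
    filter_upwards [ae_restrict_mem measurableSet_Ioo] with s hs
    rw [Real.norm_of_nonneg]
    · exact hb s hs
    · exact mul_nonneg (Real.rpow_nonneg (by linarith [hs.2]) _)
        (Real.rpow_nonneg (by linarith [hs.1]) _)
  refine ⟨hint, (setIntegral_mono_on hint hi measurableSet_Ioo hb).trans_eq ?_⟩
  rw [integral_add (i1.const_mul _) (i2.const_mul _), integral_const_mul, integral_const_mul,
    e1, e2, Real.div_rpow hLpos.le zero_le_two, Real.div_rpow hLpos.le zero_le_two,
    Real.rpow_neg zero_le_two, Real.rpow_neg zero_le_two,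
    show 1 - α - β = -α + (1 - β) by ring, Real.rpow_add hLpos,
    show L ^ (-α) * L ^ (1 - β) = L ^ (-β) * L ^ (1 - α) by
      rw [← Real.rpow_add hLpos, ← Real.rpow_add hLpos]; ring_nf, add_mul]
  rw [show L ^ (-β) * L ^ (1 - α) = L ^ (-α) * L ^ (1 - β) by
      rw [← Real.rpow_add hLpos, ← Real.rpow_add hLpos]; ring_nf]
  congr 1
  · field_simp
  · rw [show L ^ (-α) * L ^ (1 - β) = L ^ (-β) * L ^ (1 - α) by
      rw [← Real.rpow_add hLpos, ← Real.rpow_add hLpos]; ring_nf]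
    field_simp

/-- Hölder in time with exponents p' and p. The condition p > 2 reads p'/2 < 1 and γ < 1 - 1/p reads
γp' < 1, so the p'-th power of the kernel is covered by `beta_integral_bound`. The constant does not
depend on the starting time a, which the restart argument requires. -/
theorem singular_integral_bound {p γ : ℝ} (hp : 2 < p) (hγ0 : 0 ≤ γ) (hγ : γ < 1 - 1 / p)
    {w : ℝ → ℝ} (hw0 : ∀ s, 0 ≤ w s)
    (hw : MemLp w (ENNReal.ofReal p) (volume.restrict (Icc (0 : ℝ) 1))) :
    ∃ C : ℝ, 0 ≤ C ∧ ∀ a t : ℝ, 0 ≤ a → a < t → t ≤ 1 →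
      IntegrableOn (fun s => (t - s) ^ (-γ) * (s - a) ^ (-(1 / 2 : ℝ)) * w s) (Ioo a t) ∧
      ∫ s in Ioo a t, (t - s) ^ (-γ) * (s - a) ^ (-(1 / 2 : ℝ)) * w s
        ≤ C * (t - a) ^ (-(1 / 2 : ℝ)) := by
  have hp0 : 0 < p := by linarith
  set p' := p / (p - 1) with hp'
  have hconj : p'.HolderConjugate p := (Real.HolderConjugate.conjExponent (by linarith)).symm
  have hp'0 : 0 < p' := hconj.pos
  have hinv : 1 / p' = 1 - 1 / p := by rw [hp']; field_simp
  have hα1 : γ * p' < 1 := by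
    rw [← hinv, lt_div_iff₀ hp'0] at hγ; exact hγ
  have hβ1 : 1 / 2 * p' < 1 := by
    rw [hp', ← mul_div_assoc, div_lt_one (by linarith)]; linarith
  have hα0 : 0 ≤ γ * p' := by positivity
  have hβ0 : 0 ≤ 1 / 2 * p' := by positivity
  set B := 2 ^ (γ * p') / (1 - 1 / 2 * p') + 2 ^ (1 / 2 * p') / (1 - γ * p') with hB
  have hB0 : 0 ≤ B := by
    apply add_nonneg <;> apply div_nonneg <;> first | linarith | positivity
  have hwint : Integrable (fun s => w s ^ p) (volume.restrict (Icc (0 : ℝ) 1)) := by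
    have := (integrable_norm_rpow_iff hw.1 (by simpa using hp0) ENNReal.ofReal_ne_top).2 hw
    simpa [ENNReal.toReal_ofReal hp0.le, abs_of_nonneg (hw0 _)] using this
  refine ⟨B ^ (1 / p') * (∫ s in Icc (0 : ℝ) 1, w s ^ p) ^ (1 / p), by
    have : 0 ≤ ∫ s in Icc (0 : ℝ) 1, w s ^ p :=
      integral_nonneg fun s => Real.rpow_nonneg (hw0 s) _
    positivity, fun a t ha hat ht => ?_⟩
  have hsub : Ioo a t ⊆ Icc (0 : ℝ) 1 := fun s hs => ⟨by linarith [hs.1], by linarith [hs.2]⟩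
  have hwat : MemLp w (ENNReal.ofReal p) (volume.restrict (Ioo a t)) :=
    hw.mono_measure (Measure.restrict_mono hsub le_rfl)
  obtain ⟨hi, hbd⟩ := beta_integral_bound hα0 hα1 hβ0 hβ1 hat
  have hpow : ∀ s ∈ Ioo a t, ((t - s) ^ (-γ) * (s - a) ^ (-(1 / 2 : ℝ))) ^ p' =
      (t - s) ^ (-(γ * p')) * (s - a) ^ (-(1 / 2 * p')) := by
    rintro s ⟨h1, h2⟩
    rw [Real.mul_rpow (Real.rpow_nonneg (by linarith) _) (Real.rpow_nonneg (by linarith) _),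
      ← Real.rpow_mul (by linarith), ← Real.rpow_mul (by linarith)]
    ring_nf
  have hk0 : ∀ s ∈ Ioo a t, 0 ≤ (t - s) ^ (-γ) * (s - a) ^ (-(1 / 2 : ℝ)) := fun s hs =>
    mul_nonneg (Real.rpow_nonneg (by linarith [hs.2]) _) (Real.rpow_nonneg (by linarith [hs.1]) _)
  have hk : MemLp (fun s => (t - s) ^ (-γ) * (s - a) ^ (-(1 / 2 : ℝ))) (ENNReal.ofReal p')
      (volume.restrict (Ioo a t)) := by
    rw [← integrable_norm_rpow_iff (by fun_prop) (by simpa using hp'0) ENNReal.ofReal_ne_top,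
      ENNReal.toReal_ofReal hp'0.le]
    refine hi.congr ?_
    filter_upwards [ae_restrict_mem measurableSet_Ioo] with s hs
    rw [Real.norm_of_nonneg (hk0 s hs), hpow s hs]
  have : (ENNReal.ofReal p').HolderConjugate (ENNReal.ofReal p) := hconj.ennrealOfReal
  refine ⟨hk.integrable_mul hwat, ?_⟩
  refine (integral_mul_le_Lp_mul_Lq_of_nonneg hconj ?_ ?_ hk hwat).trans ?_
  · filter_upwards [ae_restrict_mem measurableSet_Ioo] with s hs using hk0 s hs
  · exact Eventually.of_forall hw0
  rw [setIntegral_congr_fun measurableSet_Ioo hpow, mul_right_comm]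
  have hta : 0 < t - a := by linarith
  have hI0 : 0 ≤ ∫ s in Ioo a t, (t - s) ^ (-(γ * p')) * (s - a) ^ (-(1 / 2 * p')) :=
    setIntegral_nonneg measurableSet_Ioo fun s hs => by
      rw [← hpow s hs]; exact Real.rpow_nonneg (hk0 s hs) _
  apply mul_le_mul
  · calc _ ≤ (B * (t - a) ^ (1 - γ * p' - 1 / 2 * p')) ^ (1 / p') :=
        Real.rpow_le_rpow hI0 hbd (by positivity)
      _ ≤ (B * (t - a) ^ (-(1 / 2 * p'))) ^ (1 / p') := by
        apply Real.rpow_le_rpow (by positivity) _ (by positivity)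
        apply mul_le_mul_of_nonneg_left _ hB0
        -- Since t - a ≤ 1, the surplus power (t - a)^(1 - γp') can be dropped.
        exact Real.rpow_le_rpow_of_exponent_ge hta (by linarith) (by linarith)
      _ = _ := by
        rw [Real.mul_rpow hB0 (by positivity), ← Real.rpow_mul hta.le]
        congr 2
        field_simp
  · apply Real.rpow_le_rpow (integral_nonneg fun s => Real.rpow_nonneg (hw0 s) _) _ (by positivity)
    exact setIntegral_mono_set hwint (Eventually.of_forall fun s => Real.rpow_nonneg (hw0 s) _)
      hsub.eventuallyLE
  · exact Real.rpow_nonneg (integral_nonneg fun s => Real.rpow_nonneg (hw0 s) _) _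
  · positivity

theorem exp_neg_le_rpow_neg {κ x : ℝ} (hκ : 0 ≤ κ) (hκ1 : κ ≤ 1) (hx : 0 < x) :
    Real.exp (-x) ≤ x ^ (-κ) := by
  rw [Real.exp_neg, Real.rpow_neg hx.le]
  apply inv_anti₀ (Real.rpow_pos_of_pos hx _)
  rcases le_total x 1 with h | h
  · exact (Real.rpow_le_one hx.le h hκ).trans (Real.one_le_exp hx.le)
  · calc x ^ κ ≤ x ^ (1 : ℝ) := Real.rpow_le_rpow_of_exponent_le h hκ1
      _ = x := Real.rpow_one x
      _ ≤ Real.exp x := by linarith [Real.add_one_le_exp x]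

/-- The strict inequality γ < 1 - 1/p leaves room to worsen the singularity by a small κ. In
exchange, exp(-l(t-s)) ≤ l^(-κ) (t-s)^(-κ) yields a factor that tends to 0 as l grows. -/
theorem weighted_singular_integral_bound {p γ : ℝ} (hp : 2 < p) (hγ0 : 0 ≤ γ)
    (hγ : γ < 1 - 1 / p) {w : ℝ → ℝ} (hw0 : ∀ s, 0 ≤ w s)
    (hw : MemLp w (ENNReal.ofReal p) (volume.restrict (Icc (0 : ℝ) 1))) {δ : ℝ} (hδ : 0 < δ) :
    ∃ l : ℝ, 0 < l ∧ ∀ a t : ℝ, 0 ≤ a → a < t → t ≤ 1 →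
      IntegrableOn (fun s => (t - s) ^ (-γ) * Real.exp (-(l * (t - s))) *
        (s - a) ^ (-(1 / 2 : ℝ)) * w s) (Ioo a t) ∧
      ∫ s in Ioo a t, (t - s) ^ (-γ) * Real.exp (-(l * (t - s))) *
        (s - a) ^ (-(1 / 2 : ℝ)) * w s ≤ δ * (t - a) ^ (-(1 / 2 : ℝ)) := by
  have hp1 : 0 < 1 / p := by positivity
  -- Half of the available gap, so that γ + κ is still below 1 - 1/p.
  set κ := (1 - 1 / p - γ) / 2 with hκ
  have hκ0 : 0 < κ := by rw [hκ]; linarith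
  have hκ1 : κ ≤ 1 := by rw [hκ]; linarith
  obtain ⟨C, hC0, hC⟩ := singular_integral_bound hp (γ := γ + κ) (by linarith)
    (by rw [hκ]; linarith) hw0 hw
  obtain ⟨l, hl0, hl⟩ : ∃ l : ℝ, 0 < l ∧ l ^ (-κ) * C ≤ δ := by
    have : Tendsto (fun l : ℝ => l ^ (-κ) * C) atTop (𝓝 (0 * C)) :=
      (tendsto_rpow_neg_atTop hκ0).mul_const C
    rw [zero_mul] at this
    obtain ⟨l, h1, h2⟩ := ((eventually_gt_atTop (0 : ℝ)).and
      (this.eventually (eventually_le_nhds hδ))).exists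
    exact ⟨l, h1, h2⟩
  refine ⟨l, hl0, fun a t ha hat ht => ?_⟩
  obtain ⟨hi, hb⟩ := hC a t ha hat ht
  have key : ∀ s ∈ Ioo a t, (t - s) ^ (-γ) * Real.exp (-(l * (t - s))) *
        (s - a) ^ (-(1 / 2 : ℝ)) * w s ≤
      l ^ (-κ) * ((t - s) ^ (-(γ + κ)) * (s - a) ^ (-(1 / 2 : ℝ)) * w s) := by
    rintro s ⟨h1, h2⟩
    have hts : 0 < t - s := by linarith
    have e := exp_neg_le_rpow_neg hκ0.le hκ1 (mul_pos hl0 hts)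
    rw [Real.mul_rpow hl0.le hts.le] at e
    have e2 : (t - s) ^ (-(γ + κ)) = (t - s) ^ (-γ) * (t - s) ^ (-κ) := by
      rw [← Real.rpow_add hts]; ring_nf
    rw [e2]
    have q1 : 0 ≤ (t - s) ^ (-γ) := Real.rpow_nonneg hts.le _
    have q2 : 0 ≤ (s - a) ^ (-(1 / 2 : ℝ)) := Real.rpow_nonneg (by linarith) _
    have q3 := hw0 s
    calc _ ≤ (t - s) ^ (-γ) * (l ^ (-κ) * (t - s) ^ (-κ)) * (s - a) ^ (-(1 / 2 : ℝ)) * w s := by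
          gcongr
      _ = _ := by ring
  have hsub : Ioo a t ⊆ Icc (0 : ℝ) 1 := fun s hs => ⟨by linarith [hs.1], by linarith [hs.2]⟩
  have hwm : AEStronglyMeasurable w (volume.restrict (Ioo a t)) :=
    hw.1.mono_measure (Measure.restrict_mono hsub le_rfl)
  have hint : IntegrableOn (fun s => (t - s) ^ (-γ) * Real.exp (-(l * (t - s))) *
        (s - a) ^ (-(1 / 2 : ℝ)) * w s) (Ioo a t) := by
    refine Integrable.mono' (hi.const_mul (l ^ (-κ))) (by fun_prop) ?_
    filter_upwards [ae_restrict_mem measurableSet_Ioo] with s hs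
    rw [Real.norm_of_nonneg]
    · exact key s hs
    · have := Real.rpow_nonneg (sub_nonneg.2 hs.2.le) (-γ)
      have := Real.rpow_nonneg (sub_nonneg.2 hs.1.le) (-(1 / 2 : ℝ))
      have := hw0 s
      positivity
  refine ⟨hint, (setIntegral_mono_on hint (hi.const_mul _) measurableSet_Ioo key).trans ?_⟩
  rw [integral_const_mul]
  have : 0 ≤ (t - a) ^ (-(1 / 2 : ℝ)) := Real.rpow_nonneg (by linarith) _
  calc _ ≤ l ^ (-κ) * (C * (t - a) ^ (-(1 / 2 : ℝ))) := by gcongr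
    _ = (l ^ (-κ) * C) * (t - a) ^ (-(1 / 2 : ℝ)) := by ring
    _ ≤ _ := by gcongr

/-! ### Duhamel integrals with a singular kernel -/

section Duhamel

variable {X Z : Type*} [NormedAddCommGroup X] [NormedSpace ℝ X] [NormedAddCommGroup Z]
  [NormedSpace ℝ Z]

theorem aestronglyMeasurable_duhamel {T : ℝ → X →L[ℝ] Z} (hTc : ContinuousOn T (Ioi 0))
    {n : ℝ → X} (hn : AEStronglyMeasurable n (volume.restrict (Ioc (0 : ℝ) 1))) {a t : ℝ}
    (ha : 0 ≤ a) (ht : t ≤ 1) :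
    AEStronglyMeasurable (fun s => T (t - s) (n s)) (volume.restrict (Ioo a t)) := by
  have h1 : AEStronglyMeasurable (fun s => T (t - s)) (volume.restrict (Ioo a t)) := by
    refine ContinuousOn.aestronglyMeasurable ?_ measurableSet_Ioo
    exact hTc.comp (by fun_prop) fun s hs => sub_pos.2 hs.2
  have h2 : AEStronglyMeasurable n (volume.restrict (Ioo a t)) :=
    hn.mono_measure (Measure.restrict_mono (fun s hs =>
      (⟨by linarith [hs.1], by linarith [hs.2]⟩ : s ∈ Ioc (0 : ℝ) 1)) le_rfl)
  exact (ContinuousLinearMap.id ℝ (X →L[ℝ] Z)).aestronglyMeasurable_comp₂ h1 h2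

/-- The constant `δ` controls the exponentially weighted singular integral of `w`. -/
def WeightedBound (γ l δ : ℝ) (w : ℝ → ℝ) : Prop :=
  ∀ a t : ℝ, 0 ≤ a → a < t → t ≤ 1 →
      IntegrableOn (fun s => (t - s) ^ (-γ) * Real.exp (-(l * (t - s))) *
        (s - a) ^ (-(1 / 2 : ℝ)) * w s) (Ioo a t) ∧
      ∫ s in Ioo a t, (t - s) ^ (-γ) * Real.exp (-(l * (t - s))) *
        (s - a) ^ (-(1 / 2 : ℝ)) * w s ≤ δ * (t - a) ^ (-(1 / 2 : ℝ))

/-- The exponent θ measures how much milder the singularity of `T` is than γ. It comes out as a gain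
(t-a)^θ, because (t-s)^θ ≤ (t-a)^θ. The weight passes through by writing exp(l(s-a)) = exp(l(t-a))
exp(-l(t-s)). -/
theorem norm_duhamel_le {γ l δ θ A M a t : ℝ} {w : ℝ → ℝ} (hl : WeightedBound γ l δ w)
    (hw0 : ∀ s, 0 ≤ w s)
    {T : ℝ → X →L[ℝ] Z} (hTc : ContinuousOn T (Ioi 0)) (hA : 0 ≤ A) (hθ : 0 ≤ θ)
    (hT : ∀ τ ∈ Ioc (0 : ℝ) 1, ‖T τ‖ ≤ A * τ ^ (θ - γ))
    {n : ℝ → X} (hn : AEStronglyMeasurable n (volume.restrict (Ioc (0 : ℝ) 1)))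
    (hM : 0 ≤ M) (ha : 0 ≤ a) (hat : a < t) (ht : t ≤ 1)
    (hnb : ∀ s ∈ Ioo a t, ‖n s‖ ≤ M * (Real.exp (l * (s - a)) * (s - a) ^ (-(1 / 2 : ℝ)) * w s)) :
    IntegrableOn (fun s => T (t - s) (n s)) (Ioo a t) ∧
      ‖∫ s in Ioo a t, T (t - s) (n s)‖ ≤
        A * M * δ * (Real.exp (l * (t - a)) * (t - a) ^ (θ - 1 / 2)) := by
  obtain ⟨hi, hb⟩ := hl a t ha hat ht
  have hta : 0 < t - a := by linarith
  set c := A * M * ((t - a) ^ θ * Real.exp (l * (t - a))) with hc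
  have hc0 : 0 ≤ c := by positivity
  have key : ∀ s ∈ Ioo a t, ‖T (t - s) (n s)‖ ≤ c * ((t - s) ^ (-γ) *
      Real.exp (-(l * (t - s))) * (s - a) ^ (-(1 / 2 : ℝ)) * w s) := by
    intro s hs
    have hts : 0 < t - s := by linarith [hs.2]
    have hsa : 0 < s - a := by linarith [hs.1]
    have q3 := hw0 s
    have e1 : (t - s) ^ (θ - γ) = (t - s) ^ θ * (t - s) ^ (-γ) := by
      rw [← Real.rpow_add hts]; ring_nf
    have e2 : Real.exp (l * (s - a)) = Real.exp (l * (t - a)) * Real.exp (-(l * (t - s))) := by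
      rw [← Real.exp_add]; ring_nf
    have e3 : (t - s) ^ θ ≤ (t - a) ^ θ :=
      Real.rpow_le_rpow hts.le (by linarith [hs.1]) hθ
    have q4 : 0 ≤ (t - s) ^ (-γ) := by positivity
    have q5 : 0 ≤ (s - a) ^ (-(1 / 2 : ℝ)) := by positivity
    calc ‖T (t - s) (n s)‖ ≤ ‖T (t - s)‖ * ‖n s‖ := (T (t - s)).le_opNorm _
      _ ≤ (A * (t - s) ^ (θ - γ)) *
          (M * (Real.exp (l * (s - a)) * (s - a) ^ (-(1 / 2 : ℝ)) * w s)) := by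
        gcongr
        · exact hT _ ⟨hts, by linarith [hs.1]⟩
        · exact hnb s hs
      _ ≤ (A * ((t - a) ^ θ * (t - s) ^ (-γ))) *
          (M * (Real.exp (l * (s - a)) * (s - a) ^ (-(1 / 2 : ℝ)) * w s)) := by
        rw [e1]; gcongr
      _ = _ := by rw [e2, hc]; ring
  have hae : ∀ᵐ s ∂(volume.restrict (Ioo a t)), ‖T (t - s) (n s)‖ ≤ c * ((t - s) ^ (-γ) *
      Real.exp (-(l * (t - s))) * (s - a) ^ (-(1 / 2 : ℝ)) * w s) := by
    filter_upwards [ae_restrict_mem measurableSet_Ioo] with s hs using key s hs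
  refine ⟨Integrable.mono' (hi.const_mul c) (aestronglyMeasurable_duhamel hTc hn ha ht) hae, ?_⟩
  refine (norm_integral_le_of_norm_le (hi.const_mul c) hae).trans ?_
  rw [integral_const_mul]
  calc _ ≤ c * (δ * (t - a) ^ (-(1 / 2 : ℝ))) := by gcongr
    _ = _ := by
      rw [sub_eq_add_neg θ, Real.rpow_add hta, hc]; ring

/-- Removing the window s ≥ t - η makes the kernel bounded, and the truncated integral is continuous
by dominated convergence. On the window (t-s)^κ ≤ η^κ for a small spare exponent κ, so the error
tends to 0 with η, uniformly after multiplication by t^(1/2). -/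
theorem continuousOn_duhamel {p γ A M : ℝ} {w : ℝ → ℝ} (hp : 2 < p) (hγ0 : 0 ≤ γ)
    (hγ : γ < 1 - 1 / p) (hw0 : ∀ s, 0 ≤ w s)
    (hw : MemLp w (ENNReal.ofReal p) (volume.restrict (Icc (0 : ℝ) 1)))
    {T : ℝ → X →L[ℝ] Z} (hTc : ContinuousOn T (Ioi 0)) (hA : 0 ≤ A)
    (hT : ∀ τ ∈ Ioc (0 : ℝ) 1, ‖T τ‖ ≤ A * τ ^ (-γ))
    {n : ℝ → X} (hn : AEStronglyMeasurable n (volume.restrict (Ioc (0 : ℝ) 1)))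
    (hM : 0 ≤ M) (hnb : ∀ s ∈ Ioc (0 : ℝ) 1, ‖n s‖ ≤ M * (s ^ (-(1 / 2 : ℝ)) * w s)) :
    ContinuousOn (fun t => ∫ s in Ioo 0 t, T (t - s) (n s)) (Ioc 0 1) := by
  have hp1 : 0 < 1 / p := by positivity
  set κ := (1 - 1 / p - γ) / 2 with hκ
  have hκ0 : 0 < κ := by rw [hκ]; linarith
  obtain ⟨C, hC0, hC⟩ := singular_integral_bound hp (γ := γ + κ) (by linarith)
    (by rw [hκ]; linarith) hw0 hw
  obtain ⟨C', -, hC'⟩ := singular_integral_bound hp (γ := 0) le_rfl (by linarith) hw0 hw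
  have hnint : IntegrableOn n (Ioc 0 1) := by
    rw [integrableOn_Ioc_iff_integrableOn_Ioo]
    refine Integrable.mono' (((hC' 0 1 le_rfl one_pos le_rfl).1).const_mul M)
      (hn.mono_measure (Measure.restrict_mono Ioo_subset_Ioc_self le_rfl)) ?_
    filter_upwards [ae_restrict_mem measurableSet_Ioo] with s hs
    simpa using hnb s ⟨hs.1, hs.2.le⟩
  -- kernels cut off near the singularity
  have hTm : ∀ t ∈ Ioc (0 : ℝ) 1, AEStronglyMeasurable (fun s => T (t - s) (n s))
      (volume.restrict (Ioo 0 t)) := fun t ht =>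
    aestronglyMeasurable_duhamel hTc hn le_rfl ht.2
  let J : ℝ → ℝ → Z := fun η t =>
    ∫ s in Ioc (0 : ℝ) 1, (Iio (t - η)).indicator (fun s => T (t - s) (n s)) s
  have hJc : ∀ η > 0, ContinuousOn (J η) (Ioc 0 1) := by
    intro η hη t₀ ht₀
    refine continuousWithinAt_of_dominated (bound := fun s => A * η ^ (-γ) * ‖n s‖) ?_ ?_
      (hnint.norm.const_mul _) ?_
    · filter_upwards [self_mem_nhdsWithin] with t ht
      rw [aestronglyMeasurable_indicator_iff measurableSet_Iio,
        Measure.restrict_restrict measurableSet_Iio]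
      refine (hTm t ht).mono_measure (Measure.restrict_mono ?_ le_rfl)
      rintro s ⟨h1, h2⟩
      exact ⟨h2.1, by simp only [mem_Iio] at h1; linarith⟩
    · filter_upwards [self_mem_nhdsWithin] with t ht
      filter_upwards [ae_restrict_mem measurableSet_Ioc] with s hs
      by_cases h : s ∈ Iio (t - η)
      · rw [indicator_of_mem h]
        simp only [mem_Iio] at h
        refine ((T (t - s)).le_opNorm _).trans ?_
        gcongr
        refine (hT _ ⟨by linarith, by linarith [hs.1, ht.2]⟩).trans ?_
        gcongr A * ?_
        exact Real.rpow_le_rpow_of_nonpos hη (by linarith) (by linarith)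
      · rw [indicator_of_notMem h]; simp; positivity
    -- At s = t₀ - η the cutoff jumps as t passes t₀; this single point is negligible.
    · have : ∀ᵐ s ∂(volume.restrict (Ioc (0 : ℝ) 1)), s ≠ t₀ - η :=
        ae_restrict_of_ae (by simp [ae_iff])
      filter_upwards [this] with s hs
      rcases lt_or_gt_of_ne hs with h | h
      · have h1 : ContinuousAt (fun t => T (t - s) (n s)) t₀ := by
          have : ContinuousAt T (t₀ - s) := hTc.continuousAt (Ioi_mem_nhds (by linarith))
          have : ContinuousAt (fun t => T (t - s)) t₀ :=
            ContinuousAt.comp (g := T) (f := fun t => t - s) this (by fun_prop)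
          exact this.clm_apply continuousAt_const
        refine (h1.congr ?_).continuousWithinAt
        filter_upwards [Ioi_mem_nhds (show s + η < t₀ by linarith)] with t ht
        rw [indicator_of_mem]
        simp only [mem_Ioi, mem_Iio] at *; linarith
      · refine ContinuousAt.continuousWithinAt ((continuousAt_const (y := (0 : Z))).congr ?_)
        filter_upwards [Iio_mem_nhds (show t₀ < s + η by linarith)] with t ht
        rw [indicator_of_notMem]
        simp only [mem_Iio] at *; linarith
  have happ : ∀ η > 0, ∀ t ∈ Ioc (0 : ℝ) 1,
      ‖(∫ s in Ioo 0 t, T (t - s) (n s)) - J η t‖ ≤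
        (A * M * C * η ^ κ) * t ^ (-(1 / 2 : ℝ)) := by
    intro η hη t ht
    obtain ⟨hi, hb⟩ := hC 0 t le_rfl ht.1 ht.2
    simp only [sub_zero] at hi hb
    have hJ : J η t = ∫ s in Ioo 0 t, (Iio (t - η)).indicator (fun s => T (t - s) (n s)) s := by
      refine (setIntegral_eq_of_subset_of_forall_sdiff_eq_zero measurableSet_Ioc
        (fun s hs => ⟨hs.1, by linarith [hs.2, ht.2]⟩) ?_)
      rintro s ⟨h1, h2⟩
      rw [indicator_of_notMem]
      simp only [mem_Iio, not_lt]
      simp only [mem_Ioo, not_and, not_lt] at h2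
      linarith [h2 h1.1]
    have hbase : ∀ s ∈ Ioo 0 t, ‖T (t - s) (n s)‖ ≤
        A * M * ((t - s) ^ (-γ) * s ^ (-(1 / 2 : ℝ)) * w s) := by
      intro s hs
      have := hw0 s
      have : 0 < s := hs.1
      have : 0 < t - s := sub_pos.2 hs.2
      calc _ ≤ ‖T (t - s)‖ * ‖n s‖ := (T (t - s)).le_opNorm _
        _ ≤ (A * (t - s) ^ (-γ)) * (M * (s ^ (-(1 / 2 : ℝ)) * w s)) := by
          gcongr
          · exact hT _ ⟨this, by linarith [hs.1, ht.2]⟩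
          · exact hnb s ⟨hs.1, by linarith [hs.2, ht.2]⟩
        _ = _ := by ring
    have hγle : ∀ s ∈ Ioo 0 t, (t - s) ^ (-γ) ≤ (t - s) ^ (-(γ + κ)) := fun s hs =>
      Real.rpow_le_rpow_of_exponent_ge (sub_pos.2 hs.2) (by linarith [hs.1, ht.2]) (by linarith)
    have hi1 : IntegrableOn (fun s => T (t - s) (n s)) (Ioo 0 t) := by
      refine Integrable.mono' (hi.const_mul (A * M)) (hTm t ht) ?_
      filter_upwards [ae_restrict_mem measurableSet_Ioo] with s hs
      refine (hbase s hs).trans ?_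
      have := hw0 s
      have : 0 < s := hs.1
      gcongr A * M * (?_ * _ * _)
      exact hγle s hs
    rw [hJ, ← integral_sub hi1 (hi1.indicator measurableSet_Iio)]
    refine (norm_integral_le_of_norm_le (hi.const_mul (A * M * η ^ κ)) ?_).trans ?_
    · filter_upwards [ae_restrict_mem measurableSet_Ioo] with s hs
      have := hw0 s
      have h0 : 0 < s := hs.1
      have hts : 0 < t - s := sub_pos.2 hs.2
      by_cases h : s ∈ Iio (t - η)
      · rw [indicator_of_mem h, sub_self, norm_zero]; positivity
      · rw [indicator_of_notMem h, sub_zero]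
        simp only [mem_Iio, not_lt] at h
        refine (hbase s hs).trans ?_
        have e : (t - s) ^ (-γ) = (t - s) ^ κ * (t - s) ^ (-(γ + κ)) := by
          rw [← Real.rpow_add hts]; ring_nf
        rw [e]
        calc _ ≤ A * M * (η ^ κ * (t - s) ^ (-(γ + κ)) * s ^ (-(1 / 2 : ℝ)) * w s) := by
              gcongr; linarith
          _ = _ := by ring
    · rw [integral_const_mul]
      have := Real.rpow_nonneg ht.1.le (-(1 / 2 : ℝ))
      calc _ ≤ A * M * η ^ κ * (C * t ^ (-(1 / 2 : ℝ))) := by gcongr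
        _ = _ := by ring
  -- The truncation error carries a factor t^(-1/2), so the uniform limit is taken after rescaling.
  have hscaled : ContinuousOn (fun t : ℝ => t ^ (1 / 2 : ℝ) • ∫ s in Ioo 0 t, T (t - s) (n s))
      (Ioc 0 1) := by
    refine continuousOn_of_uniform_approx_of_continuousOn fun u hu => ?_
    obtain ⟨ε, hε, hεu⟩ := Metric.mem_uniformity_dist.1 hu
    have hlim : Tendsto (fun η : ℝ => A * M * C * η ^ κ) (𝓝[>] 0) (𝓝 0) := by
      have : Tendsto (fun η : ℝ => A * M * C * η ^ κ) (𝓝 0) (𝓝 (A * M * C * 0 ^ κ)) :=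
        ((Real.continuousAt_rpow_const 0 κ (Or.inr hκ0.le)).tendsto).const_mul _
      rw [Real.zero_rpow hκ0.ne', mul_zero] at this
      exact this.mono_left nhdsWithin_le_nhds
    obtain ⟨η, hη1, hη⟩ := ((hlim.eventually (eventually_lt_nhds hε)).and
      self_mem_nhdsWithin).exists
    refine ⟨fun t => t ^ (1 / 2 : ℝ) • J η t, ?_, fun t ht => hεu ?_⟩
    · refine ContinuousOn.smul ?_ (hJc η hη)
      exact (Real.continuous_rpow_const (by norm_num)).continuousOn
    · rw [dist_eq_norm, ← smul_sub, norm_smul, Real.norm_of_nonneg (Real.rpow_nonneg ht.1.le _)]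
      refine lt_of_le_of_lt ?_ hη1
      calc _ ≤ t ^ (1 / 2 : ℝ) * ((A * M * C * η ^ κ) * t ^ (-(1 / 2 : ℝ))) := by
            gcongr
            · exact Real.rpow_nonneg ht.1.le _
            · exact happ η hη t ht
        _ = (A * M * C * η ^ κ) * (t ^ (1 / 2 : ℝ) * t ^ (-(1 / 2 : ℝ))) := by ring
        _ = _ := by rw [← Real.rpow_add ht.1]; simp
  have hfin : ContinuousOn (fun t : ℝ => t ^ (-(1 / 2 : ℝ)) • (t ^ (1 / 2 : ℝ) •
      ∫ s in Ioo 0 t, T (t - s) (n s))) (Ioc 0 1) :=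
    ContinuousOn.smul (fun t ht =>
      (Real.continuousAt_rpow_const t _ (Or.inl ht.1.ne')).continuousWithinAt) hscaled
  refine hfin.congr fun t ht => ?_
  simp only [smul_smul]
  rw [← Real.rpow_add ht.1]; simp

end Duhamel

/-! ### Abstract semilinear integral equations -/

/-- The data of an integral equation for a pair `(y, h)`, where `h` plays the role of the gradient
of `y`: two families of operators with integrable singularities at `0`, and a nonlinearity that is
Lipschitz with a time-dependent constant `w ∈ L^p`. -/
structure SingularSystem (X Y H : Type*) [NormedAddCommGroup X] [NormedSpace ℝ X]
    [NormedAddCommGroup Y] [NormedSpace ℝ Y] [NormedAddCommGroup H] [NormedSpace ℝ H] where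
  S : ℝ → X →L[ℝ] Y
  D : ℝ → X →L[ℝ] H
  N : ℝ → Y → H → X
  w : ℝ → ℝ
  p : ℝ
  γ : ℝ
  A : ℝ
  two_lt_p : 2 < p
  half_le_γ : 1 / 2 ≤ γ
  γ_lt : γ < 1 - 1 / p
  A_nonneg : 0 ≤ A
  continuousOn_S : ContinuousOn S (Ioi 0)
  continuousOn_D : ContinuousOn D (Ioi 0)
  norm_S_le : ∀ τ ∈ Ioc (0 : ℝ) 1, ‖S τ‖ ≤ A * τ ^ (1 / 2 - γ)
  norm_D_le : ∀ τ ∈ Ioc (0 : ℝ) 1, ‖D τ‖ ≤ A * τ ^ (-γ)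
  w_nonneg : ∀ s, 0 ≤ w s
  memLp_w : MemLp w (ENNReal.ofReal p) (volume.restrict (Icc (0 : ℝ) 1))
  N_zero : ∀ s, N s 0 0 = 0
  norm_N_sub_le : ∀ s y h y' h', ‖N s y h - N s y' h'‖ ≤ w s * (‖y - y'‖ + ‖h - h'‖)
  measurable_N : ∀ (y : ℝ → Y) (h : ℝ → H), ContinuousOn y (Ioc 0 1) → ContinuousOn h (Ioc 0 1) →
    AEStronglyMeasurable (fun s => N s (y s) (h s)) (volume.restrict (Ioc (0 : ℝ) 1))

/-- Continuous paths on `(0,1]` with `y` bounded and `h` of order `t^{-1/2}`. -/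
structure IsBoundedPath {Y H : Type*} [NormedAddCommGroup Y] [NormedAddCommGroup H]
    (y : ℝ → Y) (h : ℝ → H) : Prop where
  continuousOn_fst : ContinuousOn y (Ioc 0 1)
  continuousOn_snd : ContinuousOn h (Ioc 0 1)
  bound : ∃ B : ℝ, 0 ≤ B ∧ ∀ t ∈ Ioc (0 : ℝ) 1, ‖y t‖ ≤ B ∧ ‖h t‖ ≤ B * t ^ (-(1 / 2 : ℝ))

theorem norm_le_of_isBoundedPath {Y H : Type*} [NormedAddCommGroup Y]
    [NormedAddCommGroup H] {y : ℝ → Y} {h : ℝ → H} {B l : ℝ} (hl0 : 0 ≤ l) (hB0 : 0 ≤ B)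
    (hB : ∀ t ∈ Ioc (0 : ℝ) 1, ‖y t‖ ≤ B ∧ ‖h t‖ ≤ B * t ^ (-(1 / 2 : ℝ))) {t : ℝ}
    (ht : t ∈ Ioc (0 : ℝ) 1) :
    ‖y t‖ ≤ B * Real.exp (l * (t - 0)) ∧
    ‖h t‖ ≤ B * (Real.exp (l * (t - 0)) * (t - 0) ^ (-(1 / 2 : ℝ))) := by
  obtain ⟨h1, h2⟩ := hB t ht
  have e : 1 ≤ Real.exp (l * (t - 0)) := Real.one_le_exp (by have := ht.1; rw [sub_zero]; positivity)
  have := Real.rpow_nonneg ht.1.le (-(1 / 2 : ℝ))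
  rw [sub_zero t] at *
  refine ⟨h1.trans (le_mul_of_one_le_right hB0 e), h2.trans ?_⟩
  gcongr
  exact le_mul_of_one_le_left this e

/-! ### A priori bounds, uniqueness and existence for the abstract system. -/

namespace SingularSystem

variable {X Y H : Type*} [NormedAddCommGroup X] [NormedSpace ℝ X]
    [NormedAddCommGroup Y] [NormedSpace ℝ Y] [NormedAddCommGroup H] [NormedSpace ℝ H]
    (P : SingularSystem X Y H)

theorem exists_weightedBound {δ : ℝ} (hδ : 0 < δ) : ∃ l, 0 < l ∧ WeightedBound P.γ l δ P.w :=
  weighted_singular_integral_bound P.two_lt_p (by linarith [P.half_le_γ]) P.γ_lt P.w_nonneg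
    P.memLp_w hδ

theorem exists_half_weightedBound : ∃ l δ, 0 < l ∧ WeightedBound P.γ l δ P.w ∧
    ∀ M, 0 ≤ M → P.A * (2 * M) * δ ≤ M / 2 := by
  have hA := P.A_nonneg
  -- Chosen so that 2Aδ ≤ 1/2; the summand 1 covers the case A = 0.
  have hδ0 : 0 < 1 / (4 * (P.A + 1)) := by positivity
  obtain ⟨l, hl0, hl⟩ := P.exists_weightedBound hδ0
  refine ⟨l, _, hl0, hl, fun M hM => ?_⟩
  calc P.A * (2 * M) * (1 / (4 * (P.A + 1))) ≤ (P.A + 1) * (2 * M) * (1 / (4 * (P.A + 1))) := by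
        gcongr; linarith
    _ = M / 2 := by field_simp; ring

theorem norm_N_le (s : ℝ) (y : Y) (h : H) : ‖P.N s y h‖ ≤ P.w s * (‖y‖ + ‖h‖) := by
  simpa [P.N_zero] using P.norm_N_sub_le s y h 0 0

/-- As (s-a)^(-1/2) ≥ 1, the bound on the first component is absorbed in that on the second, whence
the 2M. Applying `norm_duhamel_le` with θ = 1/2 to `S` and θ = 0 to `D` reproduces the two rates, so
the pair of bounds is preserved up to the factor 2Aδ. -/
theorem norm_duhamel {l δ M a t : ℝ} (hl : WeightedBound P.γ l δ P.w) {n : ℝ → X}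
    (hn : AEStronglyMeasurable n (volume.restrict (Ioc (0 : ℝ) 1)))
    {m₁ m₂ : ℝ → ℝ} (hM : 0 ≤ M) (ha : 0 ≤ a) (hat : a < t) (ht : t ≤ 1)
    (hnb : ∀ s ∈ Ioo a t, ‖n s‖ ≤ P.w s * (m₁ s + m₂ s))
    (hm₁ : ∀ s ∈ Ioo a t, m₁ s ≤ M * Real.exp (l * (s - a)))
    (hm₂ : ∀ s ∈ Ioo a t, m₂ s ≤ M * (Real.exp (l * (s - a)) * (s - a) ^ (-(1 / 2 : ℝ)))) :
    IntegrableOn (fun s => P.S (t - s) (n s)) (Ioo a t) ∧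
    IntegrableOn (fun s => P.D (t - s) (n s)) (Ioo a t) ∧
      ‖∫ s in Ioo a t, P.S (t - s) (n s)‖ ≤
        P.A * (2 * M) * δ * Real.exp (l * (t - a)) ∧
      ‖∫ s in Ioo a t, P.D (t - s) (n s)‖ ≤
        P.A * (2 * M) * δ * (Real.exp (l * (t - a)) * (t - a) ^ (-(1 / 2 : ℝ))) := by
  have hb : ∀ s ∈ Ioo a t, ‖n s‖ ≤
      2 * M * (Real.exp (l * (s - a)) * (s - a) ^ (-(1 / 2 : ℝ)) * P.w s) := by
    intro s hs
    have hsa : 0 < s - a := by linarith [hs.1]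
    have h1 : 1 ≤ (s - a) ^ (-(1 / 2 : ℝ)) :=
      Real.one_le_rpow_of_pos_of_le_one_of_nonpos hsa (by linarith [hs.2]) (by norm_num)
    have h2 : M * Real.exp (l * (s - a)) ≤
        M * (Real.exp (l * (s - a)) * (s - a) ^ (-(1 / 2 : ℝ))) := by
      gcongr
      exact le_mul_of_one_le_right (Real.exp_pos _).le h1
    calc ‖n s‖ ≤ P.w s * (m₁ s + m₂ s) := hnb s hs
      _ ≤ P.w s * (2 * (M * (Real.exp (l * (s - a)) * (s - a) ^ (-(1 / 2 : ℝ))))) := by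
        apply mul_le_mul_of_nonneg_left _ (P.w_nonneg s)
        linarith [hm₁ s hs, hm₂ s hs]
      _ = _ := by ring
  have h1 := norm_duhamel_le hl P.w_nonneg P.continuousOn_S P.A_nonneg (θ := 1 / 2) (by norm_num)
    P.norm_S_le hn (M := 2 * M) (by positivity) ha hat ht hb
  have h2 := norm_duhamel_le hl P.w_nonneg P.continuousOn_D P.A_nonneg (θ := 0) le_rfl
    (by simpa using P.norm_D_le) hn (M := 2 * M) (by positivity) ha hat ht hb
  refine ⟨h1.1, h2.1, by simpa using h1.2, by simpa using h2.2⟩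

variable {P}

theorem integrableOn_duhamel {y : ℝ → Y} {h : ℝ → H} (hyh : IsBoundedPath y h) {t : ℝ}
    (ht : t ∈ Ioc (0 : ℝ) 1) :
    IntegrableOn (fun s => P.S (t - s) (P.N s (y s) (h s))) (Ioo 0 t) ∧
    IntegrableOn (fun s => P.D (t - s) (P.N s (y s) (h s))) (Ioo 0 t) := by
  obtain ⟨l, hl0, hl⟩ := P.exists_weightedBound one_pos
  obtain ⟨B, hB0, hB⟩ := hyh.bound
  have hmem : ∀ s ∈ Ioo 0 t, s ∈ Ioc (0 : ℝ) 1 := fun s hs => ⟨hs.1, by linarith [hs.2, ht.2]⟩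
  have := P.norm_duhamel hl (P.measurable_N y h hyh.1 hyh.2) hB0 le_rfl ht.1 ht.2
    (fun s _ => P.norm_N_le s (y s) (h s))
    (fun s hs => (norm_le_of_isBoundedPath hl0.le hB0 hB (hmem s hs)).1)
    (fun s hs => (norm_le_of_isBoundedPath hl0.le hB0 hB (hmem s hs)).2)
  exact ⟨this.1, this.2.1⟩

/-- Away from 0 continuity on a compact interval bounds both components, so no rate at the origin is
needed. The restart argument uses this before any such rate is known. -/
theorem integrableOn_duhamel_of_pos {y : ℝ → Y} {h : ℝ → H} (hyc : ContinuousOn y (Ioc 0 1))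
    (hhc : ContinuousOn h (Ioc 0 1)) {a t : ℝ} (ha : 0 < a) (hat : a < t) (ht : t ≤ 1) :
    IntegrableOn (fun s => P.S (t - s) (P.N s (y s) (h s))) (Ioo a t) ∧
    IntegrableOn (fun s => P.D (t - s) (P.N s (y s) (h s))) (Ioo a t) := by
  obtain ⟨l, hl0, hl⟩ := P.exists_weightedBound one_pos
  have hsub : Icc a t ⊆ Ioc 0 1 := fun s hs => ⟨by linarith [hs.1], by linarith [hs.2]⟩
  obtain ⟨K, hK⟩ := isCompact_Icc.exists_bound_of_continuousOn (hyc.mono hsub)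
  obtain ⟨K', hK'⟩ := isCompact_Icc.exists_bound_of_continuousOn (hhc.mono hsub)
  have hK0 : 0 ≤ K := (norm_nonneg _).trans (hK t ⟨hat.le, le_rfl⟩)
  have hK'0 : 0 ≤ K' := (norm_nonneg _).trans (hK' t ⟨hat.le, le_rfl⟩)
  have e1 : ∀ s ∈ Ioo a t, 1 ≤ Real.exp (l * (s - a)) := fun s hs =>
    Real.one_le_exp (mul_nonneg hl0.le (by linarith [hs.1]))
  have e2 : ∀ s ∈ Ioo a t, 1 ≤ (s - a) ^ (-(1 / 2 : ℝ)) := fun s hs =>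
    Real.one_le_rpow_of_pos_of_le_one_of_nonpos (by linarith [hs.1]) (by linarith [hs.2])
      (by norm_num)
  have hKK : 0 ≤ K + K' := by positivity
  have := P.norm_duhamel hl (P.measurable_N y h hyc hhc) hKK ha.le hat ht
    (fun s _ => P.norm_N_le s (y s) (h s))
    (fun s hs => (hK s ⟨hs.1.le, hs.2.le⟩).trans
      (le_trans (by linarith) (le_mul_of_one_le_right hKK (e1 s hs))))
    (fun s hs => (hK' s ⟨hs.1.le, hs.2.le⟩).trans
      (le_trans (by linarith) (le_mul_of_one_le_right hKK
        (one_le_mul_of_one_le_of_one_le (e1 s hs) (e2 s hs)))))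
  exact ⟨this.1, this.2.1⟩

/-- The constant δ can be made small at the price of a large l, and for fixed l the weight exp(lt)
is below 2 for small t. -/
theorem tendsto_duhamel_zero {y : ℝ → Y} {h : ℝ → H} (hyh : IsBoundedPath y h) :
    Tendsto (fun t => ∫ s in Ioo 0 t, P.S (t - s) (P.N s (y s) (h s))) (𝓝[>] 0) (𝓝 0) := by
  obtain ⟨B, hB0, hB⟩ := hyh.bound
  rw [Metric.tendsto_nhds]
  intro ε hε
  have hA := P.A_nonneg
  set δ := ε / (2 * (P.A * (2 * B) + 1)) with hδ
  have hδ0 : 0 < δ := by positivity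
  obtain ⟨l, hl0, hl⟩ := P.exists_weightedBound hδ0
  have hexp : Tendsto (fun t : ℝ => Real.exp (l * (t - 0))) (𝓝[>] 0) (𝓝 1) := by
    have : Continuous (fun t : ℝ => Real.exp (l * (t - 0))) := by fun_prop
    simpa using this.continuousAt.continuousWithinAt (x := (0 : ℝ)) (s := Ioi 0) |>.tendsto
  filter_upwards [Ioc_mem_nhdsGT (one_pos : (0 : ℝ) < 1),
    hexp.eventually (eventually_lt_nhds (one_lt_two : (1 : ℝ) < 2))] with t ht he
  have hmem : ∀ s ∈ Ioo 0 t, s ∈ Ioc (0 : ℝ) 1 := fun s hs => ⟨hs.1, by linarith [hs.2, ht.2]⟩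
  have := (P.norm_duhamel hl (P.measurable_N y h hyh.1 hyh.2) hB0 le_rfl ht.1 ht.2
    (fun s _ => P.norm_N_le s (y s) (h s))
    (fun s hs => (norm_le_of_isBoundedPath hl0.le hB0 hB (hmem s hs)).1)
    (fun s hs => (norm_le_of_isBoundedPath hl0.le hB0 hB (hmem s hs)).2)).2.2.1
  rw [dist_zero_right]
  refine this.trans_lt ?_
  calc P.A * (2 * B) * δ * Real.exp (l * (t - 0)) ≤ P.A * (2 * B) * δ * 2 := by gcongr
    _ < (P.A * (2 * B) + 1) * δ * 2 := by gcongr; linarith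
    _ = ε := by rw [hδ]; field_simp

/-- This makes the Duhamel map a self-map of the space in which the fixed point is sought. -/
theorem isBoundedPath_duhamel {y y₀ : ℝ → Y} {h h₀ : ℝ → H} (hyh : IsBoundedPath y h)
    (hyh₀ : IsBoundedPath y₀ h₀) :
    IsBoundedPath (fun t => y₀ t + ∫ s in Ioo 0 t, P.S (t - s) (P.N s (y s) (h s)))
      (fun t => h₀ t + ∫ s in Ioo 0 t, P.D (t - s) (P.N s (y s) (h s))) := by
  obtain ⟨l, hl0, hl⟩ := P.exists_weightedBound one_pos
  obtain ⟨B, hB0, hB⟩ := hyh.bound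
  obtain ⟨B', hB'0, hB'⟩ := hyh₀.bound
  have hA := P.A_nonneg
  have hγ := P.half_le_γ
  have hn : ∀ s ∈ Ioc (0 : ℝ) 1, ‖P.N s (y s) (h s)‖ ≤ 2 * B * (s ^ (-(1 / 2 : ℝ)) * P.w s) := by
    intro s hs
    have h1 : 1 ≤ s ^ (-(1 / 2 : ℝ)) :=
      Real.one_le_rpow_of_pos_of_le_one_of_nonpos hs.1 hs.2 (by norm_num)
    have h2 : B ≤ B * s ^ (-(1 / 2 : ℝ)) := le_mul_of_one_le_right hB0 h1
    calc _ ≤ P.w s * (‖y s‖ + ‖h s‖) := P.norm_N_le _ _ _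
      _ ≤ P.w s * (2 * (B * s ^ (-(1 / 2 : ℝ)))) := by
        apply mul_le_mul_of_nonneg_left _ (P.w_nonneg s)
        linarith [(hB s hs).1, (hB s hs).2]
      _ = _ := by ring
  have hS : ∀ τ ∈ Ioc (0 : ℝ) 1, ‖P.S τ‖ ≤ P.A * τ ^ (-P.γ) := fun τ hτ =>
    (P.norm_S_le τ hτ).trans (by
      gcongr P.A * ?_
      exact Real.rpow_le_rpow_of_exponent_ge hτ.1 hτ.2 (by linarith))
  refine ⟨hyh₀.1.add (continuousOn_duhamel P.two_lt_p (by linarith) P.γ_lt P.w_nonneg P.memLp_w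
      P.continuousOn_S hA hS (P.measurable_N y h hyh.1 hyh.2) (by positivity) hn),
    hyh₀.2.add (continuousOn_duhamel P.two_lt_p (by linarith) P.γ_lt P.w_nonneg P.memLp_w
      P.continuousOn_D hA P.norm_D_le (P.measurable_N y h hyh.1 hyh.2) (by positivity) hn),
    B' + P.A * (2 * B) * 1 * Real.exp l, by positivity, fun t ht => ?_⟩
  have hmem : ∀ s ∈ Ioo 0 t, s ∈ Ioc (0 : ℝ) 1 := fun s hs => ⟨hs.1, by linarith [hs.2, ht.2]⟩
  obtain ⟨-, -, h1, h2⟩ := P.norm_duhamel hl (P.measurable_N y h hyh.1 hyh.2) hB0 le_rfl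
    ht.1 ht.2 (fun s _ => P.norm_N_le s (y s) (h s))
    (fun s hs => (norm_le_of_isBoundedPath hl0.le hB0 hB (hmem s hs)).1)
    (fun s hs => (norm_le_of_isBoundedPath hl0.le hB0 hB (hmem s hs)).2)
  have he : Real.exp (l * (t - 0)) ≤ Real.exp l := by
    apply Real.exp_le_exp.2
    rw [sub_zero]; exact mul_le_of_le_one_right hl0.le ht.2
  constructor
  · refine (norm_add_le _ _).trans (add_le_add (hB' t ht).1 (h1.trans ?_))
    gcongr
  · refine (norm_add_le _ _).trans ?_
    rw [add_mul]
    refine add_le_add (hB' t ht).2 (h2.trans ?_)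
    rw [sub_zero, mul_assoc _ (Real.exp l)]
    have := Real.rpow_nonneg ht.1.le (-(1 / 2 : ℝ))
    rw [sub_zero] at he
    gcongr

/-- One step of the contraction estimate in the weighted norm. -/
theorem duhamel_contraction {l δ M : ℝ} (hl : WeightedBound P.γ l δ P.w)
    {y y' : ℝ → Y} {h h' : ℝ → H} (hyh : IsBoundedPath y h) (hyh' : IsBoundedPath y' h')
    (hM : 0 ≤ M)
    (hb : ∀ t ∈ Ioc (0 : ℝ) 1, ‖y t - y' t‖ ≤ M * Real.exp (l * t) ∧
      ‖h t - h' t‖ ≤ M * (Real.exp (l * t) * t ^ (-(1 / 2 : ℝ)))) {t : ℝ}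
    (ht : t ∈ Ioc (0 : ℝ) 1) :
    ‖(∫ s in Ioo 0 t, P.S (t - s) (P.N s (y s) (h s))) -
        ∫ s in Ioo 0 t, P.S (t - s) (P.N s (y' s) (h' s))‖ ≤
        P.A * (2 * M) * δ * Real.exp (l * t) ∧
    ‖(∫ s in Ioo 0 t, P.D (t - s) (P.N s (y s) (h s))) -
        ∫ s in Ioo 0 t, P.D (t - s) (P.N s (y' s) (h' s))‖ ≤
        P.A * (2 * M) * δ * (Real.exp (l * t) * t ^ (-(1 / 2 : ℝ))) := by
  obtain ⟨i1, i2⟩ := P.integrableOn_duhamel hyh ht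
  obtain ⟨i1', i2'⟩ := P.integrableOn_duhamel hyh' ht
  have hmem : ∀ s ∈ Ioo 0 t, s ∈ Ioc (0 : ℝ) 1 := fun s hs => ⟨hs.1, by linarith [hs.2, ht.2]⟩
  have := P.norm_duhamel hl ((P.measurable_N y h hyh.1 hyh.2).sub
    (P.measurable_N y' h' hyh'.1 hyh'.2)) hM le_rfl ht.1 ht.2
    (m₁ := fun s => ‖y s - y' s‖) (m₂ := fun s => ‖h s - h' s‖)
    (fun s _ => P.norm_N_sub_le s (y s) (h s) (y' s) (h' s))
    (fun s hs => by simpa using (hb s (hmem s hs)).1)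
    (fun s hs => by simpa using (hb s (hmem s hs)).2)
  simp only [Pi.sub_apply, map_sub, sub_zero] at this
  rw [integral_sub i1 i1', integral_sub i2 i2'] at this
  exact this.2.2

/-- Iterating the contraction estimate halves the weighted distance at each step, starting from the
sum of the two bounds. -/
theorem eqOn_of_duhamel {y y' y₀ : ℝ → Y} {h h' h₀ : ℝ → H}
    (hyh : IsBoundedPath y h) (hyh' : IsBoundedPath y' h')
    (hy : ∀ t ∈ Ioc (0 : ℝ) 1, y t = y₀ t + ∫ s in Ioo 0 t, P.S (t - s) (P.N s (y s) (h s)))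
    (hh : ∀ t ∈ Ioc (0 : ℝ) 1, h t = h₀ t + ∫ s in Ioo 0 t, P.D (t - s) (P.N s (y s) (h s)))
    (hy' : ∀ t ∈ Ioc (0 : ℝ) 1, y' t = y₀ t + ∫ s in Ioo 0 t, P.S (t - s) (P.N s (y' s) (h' s)))
    (hh' : ∀ t ∈ Ioc (0 : ℝ) 1,
      h' t = h₀ t + ∫ s in Ioo 0 t, P.D (t - s) (P.N s (y' s) (h' s))) :
    EqOn y y' (Ioc 0 1) := by
  obtain ⟨l, δ, hl0, hl, hAδ⟩ := P.exists_half_weightedBound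
  obtain ⟨B, hB0, hB⟩ := hyh.bound
  obtain ⟨B', hB'0, hB'⟩ := hyh'.bound
  have key : ∀ k : ℕ, ∀ t ∈ Ioc (0 : ℝ) 1,
      ‖y t - y' t‖ ≤ (B + B') / 2 ^ k * Real.exp (l * t) ∧
      ‖h t - h' t‖ ≤ (B + B') / 2 ^ k * (Real.exp (l * t) * t ^ (-(1 / 2 : ℝ))) := by
    intro k
    induction k with
    | zero =>
      intro t ht
      have h1 := norm_le_of_isBoundedPath hl0.le hB0 hB ht
      have h2 := norm_le_of_isBoundedPath hl0.le hB'0 hB' ht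
      rw [sub_zero] at h1 h2
      rw [pow_zero, div_one, add_mul, add_mul]
      exact ⟨(norm_sub_le _ _).trans (add_le_add h1.1 h2.1),
        (norm_sub_le _ _).trans (add_le_add h1.2 h2.2)⟩
    | succ k ih =>
      intro t ht
      have hM : 0 ≤ (B + B') / 2 ^ k := by positivity
      obtain ⟨h1, h2⟩ := P.duhamel_contraction hl hyh hyh' hM ih ht
      have hM2 := hAδ _ hM
      have e : (B + B') / 2 ^ (k + 1) = (B + B') / 2 ^ k / 2 := by rw [pow_succ]; field_simp
      have := Real.rpow_nonneg ht.1.le (-(1 / 2 : ℝ))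
      rw [e, hy t ht, hy' t ht, hh t ht, hh' t ht, add_sub_add_left_eq_sub,
        add_sub_add_left_eq_sub]
      exact ⟨h1.trans (by gcongr), h2.trans (by gcongr)⟩
  intro t ht
  have hlim : Tendsto (fun k : ℕ => (B + B') / 2 ^ k * Real.exp (l * t)) atTop (𝓝 0) := by
    have := (tendsto_pow_atTop_nhds_zero_of_lt_one (r := (1 / 2 : ℝ)) (by norm_num)
      (by norm_num)).const_mul (B + B') |>.mul_const (Real.exp (l * t))
    simpa [div_eq_mul_inv] using this
  have := ge_of_tendsto' hlim fun k => (key k t ht).1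
  exact sub_eq_zero.1 (norm_le_zero_iff.1 this)

/-- The rate of `h` at 0 follows from boundedness of `y` alone. On [a,1] some bound K on `h` exists
by compactness, with no control as a tends to 0. Each use of the equation restarted at a halves the
contribution of K and adds CB from the datum `y a`, so in the limit the bound is 2CB, free of K and
uniform in a. -/
theorem norm_snd_le_of_restart {y : ℝ → Y} {h : ℝ → H} {B C : ℝ} (hB0 : 0 ≤ B) (hC0 : 0 ≤ C)
    (hyc : ContinuousOn y (Ioc 0 1)) (hhc : ContinuousOn h (Ioc 0 1))
    {S₀ : ℝ → Y → Y} {D₀ : ℝ → Y → H}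
    (hS₀ : ∀ τ ∈ Ioc (0 : ℝ) 1, ∀ z, ‖S₀ τ z‖ ≤ C * ‖z‖)
    (hD₀ : ∀ τ ∈ Ioc (0 : ℝ) 1, ∀ z, ‖D₀ τ z‖ ≤ C * ‖z‖ * τ ^ (-(1 / 2 : ℝ)))
    (hyB : ∀ t ∈ Ioc (0 : ℝ) 1, ‖y t‖ ≤ B)
    (hy : ∀ a t, 0 < a → a < t → t ≤ 1 →
      y t = S₀ (t - a) (y a) + ∫ s in Ioo a t, P.S (t - s) (P.N s (y s) (h s)))
    (hh : ∀ a t, 0 < a → a < t → t ≤ 1 →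
      h t = D₀ (t - a) (y a) + ∫ s in Ioo a t, P.D (t - s) (P.N s (y s) (h s))) :
    IsBoundedPath y h := by
  obtain ⟨l, δ, hl0, hl, hAδ⟩ := P.exists_half_weightedBound
  have main : ∀ a, 0 < a → a < 1 → ∀ t ∈ Ioc a 1,
      ‖h t‖ ≤ 2 * (C * B) * (Real.exp (l * (t - a)) * (t - a) ^ (-(1 / 2 : ℝ))) := by
    intro a ha ha1
    obtain ⟨K, hK⟩ : ∃ K, ∀ t ∈ Icc a 1, ‖h t‖ ≤ K :=
      isCompact_Icc.exists_bound_of_continuousOn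
        (hhc.mono fun t ht => ⟨by linarith [ht.1], ht.2⟩)
    have hK0 : 0 ≤ K := (norm_nonneg _).trans (hK 1 ⟨ha1.le, le_rfl⟩)
    have key : ∀ k : ℕ, ∀ t ∈ Ioc a 1,
        ‖y t‖ ≤ ((B + K) / 2 ^ k + 2 * (C * B)) * Real.exp (l * (t - a)) ∧
        ‖h t‖ ≤ ((B + K) / 2 ^ k + 2 * (C * B)) *
          (Real.exp (l * (t - a)) * (t - a) ^ (-(1 / 2 : ℝ))) := by
      intro k
      induction k with
      | zero =>
        intro t ht
        have hta : 0 < t - a := by linarith [ht.1]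
        have e1 : 1 ≤ Real.exp (l * (t - a)) := Real.one_le_exp (by positivity)
        have e2 : 1 ≤ (t - a) ^ (-(1 / 2 : ℝ)) :=
          Real.one_le_rpow_of_pos_of_le_one_of_nonpos hta (by linarith [ht.2]) (by norm_num)
        have h1 := hyB t ⟨by linarith [ht.1], ht.2⟩
        have h2 := hK t ⟨ht.1.le, ht.2⟩
        have h3 : 0 ≤ C * B := by positivity
        have h4 : 0 ≤ B + K + 2 * (C * B) := by positivity
        rw [pow_zero, div_one]
        constructor
        · exact le_trans (by linarith) (le_mul_of_one_le_right h4 e1)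
        · exact le_trans (by linarith) (le_mul_of_one_le_right h4 (one_le_mul_of_one_le_of_one_le e1 e2))
      | succ k ih =>
        intro t ht
        have hta : 0 < t - a := by linarith [ht.1]
        set M := (B + K) / 2 ^ k + 2 * (C * B) with hMdef
        have hM : 0 ≤ M := by positivity
        have hmem : ∀ s ∈ Ioo a t, s ∈ Ioc a 1 := fun s hs => ⟨hs.1, by linarith [hs.2, ht.2]⟩
        obtain ⟨-, -, h1, h2⟩ := P.norm_duhamel hl (P.measurable_N y h hyc hhc) hM ha.le
          ht.1 ht.2 (fun s _ => P.norm_N_le s (y s) (h s))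
          (fun s hs => (ih s (hmem s hs)).1) (fun s hs => (ih s (hmem s hs)).2)
        have hM2 := hAδ _ hM
        -- The value 2CB is the fixed point of M ↦ CB + M/2, and only the deviation from it, which
        -- contains K, is halved.
        have e : (B + K) / 2 ^ (k + 1) + 2 * (C * B) = C * B + M / 2 := by
          rw [hMdef, pow_succ]; field_simp; ring
        have q := Real.rpow_nonneg hta.le (-(1 / 2 : ℝ))
        have e1 : 1 ≤ Real.exp (l * (t - a)) := Real.one_le_exp (by positivity)
        have hya := hyB a ⟨ha, ha1.le⟩
        have hτ : t - a ∈ Ioc (0 : ℝ) 1 := ⟨hta, by linarith [ht.2]⟩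
        have hCB : 0 ≤ C * B := by positivity
        rw [e, hy a t ha ht.1 ht.2, hh a t ha ht.1 ht.2]
        constructor
        · refine (norm_add_le _ _).trans ?_
          rw [add_mul]
          refine add_le_add ?_ (h1.trans (by gcongr))
          calc _ ≤ C * ‖y a‖ := hS₀ _ hτ _
            _ ≤ C * B := by gcongr
            _ ≤ _ := le_mul_of_one_le_right hCB e1
        · refine (norm_add_le _ _).trans ?_
          rw [add_mul]
          refine add_le_add ?_ (h2.trans (by gcongr))
          calc _ ≤ C * ‖y a‖ * (t - a) ^ (-(1 / 2 : ℝ)) := hD₀ _ hτ _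
            _ ≤ C * B * (t - a) ^ (-(1 / 2 : ℝ)) := by gcongr
            _ ≤ _ := by
              gcongr
              exact le_mul_of_one_le_left q e1
    intro t ht
    have hlim : Tendsto (fun k : ℕ => ((B + K) / 2 ^ k + 2 * (C * B)) *
        (Real.exp (l * (t - a)) * (t - a) ^ (-(1 / 2 : ℝ)))) atTop
        (𝓝 ((0 + 2 * (C * B)) * (Real.exp (l * (t - a)) * (t - a) ^ (-(1 / 2 : ℝ))))) := by
      have := (tendsto_pow_atTop_nhds_zero_of_lt_one (r := (1 / 2 : ℝ)) (by norm_num)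
        (by norm_num)).const_mul (B + K)
      have h0 : Tendsto (fun k : ℕ => (B + K) / 2 ^ k) atTop (𝓝 0) := by
        simpa [div_eq_mul_inv] using this
      exact (h0.add_const _).mul_const _
    rw [zero_add] at hlim
    exact ge_of_tendsto' hlim fun k => (key k t ht).2
  have hB'0 : 0 ≤ 2 * (C * B) * Real.exp l * 2 ^ (1 / 2 : ℝ) := by positivity
  refine ⟨hyc, hhc, B + 2 * (C * B) * Real.exp l * 2 ^ (1 / 2 : ℝ), by positivity,
    fun t ht => ⟨(hyB t ht).trans (by linarith), ?_⟩⟩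
  have q := Real.rpow_nonneg ht.1.le (-(1 / 2 : ℝ))
  have ht0 := ht.1
  -- Restarting at half the time turns (t-a)^(-1/2) into a multiple of t^(-1/2).
  have := main (t / 2) (by linarith) (by linarith [ht.2]) t ⟨by linarith, ht.2⟩
  refine this.trans ?_
  rw [show t - t / 2 = t / 2 by ring, Real.div_rpow ht.1.le zero_le_two,
    Real.rpow_neg zero_le_two, div_inv_eq_mul]
  have he : Real.exp (l * (t / 2)) ≤ Real.exp l := by
    apply Real.exp_le_exp.2
    exact mul_le_of_le_one_right hl0.le (by linarith [ht.2])
  have hBq : 0 ≤ B * t ^ (-(1 / 2 : ℝ)) := by positivity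
  calc _ ≤ 2 * (C * B) * (Real.exp l * (t ^ (-(1 / 2 : ℝ)) * 2 ^ (1 / 2 : ℝ))) := by
        gcongr
    _ ≤ B * t ^ (-(1 / 2 : ℝ)) +
      2 * (C * B) * (Real.exp l * (t ^ (-(1 / 2 : ℝ)) * 2 ^ (1 / 2 : ℝ))) := by linarith
    _ = _ := by ring

-- Banach's fixed point theorem after the change of unknowns z = (exp(-lt) y, exp(-lt) t^(1/2) h).
-- Under it the weighted norm becomes the supremum norm of bounded continuous functions on (0,1], a
-- complete space, and bounded paths correspond to its elements.
open BoundedContinuousFunction in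
theorem exists_duhamel [CompleteSpace Y] [CompleteSpace H] {y₀ : ℝ → Y} {h₀ : ℝ → H}
    (hyh₀ : IsBoundedPath y₀ h₀) :
    ∃ (y : ℝ → Y) (h : ℝ → H), IsBoundedPath y h ∧
      (∀ t ∈ Ioc (0 : ℝ) 1, y t = y₀ t + ∫ s in Ioo 0 t, P.S (t - s) (P.N s (y s) (h s))) ∧
      (∀ t ∈ Ioc (0 : ℝ) 1, h t = h₀ t + ∫ s in Ioo 0 t, P.D (t - s) (P.N s (y s) (h s))) := by
  obtain ⟨l, δ, hl0, hl, hAδ⟩ := P.exists_half_weightedBound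
  -- Paths are functions on the whole line; the value outside (0,1] plays no role.
  let ext : (Ioc (0 : ℝ) 1 →ᵇ Y × H) → ℝ → Y × H := fun z => Function.extend Subtype.val z 0
  have hext : ∀ z (t : Ioc (0 : ℝ) 1), ext z t = z t := fun z t =>
    Subtype.val_injective.extend_apply _ _ _
  have hextc : ∀ z, ContinuousOn (ext z) (Ioc 0 1) := by
    intro z
    rw [continuousOn_iff_continuous_domRestrict]
    have : (Ioc (0 : ℝ) 1).domRestrict (ext z) = z := funext fun t => hext z t
    rw [this]; exact z.continuous
  let y : (Ioc (0 : ℝ) 1 →ᵇ Y × H) → ℝ → Y := fun z t => Real.exp (l * t) • (ext z t).1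
  let h : (Ioc (0 : ℝ) 1 →ᵇ Y × H) → ℝ → H := fun z t =>
    (Real.exp (l * t) * t ^ (-(1 / 2 : ℝ))) • (ext z t).2
  have hsub : ∀ z z' M, 0 ≤ M → (dist z z' ≤ M ↔ ∀ t ∈ Ioc (0 : ℝ) 1,
      ‖y z t - y z' t‖ ≤ M * Real.exp (l * t) ∧
      ‖h z t - h z' t‖ ≤ M * (Real.exp (l * t) * t ^ (-(1 / 2 : ℝ)))) := by
    intro z z' M hM
    rw [BoundedContinuousFunction.dist_le hM]
    have : ∀ t (ht : t ∈ Ioc (0 : ℝ) 1), dist (z ⟨t, ht⟩) (z' ⟨t, ht⟩) ≤ M ↔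
      (‖y z t - y z' t‖ ≤ M * Real.exp (l * t) ∧
      ‖h z t - h z' t‖ ≤ M * (Real.exp (l * t) * t ^ (-(1 / 2 : ℝ)))) := by
      intro t ht
      have e0 : 0 < Real.exp (l * t) := Real.exp_pos _
      have e1 : 0 < Real.exp (l * t) * t ^ (-(1 / 2 : ℝ)) :=
        mul_pos e0 (Real.rpow_pos_of_pos ht.1 _)
      simp only [y, h, ← smul_sub, norm_smul, Real.norm_of_nonneg e0.le, Real.norm_of_nonneg e1.le]
      rw [mul_comm (Real.exp _) ‖_‖, mul_comm (_ * _) ‖_‖, mul_le_mul_iff_left₀ e0,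
        mul_le_mul_iff_left₀ e1, hext z ⟨t, ht⟩, hext z' ⟨t, ht⟩, Prod.dist_eq, max_le_iff,
        dist_eq_norm, dist_eq_norm]
    constructor
    · intro H t ht; exact (this t ht).1 (H _)
    · intro H t; exact (this t t.2).2 (H t t.2)
  have hpow : ContinuousOn (fun t : ℝ => t ^ (-(1 / 2 : ℝ))) (Ioc 0 1) := fun t ht =>
    (Real.continuousAt_rpow_const t _ (Or.inl ht.1.ne')).continuousWithinAt
  have hexpc : ContinuousOn (fun t : ℝ => Real.exp (l * t)) (Ioc 0 1) := by fun_prop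
  have hz0 : ∀ t, y 0 t = 0 ∧ h 0 t = 0 := by
    intro t
    have : ext 0 t = 0 := by
      by_cases ht : t ∈ Ioc (0 : ℝ) 1
      · exact hext 0 ⟨t, ht⟩
      · have hne : ¬∃ a : Ioc (0 : ℝ) 1, (a : ℝ) = t := by
          rintro ⟨a, rfl⟩; exact ht a.2
        simp only [ext, Function.extend_apply' _ _ _ hne, Pi.zero_apply]
    simp [y, h, this]
  have hpath : ∀ z, IsBoundedPath (y z) (h z) := by
    intro z
    refine ⟨hexpc.smul (continuous_fst.comp_continuousOn (hextc z)),
      (hexpc.mul hpow).smul (continuous_snd.comp_continuousOn (hextc z)),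
      ‖z‖ * Real.exp l, by positivity, fun t ht => ?_⟩
    have := (hsub z 0 ‖z‖ (norm_nonneg z)).1 (by rw [dist_zero_right]) t ht
    rw [(hz0 t).1, (hz0 t).2, sub_zero, sub_zero] at this
    have he : Real.exp (l * t) ≤ Real.exp l :=
      Real.exp_le_exp.2 (mul_le_of_le_one_right hl0.le ht.2)
    have q := Real.rpow_nonneg ht.1.le (-(1 / 2 : ℝ))
    refine ⟨this.1.trans (by gcongr), this.2.trans ?_⟩
    rw [mul_assoc]; gcongr
  have hlift : ∀ (y' : ℝ → Y) (h' : ℝ → H), IsBoundedPath y' h' →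
      ∃ z, EqOn (y z) y' (Ioc 0 1) ∧ EqOn (h z) h' (Ioc 0 1) := by
    intro y' h' hyh'
    obtain ⟨B, hB0, hB⟩ := hyh'.bound
    have hc : ContinuousOn (fun t => (Real.exp (-(l * t)) • y' t,
        (Real.exp (-(l * t)) * t ^ (1 / 2 : ℝ)) • h' t)) (Ioc 0 1) := by
      refine ContinuousOn.prodMk (ContinuousOn.smul (by fun_prop) hyh'.1)
        (ContinuousOn.smul (ContinuousOn.mul (by fun_prop) ?_) hyh'.2)
      exact (Real.continuous_rpow_const (by norm_num)).continuousOn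
    rw [continuousOn_iff_continuous_domRestrict] at hc
    let z : Ioc (0 : ℝ) 1 →ᵇ Y × H := BoundedContinuousFunction.ofNormedAddCommGroup _ hc B (by
      rintro ⟨t, ht⟩
      have he : Real.exp (-(l * t)) ≤ 1 := by
        rw [Real.exp_le_one_iff]; have := ht.1; have : 0 ≤ l * t := by positivity
        linarith
      have ht0 := ht.1
      simp only [Set.domRestrict_apply, Prod.norm_def, max_le_iff, norm_smul, norm_mul]
      rw [Real.norm_of_nonneg (Real.exp_pos _).le, 
        Real.norm_of_nonneg (Real.rpow_nonneg ht0.le _)]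
      refine ⟨(mul_le_of_le_one_left (norm_nonneg _) he).trans (hB t ht).1, ?_⟩
      calc _ ≤ 1 * t ^ (1 / 2 : ℝ) * (B * t ^ (-(1 / 2 : ℝ))) := by
            gcongr; exact (hB t ht).2
        _ = B * (t ^ (1 / 2 : ℝ) * t ^ (-(1 / 2 : ℝ))) := by ring
        _ = B := by rw [← Real.rpow_add ht0]; simp)
    refine ⟨z, fun t ht => ?_, fun t ht => ?_⟩
    · simp only [y]
      rw [hext z ⟨t, ht⟩]
      change Real.exp (l * t) • (Real.exp (-(l * t)) • y' t) = _
      rw [smul_smul, ← Real.exp_add]; simp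
    · simp only [h]
      rw [hext z ⟨t, ht⟩]
      change (Real.exp (l * t) * t ^ (-(1 / 2 : ℝ))) •
        ((Real.exp (-(l * t)) * t ^ (1 / 2 : ℝ)) • h' t) = _
      rw [smul_smul, mul_mul_mul_comm, ← Real.exp_add, ← Real.rpow_add ht.1]; simp
  -- The Duhamel map, transported to the space of bounded continuous functions.
  choose Φ hΦy hΦh using fun z => hlift _ _ (isBoundedPath_duhamel (P := P) (hpath z) hyh₀)
  have hΦ : ContractingWith (1 / 2) Φ := by
    refine ⟨by norm_num, LipschitzWith.of_dist_le_mul fun z z' => ?_⟩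
    rw [hsub _ _ _ (by positivity)]
    intro t ht
    have hM : 0 ≤ dist z z' := dist_nonneg
    obtain ⟨h1, h2⟩ := P.duhamel_contraction hl (hpath z) (hpath z') hM
      ((hsub z z' _ hM).1 le_rfl) ht
    have hM2 : P.A * (2 * dist z z') * δ ≤ ((1 / 2 : NNReal) : ℝ) * dist z z' := by
      have := hAδ _ hM
      push_cast; linarith
    have := Real.rpow_nonneg ht.1.le (-(1 / 2 : ℝ))
    rw [hΦy z ht, hΦy z' ht, hΦh z ht, hΦh z' ht]
    simp only [add_sub_add_left_eq_sub]
    exact ⟨h1.trans (by gcongr), h2.trans (by gcongr)⟩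
  set z := hΦ.fixedPoint with hz
  have hfix : Φ z = z := hΦ.fixedPoint_isFixedPt
  refine ⟨y z, h z, hpath z, fun t ht => ?_, fun t ht => ?_⟩
  · have := hΦy z ht
    rwa [hfix] at this
  · have := hΦh z ht
    rwa [hfix] at this

end SingularSystem

/-! ### Convolution on Lebesgue spaces -/

section Convolution

variable {d : ℕ} {q r : ℝ≥0∞}

/-- The translate `x ↦ h (x - y)`. -/
def translate (y : Space d) (h : LSpace d q) : LSpace d q :=
  Lp.compMeasurePreserving (fun x => x - y) (measurePreserving_sub_right volume y) h

theorem coeFn_translate (y : Space d) (h : LSpace d q) :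
    translate y h =ᵐ[volume] fun x => h (x - y) :=
  Lp.coeFn_compMeasurePreserving h (measurePreserving_sub_right volume y)

theorem norm_translate (y : Space d) (h : LSpace d q) : ‖translate y h‖ = ‖h‖ :=
  Lp.norm_compMeasurePreserving h _

theorem translate_add (y : Space d) (h h' : LSpace d q) :
    translate y (h + h') = translate y h + translate y h' :=
  map_add (Lp.compMeasurePreserving _ _) h h'

theorem translate_smul (y : Space d) (c : ℝ) (h : LSpace d q) :
    translate y (c • h) = c • translate y h :=
  (Lp.compMeasurePreservingₗ ℝ _ (measurePreserving_sub_right volume y)).map_smul c h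

theorem translate_zero (h : LSpace d q) : translate 0 h = h := by
  apply Lp.ext
  filter_upwards [coeFn_translate 0 h] with x hx
  rw [hx, sub_zero]

variable [Fact (1 ≤ q)]

theorem continuous_translate (hq : q ≠ ⊤) (h : LSpace d q) :
    Continuous fun y : Space d => translate y h := by
  let g : C(Space d, C(Space d, Space d)) :=
    (ContinuousMap.mk (fun a : Space d × Space d => a.2 - a.1) (by fun_prop)).curry
  exact Continuous.compMeasurePreservingLp (f := fun _ : Space d => h) continuous_const
    g.continuous (fun y => measurePreserving_sub_right volume y) hq

theorem integrable_smul_translate (hq : q ≠ ⊤) {k : Space d → ℝ} (hk : Integrable k)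
    (h : LSpace d q) : Integrable fun y => k y • translate y h := by
  refine Integrable.mono' (hk.norm.mul_const ‖h‖)
    (hk.1.smul (continuous_translate hq h).aestronglyMeasurable) (Eventually.of_forall fun y => ?_)
  rw [norm_smul, norm_translate]

/-- Convolution `L¹ × L^q → L^q`, as a Bochner integral of translates. -/
def convL (d : ℕ) {q : ℝ≥0∞} [Fact (1 ≤ q)] (hq : q ≠ ⊤) :
    LSpace d 1 →L[ℝ] LSpace d q →L[ℝ] LSpace d q :=
  LinearMap.mkContinuous₂
    (LinearMap.mk₂ ℝ (fun k h => ∫ y, k y • translate y h)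
      (fun k k' h => by
        rw [← integral_add (integrable_smul_translate hq (L1.integrable_coeFn k) h)
          (integrable_smul_translate hq (L1.integrable_coeFn k') h)]
        refine integral_congr_ae ?_
        filter_upwards [Lp.coeFn_add k k'] with y hy
        rw [hy, Pi.add_apply, add_smul])
      (fun c k h => by
        rw [← integral_smul]
        refine integral_congr_ae ?_
        filter_upwards [Lp.coeFn_smul c k] with y hy
        rw [hy, Pi.smul_apply, smul_assoc])
      (fun k h h' => by
        rw [← integral_add (integrable_smul_translate hq (L1.integrable_coeFn k) h)
          (integrable_smul_translate hq (L1.integrable_coeFn k) h')]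
        simp only [translate_add, smul_add])
      (fun c k h => by
        rw [← integral_smul]
        simp only [translate_smul, smul_comm c]))
    1 (fun k h => by
      rw [LinearMap.mk₂_apply, one_mul, L1.norm_eq_integral_norm, ← integral_mul_const]
      refine (norm_integral_le_integral_norm _).trans_eq ?_
      simp only [norm_smul, norm_translate])

theorem convL_apply (hq : q ≠ ⊤) (k : LSpace d 1) (h : LSpace d q) :
    convL d hq k h = ∫ y, k y • translate y h := rfl

theorem norm_convL_apply_le (hq : q ≠ ⊤) (k : LSpace d 1) (h : LSpace d q) :
    ‖convL d hq k h‖ ≤ ‖k‖ * ‖h‖ := by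
  rw [convL_apply, L1.norm_eq_integral_norm, ← integral_mul_const]
  refine (norm_integral_le_integral_norm _).trans_eq ?_
  simp only [norm_smul, norm_translate]

/-- Integration against a function in the dual Lebesgue space. -/
def pairing [Fact (1 ≤ r)] [ENNReal.HolderConjugate r q] (ψ : LSpace d r) : LSpace d q →L[ℝ] ℝ :=
  (ContinuousLinearMap.mul ℝ ℝ).lpPairing volume r q ψ

theorem pairing_apply [Fact (1 ≤ r)] [ENNReal.HolderConjugate r q] (ψ : LSpace d r)
    (f : LSpace d q) : pairing ψ f = ∫ x, ψ x * f x :=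
  ContinuousLinearMap.lpPairing_eq_integral _ _ _

theorem pairing_toLp [Fact (1 ≤ r)] [ENNReal.HolderConjugate r q] {ψ : Space d → ℝ}
    (hψ : MemLp ψ r volume) (f : LSpace d q) : pairing (hψ.toLp ψ) f = ∫ x, ψ x * f x := by
  rw [pairing_apply]
  refine integral_congr_ae ?_
  filter_upwards [hψ.coeFn_toLp] with x hx
  rw [hx]

end Convolution

/-- The convolution of `K` and `h` converges absolutely and uniformly. -/
structure ConvBounded {d : ℕ} (K h : Space d → ℝ) : Prop where
  left : AEStronglyMeasurable K volume
  right : AEStronglyMeasurable h volume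
  bound : ∃ C : ℝ, ∀ x, Integrable (fun z => K z * h (x - z)) ∧ ∫ z, ‖K z * h (x - z)‖ ≤ C

/-! ### Absolutely convergent convolutions and Fubini's theorem. -/

namespace ConvBounded

variable {d : ℕ} {K h : Space d → ℝ}

theorem symm (H : ConvBounded K h) : ConvBounded h K := by
  obtain ⟨C, hC⟩ := H.bound
  refine ⟨H.right, H.left, C, fun x => ?_⟩
  have e : ∀ z, h z * K (x - z) = (fun z => K z * h (x - z)) (x - z) := fun z => by
    simp only [sub_sub_cancel]; ring
  constructor
  · simp only [e]; exact (hC x).1.comp_sub_left x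
  · simp only [e]
    rw [integral_sub_left_eq_self (fun z => ‖K z * h (x - z)‖) volume x]
    exact (hC x).2

theorem of_memLp {r q : ℝ≥0∞} [ENNReal.HolderConjugate r q] (hK : MemLp K r volume)
    (hh : MemLp h q volume) : ConvBounded K h := by
  refine ⟨hK.1, hh.1, (eLpNorm K r volume * eLpNorm h q volume).toReal, fun x => ?_⟩
  have hmp := Measure.measurePreserving_sub_left (volume : Measure (Space d)) x
  have hx : MemLp (fun z => h (x - z)) q volume := hh.comp_measurePreserving hmp
  have hi : Integrable (fun z => K z * h (x - z)) := hK.integrable_mul hx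
  refine ⟨hi, ?_⟩
  rw [integral_norm_eq_lintegral_enorm hi.1, ← eLpNorm_one_eq_lintegral_enorm]
  refine ENNReal.toReal_mono (ENNReal.mul_ne_top hK.eLpNorm_ne_top hh.eLpNorm_ne_top) ?_
  have := eLpNorm_smul_le_mul_eLpNorm (p := r) (q := q) (r := 1) hx.1 hK.1
  rw [show eLpNorm h q volume = eLpNorm (fun z => h (x - z)) q volume from
    (eLpNorm_comp_measurePreserving hh.1 hmp).symm]
  exact this

theorem add_right {h' : Space d → ℝ} (H : ConvBounded K h) (H' : ConvBounded K h') :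
    ConvBounded K (fun x => h x + h' x) := by
  obtain ⟨C, hC⟩ := H.bound
  obtain ⟨C', hC'⟩ := H'.bound
  refine ⟨H.left, H.right.add H'.right, C + C', fun x => ?_⟩
  simp only [mul_add]
  refine ⟨(hC x).1.add (hC' x).1, ?_⟩
  calc ∫ z, ‖K z * h (x - z) + K z * h' (x - z)‖
      ≤ ∫ z, (‖K z * h (x - z)‖ + ‖K z * h' (x - z)‖) := by
        refine integral_mono ((hC x).1.add (hC' x).1).norm ((hC x).1.norm.add (hC' x).1.norm)
          fun z => norm_add_le _ _
    _ = _ := integral_add (hC x).1.norm (hC' x).1.norm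
    _ ≤ C + C' := add_le_add (hC x).2 (hC' x).2

theorem congr_right {h' : Space d → ℝ} (H : ConvBounded K h) (hh : h =ᵐ[volume] h') :
    ConvBounded K h' := by
  obtain ⟨C, hC⟩ := H.bound
  refine ⟨H.left, H.right.congr hh, C, fun x => ?_⟩
  have : (fun z => K z * h (x - z)) =ᵐ[volume] fun z => K z * h' (x - z) := by
    filter_upwards [(quasiMeasurePreserving_sub_left volume x).ae hh] with z hz
    rw [hz]
  refine ⟨(hC x).1.congr this, ?_⟩
  exact (integral_congr_ae (this.fun_comp norm)).symm.trans_le (hC x).2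

theorem norm (H : ConvBounded K h) : ConvBounded (fun x => ‖K x‖) (fun x => ‖h x‖) := by
  obtain ⟨C, hC⟩ := H.bound
  refine ⟨H.left.norm, H.right.norm, C, fun x => ?_⟩
  have := hC x
  simp only [norm_mul] at this
  refine ⟨?_, by simpa only [norm_mul, norm_norm] using this.2⟩
  simpa only [norm_mul] using this.1.norm

/-- The bound on the inner integral is uniform in x, so the iterated integral is dominated by a
multiple of |ψ|. This licenses the exchange of integrals in every duality argument below. -/
theorem integrable_prod (H : ConvBounded K h) {ψ : Space d → ℝ} (hψ : Integrable ψ) :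
    Integrable (fun p : Space d × Space d => ψ p.1 * (K p.2 * h (p.1 - p.2)))
      (volume.prod volume) := by
  obtain ⟨C, hC⟩ := H.bound
  have hm : AEStronglyMeasurable
      (fun p : Space d × Space d => ψ p.1 * (K p.2 * h (p.1 - p.2))) (volume.prod volume) := by
    refine hψ.1.comp_fst.mul (H.left.comp_snd.mul ?_)
    exact H.right.comp_quasiMeasurePreserving (quasiMeasurePreserving_sub volume volume)
  rw [integrable_prod_iff hm]
  refine ⟨Eventually.of_forall fun x => (hC x).1.const_mul (ψ x), ?_⟩
  refine Integrable.mono' (hψ.norm.mul_const C) hm.norm.integral_prod_right'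
    (Eventually.of_forall fun x => ?_)
  rw [Real.norm_of_nonneg (integral_nonneg fun _ => norm_nonneg _)]
  simp only [norm_mul (ψ x)]
  rw [integral_const_mul]
  exact mul_le_mul_of_nonneg_left (hC x).2 (norm_nonneg _)

end ConvBounded

/-- The pointwise convolution `K ⋆ h`. -/
def conv {d : ℕ} (K h : Space d → ℝ) : Space d → ℝ :=
  convolution K h (ContinuousLinearMap.mul ℝ ℝ) volume

section

variable {d : ℕ} {K h : Space d → ℝ}

theorem conv_apply (x : Space d) : conv K h x = ∫ z, K z * h (x - z) := rfl

theorem conv_comm (K h : Space d → ℝ) : conv K h = conv h K := by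
  ext x
  rw [conv_apply, conv_apply, ← integral_sub_left_eq_self (fun z => h z * K (x - z)) volume x]
  simp only [sub_sub_cancel, mul_comm]

theorem conv_congr_right {h' : Space d → ℝ} (hh : h =ᵐ[volume] h') : conv K h = conv K h' := by
  ext x
  refine integral_congr_ae ?_
  filter_upwards [(quasiMeasurePreserving_sub_left volume x).ae hh] with z hz
  rw [hz]

theorem conv_add_right {h' : Space d → ℝ} (H : ConvBounded K h) (H' : ConvBounded K h') :
    conv K (fun x => h x + h' x) = fun x => conv K h x + conv K h' x := by
  obtain ⟨C, hC⟩ := H.bound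
  obtain ⟨C', hC'⟩ := H'.bound
  ext x
  simp only [conv_apply, mul_add]
  exact integral_add (hC x).1 (hC' x).1

theorem ConvBounded.integrable_mul_conv (H : ConvBounded K h) {ψ : Space d → ℝ}
    (hψ : Integrable ψ) : Integrable (fun x => ψ x * conv K h x) := by
  have := (H.integrable_prod hψ).integral_prod_left
  simpa only [integral_const_mul, conv_apply] using this

theorem ConvBounded.integral_mul_conv (H : ConvBounded K h) {ψ : Space d → ℝ}
    (hψ : Integrable ψ) :
    ∫ x, ψ x * conv K h x = ∫ z, K z * ∫ x, ψ x * h (x - z) := by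
  have := integral_integral_swap (f := fun x z => ψ x * (K z * h (x - z))) (H.integrable_prod hψ)
  simp only [integral_const_mul] at this
  simp only [conv_apply]
  rw [this]
  refine integral_congr_ae (Eventually.of_forall fun z => ?_)
  simp only
  rw [← integral_const_mul]
  refine integral_congr_ae (Eventually.of_forall fun x => ?_)
  simp only; ring

theorem ConvBounded.norm_conv_le (H : ConvBounded K h) : ∃ C, ∀ x, ‖conv K h x‖ ≤ C := by
  obtain ⟨C, hC⟩ := H.bound
  exact ⟨C, fun x => (norm_integral_le_integral_norm _).trans (hC x).2⟩

/-- Both sides are integrated over sets of finite measure. Indicators of such sets lie in the dual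
space L^r, and the resulting continuous functional passes through the Bochner integral of
translates; on the pointwise side Fubini gives the same value. -/
theorem convL_ae_eq {q r : ℝ≥0∞} [Fact (1 ≤ q)] [Fact (1 ≤ r)] [ENNReal.HolderConjugate r q]
    (hq : q ≠ ⊤) (k : LSpace d 1) (h : LSpace d q) (H : ConvBounded k h) :
    convL d hq k h =ᵐ[volume] conv k h := by
  have hind : ∀ (s : Set (Space d)) (f : Space d → ℝ), MeasurableSet s →
      ∫ x in s, f x = ∫ x, s.indicator 1 x * f x := fun s f hs => by
    rw [← integral_indicator hs]
    refine integral_congr_ae (Eventually.of_forall fun x => ?_)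
    by_cases hx : x ∈ s <;> simp [hx]
  have hint : ∀ s : Set (Space d), MeasurableSet s → volume s < ⊤ →
      Integrable (s.indicator (1 : Space d → ℝ)) := fun s hs hs' =>
    (integrable_indicator_iff hs).2 (integrableOn_const hs'.ne)
  refine ae_eq_of_forall_setIntegral_eq_of_sigmaFinite ?_ ?_ ?_
  · intro s hs hs'
    have : IsFiniteMeasure (volume.restrict s) := ⟨by simpa using hs'⟩
    exact ((Lp.memLp _).restrict s).integrable Fact.out
  · intro s hs hs'
    have := H.integrable_mul_conv (hint s hs hs')
    rw [← integrable_indicator_iff hs]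
    refine this.congr (Eventually.of_forall fun x => ?_)
    by_cases hx : x ∈ s <;> simp [hx]
  · intro s hs hs'
    have hψ : MemLp (s.indicator (1 : Space d → ℝ)) r volume :=
      memLp_indicator_const r hs 1 (Or.inr hs'.ne)
    rw [hind s _ hs, hind s _ hs, H.integral_mul_conv (hint s hs hs'), ← pairing_toLp hψ,
      convL_apply, ← ContinuousLinearMap.integral_comp_comm _
        (integrable_smul_translate hq (L1.integrable_coeFn k) h)]
    refine integral_congr_ae (Eventually.of_forall fun y => ?_)
    simp only [map_smul, smul_eq_mul]
    rw [pairing_toLp]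
    congr 1
    refine integral_congr_ae ?_
    filter_upwards [coeFn_translate y h] with x hx
    rw [hx]

end

/-! ### Kernels with Gaussian decay -/

section Kernel

variable {d : ℕ}

theorem integrable_exp_neg_mul_sq_norm {b : ℝ} (hb : 0 < b) :
    Integrable (fun x : Space d => Real.exp (-b * ‖x‖ ^ 2)) := by
  by_contra h
  have := GaussianFourier.integral_rexp_neg_mul_sq_norm (V := Space d) hb
  rw [integral_undef h] at this
  have h2 : 0 < (Real.pi / b) ^ (Module.finrank ℝ (Space d) / 2 : ℝ) := by positivity
  linarith

/-- Continuous functions bounded by a multiple of some Gaussian. -/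
def GaussianDecay (φ : Space d → ℝ) : Prop :=
  Continuous φ ∧ ∃ C b : ℝ, 0 ≤ C ∧ 0 < b ∧ ∀ x, ‖φ x‖ ≤ C * Real.exp (-b * ‖x‖ ^ 2)

theorem GaussianDecay.memLp {φ : Space d → ℝ} (hφ : GaussianDecay φ) (p : ℝ≥0∞) :
    MemLp φ p volume := by
  obtain ⟨hc, C, b, hC, hb, hbd⟩ := hφ
  have hexp : MemLp (fun x : Space d => C * Real.exp (-b * ‖x‖ ^ 2)) p volume := by
    apply MemLp.const_mul
    rcases eq_or_ne p ⊤ with rfl | hp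
    · refine memLp_top_of_bound (Continuous.aestronglyMeasurable (by fun_prop)) 1
        (Eventually.of_forall fun x => ?_)
      rw [Real.norm_of_nonneg (Real.exp_pos _).le, Real.exp_le_one_iff]
      have : 0 ≤ b * ‖x‖ ^ 2 := by positivity
      linarith
    rcases eq_or_ne p 0 with rfl | hp0
    · exact memLp_zero_iff_aestronglyMeasurable.2 (Continuous.aestronglyMeasurable (by fun_prop))
    rw [← integrable_norm_rpow_iff (Continuous.aestronglyMeasurable (by fun_prop)) hp0 hp]
    have hpos : 0 < p.toReal := ENNReal.toReal_pos hp0 hp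
    refine (integrable_exp_neg_mul_sq_norm (d := d) (mul_pos hb hpos)).congr
      (Eventually.of_forall fun x => ?_)
    simp only
    rw [Real.norm_of_nonneg (Real.exp_pos _).le, ← Real.exp_mul]
    ring_nf
  exact hexp.mono' hc.aestronglyMeasurable (Eventually.of_forall hbd)

/-- The `L¹`-normalized dilation `x ↦ τ^{-d} φ(x / τ)`. -/
def dilate (τ : ℝ) (φ : Space d → ℝ) (x : Space d) : ℝ := (τ ^ d)⁻¹ * φ (τ⁻¹ • x)

/-- A single Gaussian dominates all dilates with τ between τ₀/2 and 2τ₀: the prefactor is worst at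
τ₀/2 and the decay at 2τ₀. It serves as the majorant for continuity in τ. -/
theorem norm_dilate_le {φ : Space d → ℝ} {C b τ τ₀ : ℝ} (hC : 0 ≤ C) (hb : 0 < b)
    (hbd : ∀ x, ‖φ x‖ ≤ C * Real.exp (-b * ‖x‖ ^ 2)) (hτ₀ : 0 < τ₀) (h1 : τ₀ / 2 ≤ τ)
    (h2 : τ ≤ 2 * τ₀) (x : Space d) :
    ‖dilate τ φ x‖ ≤ (((τ₀ / 2) ^ d)⁻¹ * C) * Real.exp (-(b / (4 * τ₀ ^ 2)) * ‖x‖ ^ 2) := by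
  have hτ : 0 < τ := by linarith
  rw [dilate, norm_mul, Real.norm_of_nonneg (by positivity), mul_assoc]
  gcongr
  refine (hbd _).trans (mul_le_mul_of_nonneg_left (Real.exp_le_exp.2 ?_) hC)
  rw [norm_smul, mul_pow, norm_inv, Real.norm_of_nonneg hτ.le, ← mul_assoc]
  apply mul_le_mul_of_nonneg_right _ (by positivity)
  rw [neg_mul, neg_le_neg_iff, inv_pow, ← div_eq_mul_inv]
  apply div_le_div_of_nonneg_left hb.le (by positivity)
  calc τ ^ 2 ≤ (2 * τ₀) ^ 2 := by gcongr
    _ = _ := by ring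

theorem GaussianDecay.dilate {φ : Space d → ℝ} (hφ : GaussianDecay φ) {τ : ℝ} (hτ : 0 < τ) :
    GaussianDecay (dilate τ φ) := by
  obtain ⟨hc, C, b, hC, hb, hbd⟩ := hφ
  refine ⟨by unfold AllenCahn.dilate; fun_prop, _, _, ?_, ?_,
    norm_dilate_le hC hb hbd hτ (by linarith) (by linarith)⟩ <;> positivity

open Classical in
/-- The class of `K` in `L^p`, if `K` is `p`-integrable. -/
def lpOf (p : ℝ≥0∞) (K : Space d → ℝ) : LSpace d p :=
  if h : MemLp K p volume then h.toLp K else 0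

theorem lpOf_eq {p : ℝ≥0∞} {K : Space d → ℝ} (h : MemLp K p volume) : lpOf p K = h.toLp K :=
  dif_pos h

theorem coeFn_lpOf {p : ℝ≥0∞} {K : Space d → ℝ} (h : MemLp K p volume) :
    lpOf p K =ᵐ[volume] K := by
  rw [lpOf_eq h]; exact h.coeFn_toLp

theorem continuousOn_lpOf_dilate {p : ℝ≥0∞} [Fact (1 ≤ p)] (hp : p ≠ ⊤) {φ : Space d → ℝ}
    (hφ : GaussianDecay φ) : ContinuousOn (fun τ => lpOf p (dilate τ φ)) (Ioi 0) := by
  intro τ₀ hτ₀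
  simp only [mem_Ioi] at hτ₀
  refine ContinuousAt.continuousWithinAt ?_
  have hp0 : p ≠ 0 := (zero_lt_one.trans_le Fact.out).ne'
  have hpos : 0 < p.toReal := ENNReal.toReal_pos hp0 hp
  obtain ⟨hc, C, b, hC, hb, hbd⟩ := id hφ
  have hnear : ∀ᶠ τ in 𝓝 τ₀, τ₀ / 2 ≤ τ ∧ τ ≤ 2 * τ₀ :=
    (eventually_ge_nhds (by linarith)).and (eventually_le_nhds (by linarith))
  have hpos' : ∀ᶠ τ in 𝓝 τ₀, 0 < τ := eventually_gt_nhds hτ₀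
  have hlim : ∀ x, Tendsto (fun τ => dilate τ φ x) (𝓝 τ₀) (𝓝 (dilate τ₀ φ x)) := by
    intro x
    have h1 : ContinuousAt (fun τ : ℝ => (τ ^ d)⁻¹) τ₀ :=
      ContinuousAt.inv₀ (by fun_prop) (by positivity)
    have h2 : ContinuousAt (fun τ : ℝ => φ (τ⁻¹ • x)) τ₀ :=
      hc.continuousAt.comp ((continuousAt_inv₀ hτ₀.ne').smul continuousAt_const)
    exact h1.mul h2
  set C' := ((τ₀ / 2) ^ d)⁻¹ * C with hC'
  set b' := b / (4 * τ₀ ^ 2) with hb'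
  have hC'0 : 0 ≤ C' := by positivity
  have hb'0 : 0 < b' := by positivity
  rw [ContinuousAt, Lp.tendsto_Lp_iff_tendsto_eLpNorm']
  have hdom : GaussianDecay (fun x : Space d => 2 * C' * Real.exp (-b' * ‖x‖ ^ 2)) :=
    ⟨by fun_prop, 2 * C', b', by positivity, hb'0, fun x => by
      rw [Real.norm_of_nonneg (by positivity)]⟩
  have key : Tendsto (fun τ => ∫⁻ x, ‖dilate τ φ x - dilate τ₀ φ x‖ₑ ^ p.toReal) (𝓝 τ₀)
      (𝓝 (∫⁻ _ : Space d, 0)) := by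
    refine tendsto_lintegral_filter_of_dominated_convergence
      (fun x => ‖2 * C' * Real.exp (-b' * ‖x‖ ^ 2)‖ₑ ^ p.toReal) ?_ ?_ ?_ ?_
    · filter_upwards [hpos'] with τ hτ
      have := (hφ.dilate hτ).1.measurable
      have := (hφ.dilate hτ₀).1.measurable
      fun_prop
    · filter_upwards [hnear] with τ hτ
      refine Eventually.of_forall fun x => ENNReal.rpow_le_rpow ?_ hpos.le
      rw [enorm_le_iff_norm_le]
      refine (norm_sub_le _ _).trans ?_
      have h1 := norm_dilate_le hC hb hbd hτ₀ hτ.1 hτ.2 x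
      have h2 := norm_dilate_le hC hb hbd hτ₀ (show τ₀ / 2 ≤ τ₀ by linarith) (by linarith) x
      rw [Real.norm_of_nonneg (show 0 ≤ 2 * C' * Real.exp (-b' * ‖x‖ ^ 2) by positivity)]
      linarith
    · have := (hdom.memLp p).eLpNorm_lt_top
      rw [eLpNorm_eq_lintegral_rpow_enorm_toReal hp0 hp] at this
      intro h
      rw [h, ENNReal.top_rpow_of_pos (by positivity)] at this
      exact lt_irrefl _ this
    · refine Eventually.of_forall fun x => ?_
      have h1 : Tendsto (fun τ => ‖dilate τ φ x - dilate τ₀ φ x‖ₑ) (𝓝 τ₀) (𝓝 0) := by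
        have := ((hlim x).sub_const (dilate τ₀ φ x)).enorm
        simpa using this
      have := (ENNReal.continuous_rpow_const (y := p.toReal)).tendsto 0 |>.comp h1
      rwa [ENNReal.zero_rpow_of_pos hpos] at this
  have key2 := (ENNReal.continuous_rpow_const (y := 1 / p.toReal)).tendsto _ |>.comp key
  rw [lintegral_zero, ENNReal.zero_rpow_of_pos (by positivity)] at key2
  refine key2.congr' ?_
  filter_upwards [hpos'] with τ hτ
  rw [Function.comp_apply, ← eLpNorm_eq_lintegral_rpow_enorm_toReal hp0 hp]
  refine eLpNorm_congr_ae ?_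
  filter_upwards [coeFn_lpOf ((hφ.dilate hτ).memLp p), coeFn_lpOf ((hφ.dilate hτ₀).memLp p)]
    with x h1 h2
  simp only [Pi.sub_apply]
  rw [h1, h2]

/-- The source of the singular exponents: for p = 1 the norm does not depend on τ, while in L^q it
is of order τ^(-(d - d/q)), the price of smoothing L¹ into L^q. -/
theorem norm_lpOf_dilate {p : ℝ≥0∞} (hp : p ≠ ⊤) {φ : Space d → ℝ}
    (hφ : GaussianDecay φ) {τ : ℝ} (hτ : 0 < τ) :
    ‖lpOf p (dilate τ φ)‖ = τ ^ (-(d : ℝ) + d / p.toReal) * ‖lpOf p φ‖ := by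
  rw [lpOf_eq ((hφ.dilate hτ).memLp p), lpOf_eq (hφ.memLp p), Lp.norm_toLp, Lp.norm_toLp]
  have hmap := Measure.map_addHaar_smul (volume : Measure (Space d)) (inv_ne_zero hτ.ne')
  have h1 : eLpNorm (fun x : Space d => φ (τ⁻¹ • x)) p volume =
      ENNReal.ofReal (τ ^ d) ^ (1 / p).toReal * eLpNorm φ p volume := by
    have h2 := eLpNorm_map_measure (p := p) (μ := (volume : Measure (Space d)))
      (f := fun x => τ⁻¹ • x) (g := φ) hφ.1.aestronglyMeasurable (by fun_prop)
    rw [Function.comp_def] at h2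
    rw [← h2, hmap, eLpNorm_smul_measure_of_ne_top hp, smul_eq_mul]
    congr 3
    rw [finrank_euclideanSpace_fin, inv_pow, inv_inv, abs_of_pos (by positivity)]
  have h3 : eLpNorm (dilate τ φ) p volume =
      ENNReal.ofReal ((τ ^ d)⁻¹) * eLpNorm (fun x : Space d => φ (τ⁻¹ • x)) p volume := by
    have := eLpNorm_const_smul (p := p) (μ := (volume : Measure (Space d))) ((τ ^ d)⁻¹)
      (fun x : Space d => φ (τ⁻¹ • x))
    rw [Real.enorm_eq_ofReal (by positivity)] at this
    exact this
  rw [h3, h1, ENNReal.toReal_mul, ENNReal.toReal_mul, ENNReal.toReal_ofReal (by positivity),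
    ← ENNReal.toReal_rpow, ENNReal.toReal_ofReal (by positivity), ← mul_assoc,
    Real.rpow_add hτ, Real.rpow_neg hτ.le, Real.rpow_natCast, ← Real.rpow_natCast τ d,
    ← Real.rpow_mul hτ.le]
  congr 3
  rw [one_div, ENNReal.toReal_inv, div_eq_mul_inv]

end Kernel

/-! ### The heat kernel -/

section Gaussian

variable {d : ℕ}

theorem gaussianDecay_gaussian_one : GaussianDecay (gaussian 1 : Space d → ℝ) := by
  refine ⟨by unfold gaussian; fun_prop, ((2 * Real.pi) ^ ((d : ℝ) / 2))⁻¹, 1 / 2, by positivity,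
    by norm_num, fun x => ?_⟩
  rw [gaussian, one_pow, one_pow, mul_one, Real.norm_of_nonneg (by positivity), div_eq_inv_mul]
  ring_nf
  exact le_rfl

theorem gaussian_eq_dilate {τ : ℝ} (hτ : 0 < τ) :
    (gaussian τ : Space d → ℝ) = dilate τ (gaussian 1) := by
  ext x
  rw [dilate, gaussian, gaussian, norm_smul, norm_inv, Real.norm_of_nonneg hτ.le]
  rw [show -(τ⁻¹ * ‖x‖) ^ 2 / (2 * 1 ^ 2) = -‖x‖ ^ 2 / (2 * τ ^ 2) by field_simp, one_pow]
  field_simp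

theorem gaussianDecay_gaussian {τ : ℝ} (hτ : 0 < τ) : GaussianDecay (gaussian τ : Space d → ℝ) := by
  rw [gaussian_eq_dilate hτ]; exact gaussianDecay_gaussian_one.dilate hτ

/-- The partial derivative `∂_i η_1`. -/
def gaussianPartial (i : Fin d) (x : Space d) : ℝ := -(x i) * gaussian 1 x

theorem gaussianDecay_gaussianPartial (i : Fin d) : GaussianDecay (gaussianPartial i) := by
  refine ⟨?_, 2 * ((2 * Real.pi) ^ ((d : ℝ) / 2))⁻¹, 1 / 4, by positivity,
    by norm_num, fun x => ?_⟩
  · unfold gaussianPartial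
    have := gaussianDecay_gaussian_one (d := d).1
    fun_prop
  · have hg : gaussian 1 x = Real.exp (-‖x‖ ^ 2 / 2) / (2 * Real.pi) ^ ((d : ℝ) / 2) := by
      simp [gaussian]
    rw [gaussianPartial, norm_mul, norm_neg, hg,
      Real.norm_of_nonneg (r := Real.exp _ / _) (by positivity)]
    -- Half of the Gaussian exponent is sacrificed to absorb the linear factor.
    have h1 : ‖x i‖ ≤ 2 * Real.exp (1 / 4 * ‖x‖ ^ 2) := by
      have e := Real.add_one_le_exp (1 / 4 * ‖x‖ ^ 2)
      have := PiLp.norm_apply_le x i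
      nlinarith [sq_nonneg (‖x‖ - 2)]
    calc _ ≤ 2 * Real.exp (1 / 4 * ‖x‖ ^ 2) *
          (Real.exp (-‖x‖ ^ 2 / 2) / (2 * Real.pi) ^ ((d : ℝ) / 2)) := by
          gcongr
      _ = 2 * ((2 * Real.pi) ^ ((d : ℝ) / 2))⁻¹ *
          (Real.exp (1 / 4 * ‖x‖ ^ 2) * Real.exp (-‖x‖ ^ 2 / 2)) := by
          field_simp
      _ ≤ _ := by
        rw [← Real.exp_add]
        apply le_of_eq
        ring_nf

theorem differentiable_gaussian (τ : ℝ) : Differentiable ℝ (gaussian τ : Space d → ℝ) := by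
  unfold gaussian
  intro x
  have := (contDiff_norm_sq ℝ (E := Space d) (n := 1)).differentiable one_ne_zero x
  fun_prop

/-- By scaling, a derivative of the Gaussian is a dilate of one fixed profile with an extra factor
τ⁻¹. With τ = σ√t this is the t^(-1/2) of the gradient bound. -/
theorem fderiv_gaussian_single {τ : ℝ} (hτ : 0 < τ) (i : Fin d) (x : Space d) :
    fderiv ℝ (gaussian τ) x (EuclideanSpace.single i 1) =
      τ⁻¹ * dilate τ (gaussianPartial i) x := by
  have h1 : HasFDerivAt (fun x : Space d => ‖x‖ ^ 2) (2 • innerSL ℝ x) x :=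
    (hasStrictFDerivAt_norm_sq x).hasFDerivAt
  have h2 : HasFDerivAt (gaussian τ : Space d → ℝ)
      ((((2 * Real.pi) ^ ((d : ℝ) / 2) * τ ^ d)⁻¹) • (Real.exp (-(2 * τ ^ 2)⁻¹ * ‖x‖ ^ 2) •
        (-(2 * τ ^ 2)⁻¹ • (2 • innerSL ℝ x)))) x := by
    have h3 := ((h1.const_mul (-(2 * τ ^ 2)⁻¹)).exp).const_mul
      (((2 * Real.pi) ^ ((d : ℝ) / 2) * τ ^ d)⁻¹)
    refine h3.congr_of_eventuallyEq (Eventually.of_forall fun y => ?_)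
    simp only [gaussian]
    rw [div_eq_inv_mul]
    congr 2
    ring
  rw [h2.fderiv, dilate, gaussianPartial]
  have h4 := congrFun (gaussian_eq_dilate (d := d) hτ) x
  rw [dilate] at h4
  have h5 : gaussian 1 (τ⁻¹ • x) = τ ^ d * gaussian τ x := by
    rw [h4]; field_simp
  rw [h5]
  simp only [smul_apply, innerSL_apply_apply, smul_eq_mul, PiLp.smul_apply,
    EuclideanSpace.inner_single_right, gaussian]
  rw [show -(2 * τ ^ 2)⁻¹ * ‖x‖ ^ 2 = -‖x‖ ^ 2 / (2 * τ ^ 2) by ring]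
  simp
  field_simp

theorem integral_gaussian {τ : ℝ} (hτ : 0 < τ) : ∫ x : Space d, gaussian τ x = 1 := by
  have h := GaussianFourier.integral_rexp_neg_mul_sq_norm (V := Space d)
    (b := (2 * τ ^ 2)⁻¹) (by positivity)
  have e : ∀ x : Space d, gaussian τ x =
      Real.exp (-(2 * τ ^ 2)⁻¹ * ‖x‖ ^ 2) * ((2 * Real.pi) ^ ((d : ℝ) / 2) * τ ^ d)⁻¹ := by
    intro x
    rw [gaussian, div_eq_mul_inv]
    congr 2
    ring
  simp only [e]
  rw [integral_mul_const, h, finrank_euclideanSpace_fin,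
    show Real.pi / (2 * τ ^ 2)⁻¹ = (2 * Real.pi) * τ ^ 2 by field_simp,
    Real.mul_rpow (by positivity) (by positivity), ← Real.rpow_natCast τ 2, ← Real.rpow_mul hτ.le,
    show ((2 : ℕ) : ℝ) * ((d : ℝ) / 2) = (d : ℝ) by push_cast; ring, Real.rpow_natCast]
  field_simp

/-- Completing the square in z factors the integrand into the target Gaussian at x and a normalized
Gaussian centred at (a²/c²)x. -/
theorem conv_gaussian_gaussian {a b : ℝ} (ha : 0 < a) (hb : 0 < b) :
    conv (gaussian a) (gaussian b : Space d → ℝ) = gaussian (√(a ^ 2 + b ^ 2)) := by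
  set c := √(a ^ 2 + b ^ 2) with hc
  have hc0 : 0 < c := by positivity
  have hc2 : c ^ 2 = a ^ 2 + b ^ 2 := Real.sq_sqrt (by positivity)
  ext x
  have hab : 0 < a * b / c := by positivity
  have e : ∀ z : Space d, gaussian a z * gaussian b (x - z) =
      gaussian c x * gaussian (a * b / c) (z - (a ^ 2 / c ^ 2) • x) := by
    intro z
    unfold gaussian
    rw [div_mul_div_comm, div_mul_div_comm, ← Real.exp_add, ← Real.exp_add]
    congr 1
    · congr 1
      rw [norm_sub_sq_real, norm_sub_sq_real, norm_smul, inner_smul_right, real_inner_comm z x,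
        Real.norm_of_nonneg (by positivity)]
      have h1 : b ^ 2 = c ^ 2 - a ^ 2 := by linarith
      have hne : c ^ 2 - a ^ 2 ≠ 0 := by rw [← h1]; positivity
      have h2 : (a * b / c) ^ 2 = a ^ 2 * (c ^ 2 - a ^ 2) / c ^ 2 := by
        rw [div_pow, mul_pow, h1]
      rw [h2, h1]
      field_simp
      ring
    · rw [div_pow, mul_pow]
      field_simp
  rw [conv_apply]
  simp only [e]
  rw [integral_const_mul, integral_sub_right_eq_self (gaussian (a * b / c)), integral_gaussian hab,
    mul_one]

theorem integral_gaussian_mul_partial {τ : ℝ} (hτ : 0 < τ) (i : Fin d) (z : Space d)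
    {φ : Space d → ℝ} (hφ : ContDiff ℝ ∞ φ) (hφc : HasCompactSupport φ) :
    ∫ x, fderiv ℝ φ x (EuclideanSpace.single i 1) * gaussian τ (x - z) =
      - ∫ x, φ x * (τ⁻¹ * dilate τ (gaussianPartial i) (x - z)) := by
  have hd : Differentiable ℝ (fun x : Space d => gaussian τ (x - z)) :=
    (differentiable_gaussian τ).comp (by fun_prop)
  have hfd : ∀ x, fderiv ℝ (fun x : Space d => gaussian τ (x - z)) x (EuclideanSpace.single i 1) =
      τ⁻¹ * dilate τ (gaussianPartial i) (x - z) := fun x => by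
    rw [fderiv_comp_sub, fderiv_gaussian_single hτ]
  have hgc := ((gaussianDecay_gaussianPartial i).dilate hτ).1
  have hφd : Continuous fun x => fderiv ℝ φ x (EuclideanSpace.single i 1) :=
    (hφ.continuous_fderiv (by simp)).clm_apply continuous_const
  have hφdc : HasCompactSupport fun x => fderiv ℝ φ x (EuclideanSpace.single i 1) :=
    hφc.fderiv_apply ℝ _
  have := integral_mul_fderiv_eq_neg_fderiv_mul_of_integrable (μ := (volume : Measure (Space d)))
    (f := fun x : Space d => gaussian τ (x - z)) (g := φ) (v := EuclideanSpace.single i 1)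
    ?_ ?_ ?_ (fun x _ => hd x) (fun x _ => hφ.differentiable (by simp) x)
  · simp only [hfd] at this
    simp only [mul_comm (fderiv ℝ φ _ _), mul_comm (φ _)]
    exact this
  · simp only [hfd]
    exact Continuous.integrable_of_hasCompactSupport
      (by have := hφ.continuous; fun_prop) hφc.mul_left
  · exact Continuous.integrable_of_hasCompactSupport (hd.continuous.mul hφd) hφdc.mul_left
  · exact Continuous.integrable_of_hasCompactSupport (hd.continuous.mul hφ.continuous) hφc.mul_left

end Gaussian

/-! ### Weak partial derivatives -/

section WeakPartial

variable {d : ℕ} {q : ℝ≥0∞} [Fact (1 ≤ q)]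

theorem HasWeakPartial.unique {i : Fin d} {f g g' : LSpace d q} (h : HasWeakPartial i f g)
    (h' : HasWeakPartial i f g') : g = g' := by
  apply Lp.ext
  refine ae_eq_of_integral_contDiff_smul_eq ((Lp.memLp g).locallyIntegrable Fact.out)
    ((Lp.memLp g').locallyIntegrable Fact.out) fun φ hφ hφc => ?_
  have := (h φ hφ hφc).symm.trans (h' φ hφ hφc)
  simpa only [smul_eq_mul, mul_comm (φ _), neg_inj] using this

theorem HasWeakPartial.weakPartial_eq {i : Fin d} {f g : LSpace d q} (h : HasWeakPartial i f g) :
    weakPartial i f = g := by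
  have hex : ∃ g, HasWeakPartial i f g := ⟨g, h⟩
  rw [weakPartial, dif_pos hex]
  exact hex.choose_spec.unique h

theorem MemW1.hasWeakPartial {f : LSpace d q} (h : MemW1 f) (i : Fin d) :
    HasWeakPartial i f (weakPartial i f) := by
  obtain ⟨g, hg⟩ := h i
  rw [hg.weakPartial_eq]; exact hg

theorem exists_test_pairing (r : ℝ≥0∞) [Fact (1 ≤ r)] [ENNReal.HolderConjugate r q]
    {φ : Space d → ℝ} (hφ : Continuous φ) (hφc : HasCompactSupport φ) :
    ∃ L : LSpace d q →L[ℝ] ℝ, ∀ f : LSpace d q, ∫ x, f x * φ x = L f := by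
  have hr : MemLp φ r volume := hφ.memLp_of_hasCompactSupport hφc
  refine ⟨pairing (hr.toLp φ), fun f => ?_⟩
  rw [pairing_toLp]
  simp only [mul_comm]

/-- Test functions lie in the dual space L^r, so the weak derivative relation is a family of linear
equations between continuous functionals. It is therefore stable under sums, differences and Bochner
integrals. -/
theorem hasWeakPartial_iff (r : ℝ≥0∞) [Fact (1 ≤ r)] [ENNReal.HolderConjugate r q] (i : Fin d) :
    ∃ 𝓛 : Set ((LSpace d q →L[ℝ] ℝ) × (LSpace d q →L[ℝ] ℝ)), ∀ f g : LSpace d q,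
      HasWeakPartial i f g ↔ ∀ L ∈ 𝓛, L.1 f = - L.2 g := by
  have hc : ∀ φ : Space d → ℝ, ContDiff ℝ ∞ φ →
      Continuous fun x => fderiv ℝ φ x (EuclideanSpace.single i 1) := fun φ hφ =>
    (hφ.continuous_fderiv (by simp)).clm_apply continuous_const
  refine ⟨{L | ∃ φ : Space d → ℝ, ContDiff ℝ ∞ φ ∧ HasCompactSupport φ ∧
    (∀ f : LSpace d q, ∫ x, f x * fderiv ℝ φ x (EuclideanSpace.single i 1) = L.1 f) ∧
    ∀ f : LSpace d q, ∫ x, f x * φ x = L.2 f}, fun f g => ⟨?_, ?_⟩⟩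
  · rintro h L ⟨φ, hφ, hφc, h1, h2⟩
    rw [← h1, ← h2]; exact h φ hφ hφc
  · intro h φ hφ hφc
    obtain ⟨L, hL⟩ := exists_test_pairing (q := q) r (hc φ hφ) (hφc.fderiv_apply ℝ _)
    obtain ⟨L', hL'⟩ := exists_test_pairing (q := q) r hφ.continuous hφc
    rw [hL, hL']
    exact h (L, L') ⟨φ, hφ, hφc, hL, hL'⟩

theorem HasWeakPartial.add (r : ℝ≥0∞) [Fact (1 ≤ r)] [ENNReal.HolderConjugate r q] {i : Fin d}
    {f g f' g' : LSpace d q} (h : HasWeakPartial i f g) (h' : HasWeakPartial i f' g') :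
    HasWeakPartial i (f + f') (g + g') := by
  obtain ⟨𝓛, h𝓛⟩ := hasWeakPartial_iff (q := q) r i
  rw [h𝓛] at *
  intro L hL
  rw [map_add, map_add, h L hL, h' L hL]; ring

theorem HasWeakPartial.sub (r : ℝ≥0∞) [Fact (1 ≤ r)] [ENNReal.HolderConjugate r q] {i : Fin d}
    {f g f' g' : LSpace d q} (h : HasWeakPartial i f g) (h' : HasWeakPartial i f' g') :
    HasWeakPartial i (f - f') (g - g') := by
  obtain ⟨𝓛, h𝓛⟩ := hasWeakPartial_iff (q := q) r i
  rw [h𝓛] at *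
  intro L hL
  rw [map_sub, map_sub, h L hL, h' L hL]; ring

theorem HasWeakPartial.integral (r : ℝ≥0∞) [Fact (1 ≤ r)] [ENNReal.HolderConjugate r q]
    {i : Fin d} {α : Type*} [MeasurableSpace α] {μ : Measure α} {F G : α → LSpace d q}
    (hF : Integrable F μ) (hG : Integrable G μ) (h : ∀ᵐ s ∂μ, HasWeakPartial i (F s) (G s)) :
    HasWeakPartial i (∫ s, F s ∂μ) (∫ s, G s ∂μ) := by
  obtain ⟨𝓛, h𝓛⟩ := hasWeakPartial_iff (q := q) r i
  rw [h𝓛]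
  intro L hL
  rw [← L.1.integral_comp_comm hF, ← L.2.integral_comp_comm hG, ← integral_neg]
  refine integral_congr_ae ?_
  filter_upwards [h] with s hs
  exact (h𝓛 _ _).1 hs L hL

end WeakPartial

/-! ### Convolution operators on `L^q × L¹` -/

theorem convBounded_sum {d : ℕ} {q : ℝ≥0∞} (r : ℝ≥0∞) [ENNReal.HolderConjugate r q] {K : Space d → ℝ}
    (hK : GaussianDecay K) (x : LSpace d q × LSpace d 1) :
    ConvBounded K (fun z => x.1 z + x.2 z) :=
  (ConvBounded.of_memLp (hK.memLp r) (Lp.memLp x.1)).add_right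
    (ConvBounded.of_memLp (hK.memLp ⊤) (Lp.memLp x.2))

theorem ConvBounded.memLp_top_conv {d : ℕ} {K h : Space d → ℝ} (H : ConvBounded K h) :
    MemLp (conv K h) ⊤ volume := by
  obtain ⟨C, hC⟩ := H.norm_conv_le
  refine memLp_top_of_bound ?_ C (Eventually.of_forall hC)
  have : AEStronglyMeasurable (fun p : Space d × Space d => K p.2 * h (p.1 - p.2))
      (volume.prod volume) := H.left.comp_snd.mul
    (H.right.comp_quasiMeasurePreserving (quasiMeasurePreserving_sub volume volume))
  exact this.integral_prod_right'

theorem conv_assoc {d : ℕ} {K L h : Space d → ℝ} (hK : Integrable K) (hL : MemLp L ⊤ volume)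
    (H : ConvBounded L h) : conv (conv K L) h = conv K (conv L h) := by
  have hK1 : MemLp K 1 volume := memLp_one_iff_integrable.2 hK
  obtain ⟨C, hC⟩ := (ConvBounded.of_memLp hK1 hL).bound
  obtain ⟨C', hC'⟩ := H.norm.bound
  obtain ⟨C'', hC''⟩ := (ConvBounded.of_memLp hK1.norm H.norm.memLp_top_conv).bound
  ext x
  exact convolution_assoc (ContinuousLinearMap.mul ℝ ℝ) (ContinuousLinearMap.mul ℝ ℝ)
    (ContinuousLinearMap.mul ℝ ℝ) (ContinuousLinearMap.mul ℝ ℝ)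
    (fun a b c => by simp [mul_assoc]) hK.1 hL.1 H.right
    (Eventually.of_forall fun y => (hC y).1) (Eventually.of_forall fun y => (hC' y).1) (hC'' x).1

section KernelOp

variable {d : ℕ} {q : ℝ≥0∞} [Fact (1 ≤ q)]

/-- Convolution with `K`, acting on the sum of the two components in `L^q` and `L¹`. -/
def kernelOp (hq : q ≠ ⊤) (K : Space d → ℝ) : LSpace d q × LSpace d 1 →L[ℝ] LSpace d q :=
  (convL d hq (lpOf 1 K)).coprod ((convL d hq).flip (lpOf q K))

theorem norm_kernelOp_le (hq : q ≠ ⊤) (K : Space d → ℝ) :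
    ‖kernelOp hq K‖ ≤ ‖lpOf 1 K‖ + ‖lpOf q K‖ := by
  refine ContinuousLinearMap.opNorm_le_bound _ (by positivity) fun x => ?_
  rw [kernelOp, ContinuousLinearMap.coprod_apply, add_mul]
  refine (norm_add_le _ _).trans (add_le_add ?_ ?_)
  · refine (norm_convL_apply_le hq _ _).trans ?_
    gcongr; exact norm_fst_le x
  · rw [ContinuousLinearMap.flip_apply, mul_comm]
    refine (norm_convL_apply_le hq _ _).trans ?_
    gcongr; exact norm_snd_le x

theorem norm_kernelOp_inl_le (hq : q ≠ ⊤) (K : Space d → ℝ) (f : LSpace d q) :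
    ‖kernelOp hq K (f, 0)‖ ≤ ‖lpOf 1 K‖ * ‖f‖ := by
  rw [kernelOp, ContinuousLinearMap.coprod_apply, map_zero, add_zero]
  exact norm_convL_apply_le hq _ _

theorem continuousOn_kernelOp_dilate (hq : q ≠ ⊤) {φ : Space d → ℝ} (hφ : GaussianDecay φ) :
    ContinuousOn (fun τ => kernelOp hq (dilate τ φ)) (Ioi 0) := by
  have h1 := (convL d hq).continuous.comp_continuousOn
    (continuousOn_lpOf_dilate (p := 1) ENNReal.one_ne_top hφ)
  have h2 := (convL d hq).flip.continuous.comp_continuousOn (continuousOn_lpOf_dilate hq hφ)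
  have h3 : ContinuousOn (fun τ => (convL d hq (lpOf 1 (dilate τ φ))).comp
      (ContinuousLinearMap.fst ℝ (LSpace d q) (LSpace d 1)) +
      ((convL d hq).flip (lpOf q (dilate τ φ))).comp
      (ContinuousLinearMap.snd ℝ (LSpace d q) (LSpace d 1))) (Ioi 0) :=
    (ContinuousOn.clm_comp h1 continuousOn_const).add (ContinuousOn.clm_comp h2 continuousOn_const)
  refine h3.congr fun τ _ => ?_
  refine ContinuousLinearMap.ext fun x => ?_
  simp [kernelOp]

/-- One bilinear map serves both components: the kernel is the L¹ factor against the L^q component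
and the L^q factor against the L¹ component. Commutativity of convolution reconciles the two orders.
-/
theorem kernelOp_ae_eq (r : ℝ≥0∞) [Fact (1 ≤ r)] [ENNReal.HolderConjugate r q] (hq : q ≠ ⊤)
    {K : Space d → ℝ} (hK : GaussianDecay K) (x : LSpace d q × LSpace d 1) :
    kernelOp hq K x =ᵐ[volume] conv K (fun z => x.1 z + x.2 z) := by
  have hB1 : ConvBounded K x.1 := ConvBounded.of_memLp (hK.memLp r) (Lp.memLp x.1)
  have hB2 : ConvBounded K x.2 := ConvBounded.of_memLp (hK.memLp ⊤) (Lp.memLp x.2)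
  have e1 := coeFn_lpOf (hK.memLp 1)
  have eq := coeFn_lpOf (hK.memLp q)
  have h1 := convL_ae_eq (r := r) hq (lpOf 1 K) x.1 (hB1.symm.congr_right e1.symm).symm
  have h2 := convL_ae_eq (r := r) hq x.2 (lpOf q K) (hB2.symm.congr_right eq.symm)
  rw [conv_comm, conv_congr_right e1, conv_comm] at h1
  rw [conv_congr_right eq, conv_comm] at h2
  rw [conv_add_right hB1 hB2, kernelOp, ContinuousLinearMap.coprod_apply,
    ContinuousLinearMap.flip_apply]
  filter_upwards [h1, h2, Lp.coeFn_add (convL d hq (lpOf 1 K) x.1) (convL d hq x.2 (lpOf q K))]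
    with z hz1 hz2 hz3
  rw [hz3, Pi.add_apply, hz1, hz2]

/-- Fubini isolates the integral of the test function against a translated Gaussian, where classical
integration by parts applies. -/
theorem hasWeakPartial_kernelOp_gaussian (r : ℝ≥0∞) [Fact (1 ≤ r)] [ENNReal.HolderConjugate r q]
    (hq : q ≠ ⊤) {τ : ℝ} (hτ : 0 < τ) (i : Fin d) (x : LSpace d q × LSpace d 1) :
    HasWeakPartial i (kernelOp hq (gaussian τ) x)
      (τ⁻¹ • kernelOp hq (dilate τ (gaussianPartial i)) x) := by
  intro φ hφ hφc
  have hG := gaussianDecay_gaussian (d := d) hτ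
  have hP := (gaussianDecay_gaussianPartial i).dilate hτ
  have hφd : Continuous fun x => fderiv ℝ φ x (EuclideanSpace.single i 1) :=
    (hφ.continuous_fderiv (by simp)).clm_apply continuous_const
  have hφdi : Integrable fun x => fderiv ℝ φ x (EuclideanSpace.single i 1) :=
    hφd.integrable_of_hasCompactSupport (hφc.fderiv_apply ℝ _)
  have hφi : Integrable φ := hφ.continuous.integrable_of_hasCompactSupport hφc
  set h : Space d → ℝ := fun z => x.1 z + x.2 z with hh
  have h1 : ∫ y, kernelOp hq (gaussian τ) x y * fderiv ℝ φ y (EuclideanSpace.single i 1) =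
      ∫ y, fderiv ℝ φ y (EuclideanSpace.single i 1) * conv h (gaussian τ) y := by
    refine integral_congr_ae ?_
    filter_upwards [kernelOp_ae_eq r hq hG x] with y hy
    rw [hy, mul_comm, conv_comm]
  have h2 : ∫ y, (τ⁻¹ • kernelOp hq (dilate τ (gaussianPartial i)) x) y * φ y =
      τ⁻¹ * ∫ y, φ y * conv h (dilate τ (gaussianPartial i)) y := by
    rw [← integral_const_mul]
    refine integral_congr_ae ?_
    filter_upwards [kernelOp_ae_eq r hq hP x,
      Lp.coeFn_smul τ⁻¹ (kernelOp hq (dilate τ (gaussianPartial i)) x)] with y hy hy2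
    rw [hy2, Pi.smul_apply, hy, conv_comm, smul_eq_mul]; ring
  rw [h1, h2, (convBounded_sum r hG x).symm.integral_mul_conv hφdi,
    (convBounded_sum r hP x).symm.integral_mul_conv hφi, ← integral_const_mul, ← integral_neg]
  refine integral_congr_ae (Eventually.of_forall fun z => ?_)
  simp only
  rw [integral_gaussian_mul_partial hτ i z hφ hφc]
  simp only [mul_left_comm (φ _)]
  rw [integral_const_mul]; ring

theorem kernelOp_gaussian_semigroup (r : ℝ≥0∞) [Fact (1 ≤ r)] [ENNReal.HolderConjugate r q]
    (hq : q ≠ ⊤) {a b : ℝ} (ha : 0 < a) (hb : 0 < b) (x : LSpace d q × LSpace d 1) :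
    kernelOp hq (gaussian a) (kernelOp hq (gaussian b) x, 0) =
      kernelOp hq (gaussian (√(a ^ 2 + b ^ 2))) x := by
  have hGa := gaussianDecay_gaussian (d := d) ha
  have hGb := gaussianDecay_gaussian (d := d) hb
  have hGc := gaussianDecay_gaussian (d := d) (τ := √(a ^ 2 + b ^ 2)) (by positivity)
  apply Lp.ext
  have h0 : (fun z => (kernelOp hq (gaussian b) x) z + (0 : LSpace d 1) z) =ᵐ[volume]
      conv (gaussian b) (fun z => x.1 z + x.2 z) := by
    filter_upwards [kernelOp_ae_eq r hq hGb x, Lp.coeFn_zero ℝ 1 (volume : Measure (Space d))]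
      with z h1 h2
    rw [h1, h2, Pi.zero_apply, add_zero]
  have h1 := kernelOp_ae_eq r hq hGa (kernelOp hq (gaussian b) x, 0)
  simp only at h1
  rw [conv_congr_right h0, ← conv_assoc (memLp_one_iff_integrable.1 (hGa.memLp 1)) (hGb.memLp ⊤)
    (convBounded_sum r hGb x), conv_gaussian_gaussian ha hb] at h1
  exact h1.trans (kernelOp_ae_eq r hq hGc x).symm

/-- After rescaling, the convolution averages the translates of f by τz against a fixed Gaussian of
mass one. Translation is continuous in L^q for finite q, so dominated convergence concludes. -/
theorem tendsto_kernelOp_gaussian (hq : q ≠ ⊤) (f : LSpace d q) :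
    Tendsto (fun τ => kernelOp hq (gaussian τ) (f, 0)) (𝓝[>] 0) (𝓝 f) := by
  have hG1 : Integrable (gaussian 1 : Space d → ℝ) :=
    memLp_one_iff_integrable.1 (gaussianDecay_gaussian_one.memLp 1)
  have hrep : ∀ τ : ℝ, 0 < τ → kernelOp hq (gaussian τ) (f, 0) =
      ∫ z, (gaussian 1 z : ℝ) • translate (τ • z) f := by
    intro τ hτ
    rw [kernelOp, ContinuousLinearMap.coprod_apply, map_zero, add_zero, convL_apply]
    have e1 : ∫ y, (lpOf 1 (gaussian τ) : LSpace d 1) y • translate y f =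
        ∫ y, (gaussian τ y : ℝ) • translate y f := by
      refine integral_congr_ae ?_
      filter_upwards [coeFn_lpOf ((gaussianDecay_gaussian (d := d) hτ).memLp 1)] with y hy
      rw [hy]
    have e2 := Measure.integral_comp_smul (volume : Measure (Space d))
      (fun y => (gaussian τ y : ℝ) • translate y f) τ
    rw [finrank_euclideanSpace_fin, abs_of_pos (by positivity)] at e2
    rw [e1]
    have e3 : ∫ y, (gaussian τ y : ℝ) • translate y f =
        τ ^ d • ∫ z, (gaussian τ (τ • z) : ℝ) • translate (τ • z) f := by
      rw [e2, smul_smul, mul_inv_cancel₀ (by positivity), one_smul]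
    rw [e3, ← integral_smul]
    refine integral_congr_ae (Eventually.of_forall fun z => ?_)
    simp only [smul_smul]
    rw [gaussian_eq_dilate hτ, dilate, smul_smul, inv_mul_cancel₀ hτ.ne', one_smul, ← mul_assoc,
      mul_inv_cancel₀ (by positivity), one_mul]
  have hlim : Tendsto (fun τ : ℝ => ∫ z, (gaussian 1 z : ℝ) • translate (τ • z) f) (𝓝[>] 0)
      (𝓝 (∫ z : Space d, (gaussian 1 z : ℝ) • f)) := by
    refine tendsto_integral_filter_of_dominated_convergence (fun z => ‖gaussian 1 z‖ * ‖f‖) ?_ ?_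
      (hG1.norm.mul_const _) ?_
    · refine Eventually.of_forall fun τ => hG1.1.smul ?_
      exact ((continuous_translate hq f).comp (continuous_const_smul τ)).aestronglyMeasurable
    · refine Eventually.of_forall fun τ => Eventually.of_forall fun z => ?_
      rw [norm_smul, norm_translate]
    · refine Eventually.of_forall fun z => Tendsto.const_smul ?_ _
      have hc : Continuous fun τ : ℝ => translate (τ • z) f :=
        (continuous_translate hq f).comp (by fun_prop)
      have := hc.tendsto 0
      rw [zero_smul, translate_zero] at this
      exact this.mono_left nhdsWithin_le_nhds
  rw [integral_smul_const, integral_gaussian one_pos, one_smul] at hlim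
  refine hlim.congr' ?_
  filter_upwards [self_mem_nhdsWithin] with τ hτ
  exact (hrep τ hτ).symm

end KernelOp

/-! ### The nonlinearity as a map into `L^q × L¹` -/

section Nonlinearity

variable {d : ℕ}

theorem reaction_zero (W : ℝ) : reaction W 0 = 0 := by simp [reaction]

/-- The polynomial vanishes at 0 and 1, so the cut-off reaction is the polynomial composed with the
1-Lipschitz projection onto [0,1]. -/
theorem exists_lipschitzWith_reaction {W : ℝ} (hW : 0 < W) :
    ∃ L : NNReal, LipschitzWith L (reaction W) := by
  have hproj : ∀ ξ, reaction W ξ = W * (max 0 (min ξ 1)) ^ 2 * (max 0 (min ξ 1) - 1) ^ 2 *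
      (max 0 (min ξ 1) - 1 / 2) := by
    intro ξ
    unfold reaction
    by_cases h : ξ ∈ Icc (0 : ℝ) 1
    · rw [indicator_of_mem h, min_eq_left h.2, max_eq_right h.1]
    · rw [indicator_of_notMem h]
      rcases lt_or_ge ξ 0 with h0 | h0
      · rw [max_eq_left ((min_le_left _ _).trans h0.le)]; ring
      · have h1 : 1 < ξ := by
          by_contra h1; exact h ⟨h0, not_lt.1 h1⟩
        rw [min_eq_right h1.le, max_eq_right zero_le_one]; ring
  have hpoly : ∀ a ∈ Icc (0 : ℝ) 1, ∀ b ∈ Icc (0 : ℝ) 1,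
      |W * a ^ 2 * (a - 1) ^ 2 * (a - 1 / 2) - W * b ^ 2 * (b - 1) ^ 2 * (b - 1 / 2)| ≤
        6 * W * |a - b| := by
    intro a ha b hb
    -- In terms of A and B the difference is W(A²(a - 1/2) - B²(b - 1/2)), and A - B = (a - b)(a + b
    -- - 1) lets a - b be factored out.
    set A := a * (a - 1) with hA
    set B := b * (b - 1) with hB
    have e : W * a ^ 2 * (a - 1) ^ 2 * (a - 1 / 2) - W * b ^ 2 * (b - 1) ^ 2 * (b - 1 / 2) =
        W * ((A + B) * (a + b - 1) * (a - 1 / 2) + B ^ 2) * (a - b) := by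
      rw [hA, hB]; ring
    have hA1 : |A| ≤ 1 := by rw [abs_le, hA]; constructor <;> nlinarith [ha.1, ha.2]
    have hB1 : |B| ≤ 1 := by rw [abs_le, hB]; constructor <;> nlinarith [hb.1, hb.2]
    have h1 : |A + B| ≤ 2 := (abs_add_le _ _).trans (by linarith)
    have h2 : |a + b - 1| ≤ 1 := by rw [abs_le]; constructor <;> linarith [ha.1, ha.2, hb.1, hb.2]
    have h3 : |a - 1 / 2| ≤ 1 := by rw [abs_le]; constructor <;> linarith [ha.1, ha.2]
    have h4 : |(A + B) * (a + b - 1) * (a - 1 / 2) + B ^ 2| ≤ 6 := by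
      refine (abs_add_le _ _).trans ?_
      rw [abs_mul, abs_mul, abs_pow]
      have : |A + B| * |a + b - 1| * |a - 1 / 2| ≤ 2 * 1 * 1 := by gcongr
      have : |B| ^ 2 ≤ 1 := pow_le_one₀ (abs_nonneg _) hB1
      linarith
    rw [e, abs_mul, abs_mul, abs_of_pos hW]
    calc W * _ * |a - b| ≤ W * 6 * |a - b| := by gcongr
      _ = _ := by ring
  refine ⟨⟨6 * W, by positivity⟩, LipschitzWith.of_dist_le_mul fun ξ ζ => ?_⟩
  have hmem : ∀ ξ : ℝ, max 0 (min ξ 1) ∈ Icc (0 : ℝ) 1 := fun ξ =>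
    ⟨le_max_left _ _, max_le zero_le_one (min_le_right _ _)⟩
  rw [Real.dist_eq, Real.dist_eq, hproj, hproj]
  refine (hpoly _ (hmem ξ) _ (hmem ζ)).trans ?_
  have : |max 0 (min ξ 1) - max 0 (min ζ 1)| ≤ |ξ - ζ| := by
    have h1 := abs_max_sub_max_le_max 0 (min ξ 1) 0 (min ζ 1)
    have h2 := abs_min_sub_min_le_max ξ 1 ζ 1
    rw [sub_self, abs_zero, max_eq_right (b := |_|) (abs_nonneg _)] at h1
    rw [sub_self, abs_zero, max_eq_left (a := |_|) (abs_nonneg _)] at h2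
    exact h1.trans h2
  exact mul_le_mul_of_nonneg_left this (by positivity)

theorem exists_embedding_top {V : Type*} [NormedAddCommGroup V] [InnerProductSpace ℝ V]
    {ι : V →ₗ[ℝ] (Space d → Space d)} (hι : IsC1Embedding ι) :
    ∃ E : V →L[ℝ] Lp (Space d) ⊤ (volume : Measure (Space d)), ∀ w, E w =ᵐ[volume] ι w := by
  obtain ⟨C, hC⟩ := hι.bound
  have hm : ∀ w, MemLp (ι w) ⊤ (volume : Measure (Space d)) := fun w =>
    memLp_top_of_bound (hι.contDiff w).continuous.aestronglyMeasurable (C * ‖w‖)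
      (Eventually.of_forall fun x => (hC w x).1)
  let E₀ : V →ₗ[ℝ] Lp (Space d) ⊤ (volume : Measure (Space d)) :=
    { toFun := fun w => (hm w).toLp (ι w)
      map_add' := fun w w' => by
        rw [← MemLp.toLp_add]
        exact MemLp.toLp_congr _ _ (by rw [map_add])
      map_smul' := fun c w => by
        rw [RingHom.id_apply, ← MemLp.toLp_const_smul]
        exact MemLp.toLp_congr _ _ (by rw [map_smul]) }
  refine ⟨E₀.mkContinuous C fun w => ?_, fun w => (hm w).coeFn_toLp⟩
  have h0 : 0 ≤ C * ‖w‖ := (norm_nonneg _).trans (hC w 0).1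
  change ‖(hm w).toLp (ι w)‖ ≤ C * ‖w‖
  rw [Lp.norm_toLp, eLpNorm_exponent_top]
  exact ENNReal.toReal_le_of_le_ofReal h0
    (eLpNormEssSup_le_of_ae_bound (Eventually.of_forall fun x => (hC w x).1))

/-- The vector field with given components. -/
def vectorField {q : ℝ≥0∞} [Fact (1 ≤ q)] :
    (Fin d → LSpace d q) →L[ℝ] Lp (Space d) q (volume : Measure (Space d)) :=
  ∑ i, ((ContinuousLinearMap.toSpanSingleton ℝ (EuclideanSpace.single i (1 : ℝ))).compLpL q
    volume).comp (ContinuousLinearMap.proj i)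

theorem coeFn_vectorField {q : ℝ≥0∞} [Fact (1 ≤ q)] (h : Fin d → LSpace d q) :
    vectorField h =ᵐ[volume] fun x => WithLp.toLp 2 (fun i => h i x) := by
  have e : vectorField h = ∑ i, (ContinuousLinearMap.toSpanSingleton ℝ
      (EuclideanSpace.single i (1 : ℝ))).compLpL q volume (h i) := by
    simp [vectorField]
  rw [e]
  have h1 := Lp.coeFn_finsetSum Finset.univ (fun i => (ContinuousLinearMap.toSpanSingleton ℝ
      (EuclideanSpace.single i (1 : ℝ))).compLpL q volume (h i))
  have h2 : ∀ᵐ x, ∀ i, ((ContinuousLinearMap.toSpanSingleton ℝ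
      (EuclideanSpace.single i (1 : ℝ))).compLpL q volume (h i)) x =
      h i x • (EuclideanSpace.single i (1 : ℝ) : Space d) := by
    rw [ae_all_iff]
    intro i
    filter_upwards [ContinuousLinearMap.coeFn_compLpL (ContinuousLinearMap.toSpanSingleton ℝ
      (EuclideanSpace.single i (1 : ℝ) : Space d)) (h i)] with x hx
    rw [hx, ContinuousLinearMap.toSpanSingleton_apply]
  filter_upwards [h1, h2] with x hx1 hx2
  rw [hx1]
  simp only [Finset.sum_apply, hx2]
  ext j
  simp [Finset.sum_apply, Pi.single_apply]

variable {q : ℝ≥0∞}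

/-- The pointwise length of a vector field. -/
def fieldNorm (G : Lp (Space d) q (volume : Measure (Space d))) : LSpace d q :=
  (lipschitzWith_one_norm (E := Space d)).compLp norm_zero G

theorem norm_fieldNorm_sub_le (G G' : Lp (Space d) q (volume : Measure (Space d))) :
    ‖fieldNorm G - fieldNorm G'‖ ≤ ‖G - G'‖ := by
  simpa [fieldNorm] using
    (lipschitzWith_one_norm (E := Space d)).norm_compLp_sub_le norm_zero G G'

theorem coeFn_fieldNorm (G : Lp (Space d) q (volume : Measure (Space d))) :
    fieldNorm G =ᵐ[volume] fun x => ‖G x‖ :=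
  (lipschitzWith_one_norm (E := Space d)).coeFn_compLp norm_zero G

variable [Fact (1 ≤ q)]

theorem continuous_fieldNorm :
    Continuous (fieldNorm : Lp (Space d) q (volume : Measure (Space d)) → LSpace d q) :=
  (lipschitzWith_one_norm (E := Space d)).continuous_compLp norm_zero

/-- The pointwise inner product of a bounded field and a field in `L^q`. -/
def innerL : Lp (Space d) ⊤ (volume : Measure (Space d)) →L[ℝ]
    Lp (Space d) q (volume : Measure (Space d)) →L[ℝ] LSpace d q :=
  (innerSL ℝ (E := Space d)).holderL volume ⊤ q q

theorem coeFn_innerL (b : Lp (Space d) ⊤ (volume : Measure (Space d)))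
    (G : Lp (Space d) q (volume : Measure (Space d))) :
    innerL b G =ᵐ[volume] fun x => inner ℝ (b x) (G x) :=
  (innerSL ℝ (E := Space d)).coeFn_holder (r := q) b G

variable {r : ℝ≥0∞} [Fact (1 ≤ r)] [ENNReal.HolderConjugate r q]

/-- The pointwise product `L^r × L^q → L¹`. -/
def mulL : LSpace d r →L[ℝ] LSpace d q →L[ℝ] LSpace d 1 :=
  (ContinuousLinearMap.mul ℝ ℝ).holderL volume r q 1

theorem coeFn_mulL (u : LSpace d r) (f : LSpace d q) : mulL u f =ᵐ[volume] fun x => u x * f x :=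
  (ContinuousLinearMap.mul ℝ ℝ).coeFn_holder (r := 1) u f

/-- The nonlinearity `(I(y) - b · G, u |G|)` with `G` the field of components `h`. -/
def splitNonlinearity {W : ℝ} {L : NNReal} (hL : LipschitzWith L (reaction W)) (u : LSpace d r)
    (b : Lp (Space d) ⊤ (volume : Measure (Space d))) (y : LSpace d q) (h : Fin d → LSpace d q) :
    LSpace d q × LSpace d 1 :=
  (hL.compLp (reaction_zero W) y - innerL b (vectorField h), mulL u (fieldNorm (vectorField h)))

theorem splitNonlinearity_ae_eq {W : ℝ} {L : NNReal} (hL : LipschitzWith L (reaction W))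
    (u : LSpace d r) {b : Lp (Space d) ⊤ (volume : Measure (Space d))} {v : Space d → Space d}
    (hv : b =ᵐ[volume] v) (y : LSpace d q) {h : Fin d → LSpace d q}
    (hh : ∀ i, h i = weakPartial i y) :
    (fun x => (splitNonlinearity hL u b y h).1 x + (splitNonlinearity hL u b y h).2 x) =ᵐ[volume]
      nonlinearity W u v y := by
  obtain rfl : h = fun i => weakPartial i y := funext hh
  filter_upwards [Lp.coeFn_sub (hL.compLp (reaction_zero W) y)
      (innerL b (vectorField fun i => weakPartial i y)),
    hL.coeFn_compLp (reaction_zero W) y, coeFn_innerL b (vectorField fun i => weakPartial i y),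
    coeFn_mulL u (fieldNorm (vectorField fun i => weakPartial i y)),
    coeFn_fieldNorm (vectorField fun i => weakPartial i y),
    coeFn_vectorField (fun i => weakPartial i y), hv] with x x1 x2 x3 x4 x5 x6 x7
  rw [splitNonlinearity, x1, Pi.sub_apply, x2, x3, x4, x5, x6, x7, nonlinearity, weakGrad,
    Function.comp_apply]
  ring

/-- The constant depends on `u` and `b` only through an affine function of their norms, so along the
time-dependent data it is as integrable in time as they are. -/
theorem exists_norm_splitNonlinearity_sub_le {W : ℝ} {L : NNReal}
    (hL : LipschitzWith L (reaction W)) :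
    ∃ C : ℝ, 0 ≤ C ∧ ∀ (u : LSpace d r) (b : Lp (Space d) ⊤ (volume : Measure (Space d)))
      (y : LSpace d q) (h : Fin d → LSpace d q) (y' : LSpace d q) (h' : Fin d → LSpace d q),
      ‖splitNonlinearity hL u b y h - splitNonlinearity hL u b y' h'‖ ≤
        C * (1 + ‖u‖ + ‖b‖) * (‖y - y'‖ + ‖h - h'‖) := by
  set B := innerL (d := d) (q := q)
  set M := mulL (d := d) (r := r) (q := q)
  set T := vectorField (d := d) (q := q)
  refine ⟨L + ‖B‖ * ‖T‖ + ‖M‖ * ‖T‖, by positivity, fun u b y h y' h' => ?_⟩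
  have hyn := norm_nonneg (y - y')
  have hhn := norm_nonneg (h - h')
  have e1 : ‖hL.compLp (reaction_zero W) y - hL.compLp (reaction_zero W) y'‖ ≤ L * ‖y - y'‖ :=
    hL.norm_compLp_sub_le (reaction_zero W) y y'
  have e0 : ‖T h - T h'‖ ≤ ‖T‖ * ‖h - h'‖ := by rw [← map_sub]; exact T.le_opNorm _
  have e2 : ‖B b (T h) - B b (T h')‖ ≤ ‖B‖ * ‖b‖ * (‖T‖ * ‖h - h'‖) := by
    rw [← map_sub]
    exact (B.le_opNorm₂ _ _).trans (by gcongr)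
  have e3 : ‖M u (fieldNorm (T h)) - M u (fieldNorm (T h'))‖ ≤
      ‖M‖ * ‖u‖ * (‖T‖ * ‖h - h'‖) := by
    rw [← map_sub]
    refine (M.le_opNorm₂ _ _).trans ?_
    gcongr
    exact (norm_fieldNorm_sub_le _ _).trans e0
  rw [Prod.norm_def]
  refine max_le ?_ ?_
  · have : (splitNonlinearity hL u b y h - splitNonlinearity hL u b y' h').1 =
      (hL.compLp (reaction_zero W) y - hL.compLp (reaction_zero W) y') -
        (B b (T h) - B b (T h')) := by
      simp only [splitNonlinearity, Prod.fst_sub]; abel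
    rw [this]
    refine (norm_sub_le _ _).trans ((add_le_add e1 e2).trans ?_)
    calc L * ‖y - y'‖ + ‖B‖ * ‖b‖ * (‖T‖ * ‖h - h'‖)
        ≤ (L * (1 + ‖u‖ + ‖b‖)) * (‖y - y'‖ + ‖h - h'‖) +
          (‖B‖ * ‖T‖ * (1 + ‖u‖ + ‖b‖)) * (‖y - y'‖ + ‖h - h'‖) := by
          rw [show ‖B‖ * ‖b‖ * (‖T‖ * ‖h - h'‖) = ‖B‖ * ‖T‖ * ‖b‖ * ‖h - h'‖ by ring]
          have := norm_nonneg u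
          have := norm_nonneg b
          gcongr
          · exact le_mul_of_one_le_right L.2 (by linarith)
          · linarith
          · linarith
          · linarith
      _ ≤ _ := by
          have : 0 ≤ ‖M‖ * ‖T‖ * (1 + ‖u‖ + ‖b‖) * (‖y - y'‖ + ‖h - h'‖) := by positivity
          nlinarith
  · have : (splitNonlinearity hL u b y h - splitNonlinearity hL u b y' h').2 =
        M u (fieldNorm (T h)) - M u (fieldNorm (T h')) := rfl
    rw [this]
    refine e3.trans ?_
    calc ‖M‖ * ‖u‖ * (‖T‖ * ‖h - h'‖) = ‖M‖ * ‖T‖ * ‖u‖ * ‖h - h'‖ := by ring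
      _ ≤ (‖M‖ * ‖T‖) * (1 + ‖u‖ + ‖b‖) * (‖y - y'‖ + ‖h - h'‖) := by
          have := norm_nonneg u
          have := norm_nonneg b
          gcongr
          · linarith
          · linarith
      _ ≤ _ := by
          gcongr
          have : 0 ≤ (L : ℝ) := L.2
          have : 0 ≤ ‖B‖ * ‖T‖ := by positivity
          linarith

theorem splitNonlinearity_zero {W : ℝ} {L : NNReal} (hL : LipschitzWith L (reaction W))
    (u : LSpace d r) (b : Lp (Space d) ⊤ (volume : Measure (Space d))) :
    splitNonlinearity hL u b (0 : LSpace d q) 0 = 0 := by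
  have : fieldNorm (0 : Lp (Space d) q (volume : Measure (Space d))) = 0 :=
    LipschitzWith.compLp_zero _ _
  rw [splitNonlinearity, map_zero, map_zero, this, map_zero, LipschitzWith.compLp_zero, sub_zero]
  rfl

theorem aestronglyMeasurable_splitNonlinearity {W : ℝ} {L : NNReal}
    (hL : LipschitzWith L (reaction W)) {α : Type*} [MeasurableSpace α] {μ : Measure α}
    {u : α → LSpace d r} {b : α → Lp (Space d) ⊤ (volume : Measure (Space d))}
    {y : α → LSpace d q} {h : α → Fin d → LSpace d q} (hu : AEStronglyMeasurable u μ)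
    (hb : AEStronglyMeasurable b μ) (hy : AEStronglyMeasurable y μ)
    (hh : AEStronglyMeasurable h μ) :
    AEStronglyMeasurable (fun s => splitNonlinearity hL (u s) (b s) (y s) (h s)) μ := by
  have hG := (vectorField (d := d) (q := q)).continuous.comp_aestronglyMeasurable hh
  refine AEStronglyMeasurable.prodMk (AEStronglyMeasurable.sub ?_ ?_) ?_
  · exact (hL.continuous_compLp (reaction_zero W)).comp_aestronglyMeasurable hy
  · exact innerL.aestronglyMeasurable_comp₂ hb hG
  · exact mulL.aestronglyMeasurable_comp₂ hu
      (continuous_fieldNorm.comp_aestronglyMeasurable hG)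

end Nonlinearity

/-! ### The heat semigroup and its gradient -/

section Heat

variable {d : ℕ} {q : ℝ≥0∞} [Fact (1 ≤ q)]

/-- The heat semigroup at time `t`, on `L^q + L¹`. -/
def heatOp (hq : q ≠ ⊤) (σ t : ℝ) : LSpace d q × LSpace d 1 →L[ℝ] LSpace d q :=
  kernelOp hq (gaussian (σ * √t))

/-- The gradient of the heat semigroup at time `t`, on `L^q + L¹`. -/
def heatGrad (hq : q ≠ ⊤) (σ t : ℝ) : LSpace d q × LSpace d 1 →L[ℝ] (Fin d → LSpace d q) :=
  ContinuousLinearMap.pi fun i =>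
    (σ * √t)⁻¹ • kernelOp hq (dilate (σ * √t) (gaussianPartial i))

theorem continuousOn_kernelOp_time (hq : q ≠ ⊤) {σ : ℝ} (hσ : 0 < σ) {φ : Space d → ℝ}
    (hφ : GaussianDecay φ) :
    ContinuousOn (fun t => kernelOp hq (dilate (σ * √t) φ)) (Ioi 0) :=
  (continuousOn_kernelOp_dilate hq hφ).comp (by fun_prop) fun t ht =>
    mul_pos hσ (Real.sqrt_pos.2 ht)

theorem continuousOn_heatOp (hq : q ≠ ⊤) {σ : ℝ} (hσ : 0 < σ) :
    ContinuousOn (heatOp (d := d) hq σ) (Ioi 0) :=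
  (continuousOn_kernelOp_time hq hσ gaussianDecay_gaussian_one).congr fun t ht => by
    rw [heatOp, gaussian_eq_dilate (mul_pos hσ (Real.sqrt_pos.2 ht))]

theorem continuousOn_heatGrad (hq : q ≠ ⊤) {σ : ℝ} (hσ : 0 < σ) :
    ContinuousOn (heatGrad (d := d) hq σ) (Ioi 0) := by
  have h : ContinuousOn (fun t => fun i : Fin d =>
      (σ * √t)⁻¹ • kernelOp hq (dilate (σ * √t) (gaussianPartial i))) (Ioi 0) := by
    refine continuousOn_pi.2 fun i => ?_
    have h1 : ContinuousOn (fun t : ℝ => (σ * √t)⁻¹) (Ioi 0) :=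
      ContinuousOn.inv₀ (by fun_prop) fun t ht => (mul_pos hσ (Real.sqrt_pos.2 ht)).ne'
    exact h1.smul (continuousOn_kernelOp_time hq hσ (gaussianDecay_gaussianPartial i))
  exact (ContinuousLinearMap.piEquivL ℝ (LSpace d q × LSpace d 1)
    (fun _ : Fin d => LSpace d q)).continuous.comp_continuousOn h

theorem norm_kernelOp_time_le (hq : q ≠ ⊤) {σ : ℝ} (hσ : 0 < σ) {ρ : ℝ}
    (hρ : (d : ℝ) - d / q.toReal = ρ) (hρ0 : 0 ≤ ρ) {φ : Space d → ℝ} (hφ : GaussianDecay φ)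
    {t : ℝ} (ht : t ∈ Ioc (0 : ℝ) 1) :
    ‖kernelOp hq (dilate (σ * √t) φ)‖ ≤
      (‖lpOf 1 φ‖ + σ ^ (-ρ) * ‖lpOf q φ‖) * t ^ (-(ρ / 2)) := by
  have hτ : 0 < σ * √t := mul_pos hσ (Real.sqrt_pos.2 ht.1)
  refine (norm_kernelOp_le hq _).trans ?_
  rw [norm_lpOf_dilate ENNReal.one_ne_top hφ hτ, norm_lpOf_dilate hq hφ hτ, add_mul]
  have e1 : -(d : ℝ) + d / (1 : ℝ≥0∞).toReal = 0 := by simp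
  have e2 : -(d : ℝ) + d / q.toReal = -ρ := by rw [← hρ]; ring
  rw [e1, e2, Real.rpow_zero, one_mul, Real.mul_rpow hσ.le (Real.sqrt_nonneg t),
    Real.sqrt_eq_rpow, ← Real.rpow_mul ht.1.le]
  refine add_le_add ?_ (le_of_eq ?_)
  · refine le_mul_of_one_le_right (norm_nonneg _) ?_
    exact Real.one_le_rpow_of_pos_of_le_one_of_nonpos ht.1 ht.2 (by linarith)
  · rw [show 1 / 2 * -ρ = -(ρ / 2) by ring]; ring

theorem exists_nonneg_bound {ι : Type*} [Finite ι] (c : ι → ℝ) : ∃ S : ℝ, 0 ≤ S ∧ ∀ i, c i ≤ S := by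
  obtain ⟨M, hM⟩ := (Set.finite_range c).bddAbove
  exact ⟨max M 0, le_max_right _ _, fun i => (hM ⟨i, rfl⟩).trans (le_max_left _ _)⟩

/-- The L¹ component dictates the rate t^(-ρ/2), and the L^q component costs nothing for t ≤ 1. The
gradient adds a factor of order t^(-1/2). -/
theorem exists_norm_heat_le (hq : q ≠ ⊤) {σ : ℝ} (hσ : 0 < σ) {ρ : ℝ}
    (hρ : (d : ℝ) - d / q.toReal = ρ) (hρ0 : 0 ≤ ρ) :
    ∃ A : ℝ, 0 ≤ A ∧ ∀ t ∈ Ioc (0 : ℝ) 1, ‖heatOp (d := d) hq σ t‖ ≤ A * t ^ (-(ρ / 2)) ∧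
      ‖heatGrad (d := d) hq σ t‖ ≤ A * t ^ (-(1 / 2 + ρ / 2)) := by
  obtain ⟨A₁, hA₁0, hA₁⟩ : ∃ A₁ : ℝ, 0 ≤ A₁ ∧ ‖lpOf 1 (gaussian 1 : Space d → ℝ)‖ +
      σ ^ (-ρ) * ‖lpOf q (gaussian 1 : Space d → ℝ)‖ = A₁ := ⟨_, by positivity, rfl⟩
  obtain ⟨A₂, hA₂0, hA₂⟩ := exists_nonneg_bound fun i : Fin d =>
    σ⁻¹ * (‖lpOf 1 (gaussianPartial i)‖ + σ ^ (-ρ) * ‖lpOf q (gaussianPartial i)‖)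
  refine ⟨A₁ + A₂, by positivity, fun t ht => ⟨?_, ?_⟩⟩
  · have hτ : 0 < σ * √t := mul_pos hσ (Real.sqrt_pos.2 ht.1)
    rw [heatOp, gaussian_eq_dilate hτ]
    refine (norm_kernelOp_time_le hq hσ hρ hρ0 gaussianDecay_gaussian_one ht).trans ?_
    rw [hA₁]
    have := Real.rpow_nonneg ht.1.le (-(ρ / 2))
    gcongr
    linarith
  · have q1 := Real.rpow_nonneg ht.1.le (-(1 / 2 + ρ / 2))
    refine ContinuousLinearMap.opNorm_le_bound _ (by positivity) fun x => ?_
    rw [pi_norm_le_iff_of_nonneg (by positivity)]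
    intro i
    have hτ : 0 < σ * √t := mul_pos hσ (Real.sqrt_pos.2 ht.1)
    have h1 := norm_kernelOp_time_le hq hσ hρ hρ0 (gaussianDecay_gaussianPartial i) ht
    have h2 : heatGrad hq σ t x i =
        (σ * √t)⁻¹ • kernelOp hq (dilate (σ * √t) (gaussianPartial i)) x := rfl
    have e : (σ * √t)⁻¹ = σ⁻¹ * t ^ (-(1 / 2 : ℝ)) := by
      rw [mul_inv, Real.sqrt_eq_rpow, Real.rpow_neg ht.1.le]
    rw [h2, norm_smul, Real.norm_of_nonneg (by positivity), e]
    calc σ⁻¹ * t ^ (-(1 / 2 : ℝ)) * ‖kernelOp hq (dilate (σ * √t) (gaussianPartial i)) x‖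
        ≤ σ⁻¹ * t ^ (-(1 / 2 : ℝ)) * ((‖lpOf 1 (gaussianPartial i)‖ +
          σ ^ (-ρ) * ‖lpOf q (gaussianPartial i)‖) * t ^ (-(ρ / 2)) * ‖x‖) := by
          have := Real.rpow_nonneg ht.1.le (-(1 / 2 : ℝ))
          gcongr
          exact (ContinuousLinearMap.le_opNorm _ _).trans (by gcongr)
      _ = σ⁻¹ * (‖lpOf 1 (gaussianPartial i)‖ + σ ^ (-ρ) * ‖lpOf q (gaussianPartial i)‖) *
          t ^ (-(1 / 2 + ρ / 2)) * ‖x‖ := by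
          rw [neg_add, Real.rpow_add ht.1]; ring
      _ ≤ _ := by
          gcongr
          linarith [hA₂ i]

/-- For data in L^q alone the loss t^(-ρ/2) is absent. This is why the free evolution, and each
restart from a point of the solution, has a gradient of order t^(-1/2). -/
theorem exists_norm_heat_inl_le (hq : q ≠ ⊤) {σ : ℝ} (hσ : 0 < σ) :
    ∃ C : ℝ, 0 ≤ C ∧ ∀ t, 0 < t → ∀ f : LSpace d q, ‖heatOp hq σ t (f, 0)‖ ≤ C * ‖f‖ ∧
      ‖heatGrad hq σ t (f, 0)‖ ≤ C * ‖f‖ * t ^ (-(1 / 2 : ℝ)) := by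
  obtain ⟨C₁, hC₁0, hC₁⟩ : ∃ C₁ : ℝ, 0 ≤ C₁ ∧ ‖lpOf 1 (gaussian 1 : Space d → ℝ)‖ = C₁ :=
    ⟨_, norm_nonneg _, rfl⟩
  obtain ⟨C₂, hC₂0, hC₂⟩ := exists_nonneg_bound fun i : Fin d => σ⁻¹ * ‖lpOf 1 (gaussianPartial i)‖
  have hnorm : ∀ φ : Space d → ℝ, GaussianDecay φ → ∀ t, 0 < t → ∀ f : LSpace d q,
      ‖kernelOp hq (dilate (σ * √t) φ) (f, 0)‖ ≤ ‖lpOf 1 φ‖ * ‖f‖ := by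
    intro φ hφ t ht f
    refine (norm_kernelOp_inl_le hq _ f).trans_eq ?_
    rw [norm_lpOf_dilate ENNReal.one_ne_top hφ (mul_pos hσ (Real.sqrt_pos.2 ht))]
    simp
  refine ⟨C₁ + C₂, by positivity, fun t ht f => ⟨?_, ?_⟩⟩
  · rw [heatOp, gaussian_eq_dilate (mul_pos hσ (Real.sqrt_pos.2 ht))]
    refine (hnorm _ gaussianDecay_gaussian_one t ht f).trans ?_
    rw [hC₁]
    gcongr; linarith
  · have q1 := Real.rpow_nonneg ht.le (-(1 / 2 : ℝ))
    rw [pi_norm_le_iff_of_nonneg (by positivity)]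
    intro i
    have h2 : heatGrad hq σ t (f, 0) i =
        (σ * √t)⁻¹ • kernelOp hq (dilate (σ * √t) (gaussianPartial i)) (f, 0) := rfl
    have e : (σ * √t)⁻¹ = σ⁻¹ * t ^ (-(1 / 2 : ℝ)) := by
      rw [mul_inv, Real.sqrt_eq_rpow, Real.rpow_neg ht.le]
    rw [h2, norm_smul, e, Real.norm_of_nonneg (by positivity)]
    calc _ ≤ σ⁻¹ * t ^ (-(1 / 2 : ℝ)) * (‖lpOf 1 (gaussianPartial i)‖ * ‖f‖) := by
          gcongr
          exact hnorm _ (gaussianDecay_gaussianPartial i) t ht f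
      _ = σ⁻¹ * ‖lpOf 1 (gaussianPartial i)‖ * ‖f‖ * t ^ (-(1 / 2 : ℝ)) := by ring
      _ ≤ _ := by
          gcongr
          linarith [hC₂ i]

theorem tendsto_heatOp (hq : q ≠ ⊤) {σ : ℝ} (hσ : 0 < σ) (f : LSpace d q) :
    Tendsto (fun t => heatOp hq σ t (f, 0)) (𝓝[>] 0) (𝓝 f) := by
  refine (tendsto_kernelOp_gaussian hq f).comp (tendsto_nhdsWithin_iff.2 ⟨?_, ?_⟩)
  · have : Continuous fun t : ℝ => σ * √t := by fun_prop
    have h := this.tendsto 0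
    simp only [Real.sqrt_zero, mul_zero] at h
    exact h.mono_left nhdsWithin_le_nhds
  · filter_upwards [self_mem_nhdsWithin] with t ht
    exact mul_pos hσ (Real.sqrt_pos.2 ht)

theorem isBoundedPath_heat (hq : q ≠ ⊤) {σ : ℝ} (hσ : 0 < σ) (f : LSpace d q) :
    IsBoundedPath (fun t => heatOp hq σ t (f, 0)) (fun t => heatGrad hq σ t (f, 0)) := by
  obtain ⟨C, hC0, hC⟩ := exists_norm_heat_inl_le (d := d) hq hσ
  refine ⟨?_, ?_, C * ‖f‖, by positivity, fun t ht => hC t ht.1 f⟩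
  · exact ((continuousOn_heatOp hq hσ).mono Ioc_subset_Ioi_self).clm_apply continuousOn_const
  · exact ((continuousOn_heatGrad hq hσ).mono Ioc_subset_Ioi_self).clm_apply continuousOn_const

theorem heatOp_semigroup (r : ℝ≥0∞) [Fact (1 ≤ r)] [ENNReal.HolderConjugate r q] (hq : q ≠ ⊤)
    {σ : ℝ} (hσ : 0 < σ) {a b : ℝ} (ha : 0 < a) (hb : 0 < b) (x : LSpace d q × LSpace d 1) :
    heatOp hq σ a (heatOp hq σ b x, 0) = heatOp hq σ (a + b) x := by
  rw [heatOp, heatOp, heatOp, kernelOp_gaussian_semigroup r hq (mul_pos hσ (Real.sqrt_pos.2 ha))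
    (mul_pos hσ (Real.sqrt_pos.2 hb)), mul_pow, mul_pow, Real.sq_sqrt ha.le, Real.sq_sqrt hb.le,
    ← mul_add, Real.sqrt_mul (by positivity), Real.sqrt_sq hσ.le]

theorem hasWeakPartial_heatOp (r : ℝ≥0∞) [Fact (1 ≤ r)] [ENNReal.HolderConjugate r q]
    (hq : q ≠ ⊤) {σ : ℝ} (hσ : 0 < σ) {t : ℝ} (ht : 0 < t) (i : Fin d)
    (x : LSpace d q × LSpace d 1) :
    HasWeakPartial i (heatOp hq σ t x) (heatGrad hq σ t x i) :=
  hasWeakPartial_kernelOp_gaussian r hq (mul_pos hσ (Real.sqrt_pos.2 ht)) i x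

/-- This ties the abstract second component to the gradient of the first. -/
theorem hasWeakPartial_duhamel (r : ℝ≥0∞) [Fact (1 ≤ r)] [ENNReal.HolderConjugate r q]
    (hq : q ≠ ⊤) {σ : ℝ} (hσ : 0 < σ) {a t τ : ℝ} (hτ : 0 < τ) (f : LSpace d q)
    {n : ℝ → LSpace d q × LSpace d 1}
    (h1 : IntegrableOn (fun s => heatOp hq σ (t - s) (n s)) (Ioo a t))
    (h2 : IntegrableOn (fun s => heatGrad hq σ (t - s) (n s)) (Ioo a t)) (i : Fin d) :
    HasWeakPartial i (heatOp hq σ τ (f, 0) + ∫ s in Ioo a t, heatOp hq σ (t - s) (n s))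
      ((heatGrad hq σ τ (f, 0) + ∫ s in Ioo a t, heatGrad hq σ (t - s) (n s)) i) := by
  have e : (∫ s in Ioo a t, heatGrad hq σ (t - s) (n s)) i =
      ∫ s in Ioo a t, heatGrad hq σ (t - s) (n s) i :=
    ((ContinuousLinearMap.proj (R := ℝ) (φ := fun _ : Fin d => LSpace d q) i).integral_comp_comm
      h2).symm
  rw [Pi.add_apply, e]
  refine (hasWeakPartial_heatOp r hq hσ hτ i _).add r (HasWeakPartial.integral r h1
    ((ContinuousLinearMap.proj (R := ℝ) (φ := fun _ : Fin d => LSpace d q) i).integrable_comp h2)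
    ?_)
  filter_upwards [ae_restrict_mem measurableSet_Ioo] with s hs
  exact hasWeakPartial_heatOp r hq hσ (sub_pos.2 hs.2) i _

end Heat

/-! ### The Sobolev norm -/

section Sobolev

variable {d : ℕ} {q : ℝ≥0∞} [Fact (1 ≤ q)]

/-- The ℓ^q norm of a finite family is at most its ℓ¹ norm M, since x^q ≤ x M^(q-1) for 0 ≤ x ≤ M.
-/
theorem sobolevNorm_le (hq : q ≠ ⊤) (f : LSpace d q) :
    sobolevNorm f ≤ ‖f‖ + ∑ i, ‖weakPartial i f‖ := by
  have hq1 : 1 ≤ q.toReal := by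
    have : (1 : ℝ≥0∞) ≤ q := Fact.out
    simpa using ENNReal.toReal_mono hq this
  have hs : 0 ≤ ∑ i, ‖weakPartial i f‖ := Finset.sum_nonneg fun i _ => norm_nonneg _
  have hM : 0 ≤ ‖f‖ + ∑ i, ‖weakPartial i f‖ := by positivity
  set M := ‖f‖ + ∑ i, ‖weakPartial i f‖ with hMdef
  have key : ∀ x, 0 ≤ x → x ≤ M → x ^ q.toReal ≤ x * M ^ (q.toReal - 1) := by
    intro x hx hxM
    rcases hx.eq_or_lt with rfl | hx'
    · rw [Real.zero_rpow (by linarith)]; simp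
    · calc x ^ q.toReal = x * x ^ (q.toReal - 1) := by
            rw [Real.rpow_sub_one hx'.ne']; field_simp
        _ ≤ _ := by gcongr
  have hfi : ∀ i, ‖weakPartial i f‖ ≤ M := fun i => by
    have := Finset.single_le_sum (fun j _ => norm_nonneg (weakPartial j f)) (Finset.mem_univ i)
    have := norm_nonneg f
    linarith
  have hsum : ‖f‖ ^ q.toReal + ∑ i, ‖weakPartial i f‖ ^ q.toReal ≤ M ^ q.toReal := by
    calc _ ≤ ‖f‖ * M ^ (q.toReal - 1) + ∑ i, ‖weakPartial i f‖ * M ^ (q.toReal - 1) := by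
          gcongr with i
          · exact key _ (norm_nonneg _) (by linarith)
          · exact key _ (norm_nonneg _) (hfi i)
      _ = M * M ^ (q.toReal - 1) := by rw [← Finset.sum_mul, ← add_mul]
      _ = M ^ q.toReal := by
          rcases hM.eq_or_lt with h0 | h0
          · rw [← h0, Real.zero_rpow (x := q.toReal) (by linarith), zero_mul]
          · rw [Real.rpow_sub_one h0.ne']; field_simp
  calc sobolevNorm f ≤ (M ^ q.toReal) ^ (1 / q.toReal) := by
        unfold sobolevNorm
        apply Real.rpow_le_rpow _ hsum (by positivity)
        have : 0 ≤ ∑ i, ‖weakPartial i f‖ ^ q.toReal :=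
          Finset.sum_nonneg fun i _ => by positivity
        positivity
    _ = M := by rw [← Real.rpow_mul hM, mul_one_div_cancel (by linarith), Real.rpow_one]

theorem norm_weakPartial_le_sobolevNorm (hq : q ≠ ⊤) (f : LSpace d q) (i : Fin d) :
    ‖weakPartial i f‖ ≤ sobolevNorm f := by
  have hq1 : 1 ≤ q.toReal := by
    have : (1 : ℝ≥0∞) ≤ q := Fact.out
    simpa using ENNReal.toReal_mono hq this
  calc ‖weakPartial i f‖ = (‖weakPartial i f‖ ^ q.toReal) ^ (1 / q.toReal) := by
        rw [← Real.rpow_mul (norm_nonneg _), mul_one_div_cancel (by linarith), Real.rpow_one]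
    _ ≤ sobolevNorm f := by
        unfold sobolevNorm
        apply Real.rpow_le_rpow (by positivity) _ (by positivity)
        have h1 := Finset.single_le_sum (f := fun j => ‖weakPartial j f‖ ^ q.toReal)
          (fun j _ => by positivity) (Finset.mem_univ i)
        have h2 : 0 ≤ ‖f‖ ^ q.toReal := by positivity
        linarith

end Sobolev

/-! ### The system of the Allen–Cahn equation -/

/-- Here ρ = d/r, and the hypothesis on r reads d/r < 1 - 2/p, that is 1/2 + ρ/2 < 1 - 1/p. For p =
∞ the strict inequality survives the passage to a large finite exponent. -/
theorem exists_real_exponent {d : ℕ} (hd : 1 ≤ d) {p r q : ℝ≥0∞} [ENNReal.HolderConjugate r q]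
    (hp : 2 < p) (hr : (d : ℝ≥0∞) / (1 - 2 / p) < r) :
    q ≠ ⊤ ∧ ∃ p₁ ρ : ℝ, 2 < p₁ ∧ ENNReal.ofReal p₁ ≤ p ∧ (d : ℝ) - d / q.toReal = ρ ∧ 0 ≤ ρ ∧
      1 / 2 + ρ / 2 < 1 - 1 / p₁ := by
  have hd' : (1 : ℝ) ≤ d := by exact_mod_cast hd
  have hconj : r.toReal⁻¹ + q.toReal⁻¹ = 1 := by
    have h := ENNReal.HolderConjugate.inv_add_inv_eq_one r q
    have h1 : r⁻¹ ≠ ⊤ := fun h' => by simp [h'] at h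
    have h2 : q⁻¹ ≠ ⊤ := fun h' => by simp [h'] at h
    rw [← ENNReal.toReal_inv, ← ENNReal.toReal_inv, ← ENNReal.toReal_add h1 h2, h,
      ENNReal.toReal_one]
  have hp2 : 2 / p.toReal < 1 := by
    rcases eq_or_ne p ⊤ with rfl | hpt
    · simp
    · have : 2 < p.toReal := by
        simpa using (ENNReal.toReal_lt_toReal ENNReal.ofNat_ne_top hpt).2 hp
      rwa [div_lt_one (by linarith)]
  have hlt : (d : ℝ) * r.toReal⁻¹ < 1 - 2 / p.toReal := by
    rcases eq_or_ne r ⊤ with rfl | hrt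
    · simpa using hp2
    have hle : 2 / p ≤ 1 := ENNReal.div_le_of_le_mul (by simpa using hp.le)
    have hpos : 1 - 2 / p ≠ 0 := by
      intro h0
      rw [h0, ENNReal.div_zero (by exact_mod_cast (by omega : d ≠ 0))] at hr
      exact not_top_lt hr
    have hne : 1 - 2 / p ≠ ⊤ := ENNReal.sub_ne_top ENNReal.one_ne_top
    rw [ENNReal.div_lt_iff (Or.inl hpos) (Or.inl hne)] at hr
    have h := (ENNReal.toReal_lt_toReal (ENNReal.natCast_ne_top d)
      (ENNReal.mul_ne_top hrt hne)).2 hr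
    rw [ENNReal.toReal_mul, ENNReal.toReal_sub_of_le hle ENNReal.one_ne_top, ENNReal.toReal_div,
      ENNReal.toReal_natCast, ENNReal.toReal_one, ENNReal.toReal_ofNat] at h
    have hr0 : 0 < r.toReal := by
      by_contra h0
      have : r.toReal = 0 := le_antisymm (not_lt.1 h0) ENNReal.toReal_nonneg
      rw [this, zero_mul] at h
      linarith
    rwa [← div_eq_mul_inv, div_lt_iff₀ hr0, mul_comm]
  have hb0 : 0 ≤ r.toReal⁻¹ := inv_nonneg.2 ENNReal.toReal_nonneg
  have hp0 : 0 ≤ 2 / p.toReal := div_nonneg zero_le_two ENNReal.toReal_nonneg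
  have hρ : (d : ℝ) - d / q.toReal = d * r.toReal⁻¹ := by
    rw [div_eq_mul_inv, eq_sub_of_add_eq' hconj]
    ring
  refine ⟨?_, ?_⟩
  -- If q were infinite then 1/r = 1, and d < 1 - 2/p would contradict d ≥ 1.
  · rintro rfl
    rw [ENNReal.toReal_top, inv_zero, add_zero] at hconj
    rw [hconj] at hlt
    linarith
  have hρ0 : 0 ≤ (d : ℝ) * r.toReal⁻¹ := by positivity
  rcases eq_or_ne p ⊤ with rfl | hpt
  · have h1 : 0 < 1 - (d : ℝ) * r.toReal⁻¹ := by simpa using hlt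
    -- The requirement is p₁ > 2/(1 - ρ); adding 2 also secures p₁ > 2.
    refine ⟨2 + 2 / (1 - d * r.toReal⁻¹), _, ?_, le_top, hρ, hρ0, ?_⟩
    · have : 0 < 2 / (1 - (d : ℝ) * r.toReal⁻¹) := by positivity
      linarith
    · have : 1 / (2 + 2 / (1 - d * r.toReal⁻¹)) < 1 / (2 / (1 - d * r.toReal⁻¹)) :=
        one_div_lt_one_div_of_lt (by positivity) (by linarith)
      rw [one_div_div] at this
      linarith
  · refine ⟨p.toReal, _, ?_, (ENNReal.ofReal_toReal hpt).le, hρ, hρ0, ?_⟩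
    · simpa using (ENNReal.toReal_lt_toReal ENNReal.ofNat_ne_top hpt).2 hp
    · have : 2 / p.toReal = 2 * (1 / p.toReal) := by ring
      linarith

theorem memLp_mul_one_add_norm_add_norm {α F G : Type*} [MeasurableSpace α] {μ : Measure α}
    [IsFiniteMeasure μ] [NormedAddCommGroup F] [NormedAddCommGroup G] {p : ℝ≥0∞} {f : α → F}
    {g : α → G} (hf : MemLp f p μ) (hg : MemLp g p μ) (C : ℝ) :
    MemLp (fun s => C * (1 + ‖f s‖ + ‖g s‖)) p μ := by
  have h1 : MemLp (fun _ : α => (1 : ℝ)) p μ := memLp_const 1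
  have h2 : MemLp (fun s => 1 + ‖f s‖) p μ := h1.add hf.norm
  have h3 : MemLp (fun s => 1 + ‖f s‖ + ‖g s‖) p μ := h2.add hg.norm
  exact h3.const_mul C

theorem mul_one_add_norm_add_norm_nonneg {F G : Type*} [NormedAddCommGroup F]
    [NormedAddCommGroup G] {C : ℝ} (hC : 0 ≤ C) (x : F) (y : G) : 0 ≤ C * (1 + ‖x‖ + ‖y‖) := by
  positivity

section System

variable {d : ℕ} {q r : ℝ≥0∞} [Fact (1 ≤ q)] [Fact (1 ≤ r)] [ENNReal.HolderConjugate r q]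
  {V : Type*} [NormedAddCommGroup V] [InnerProductSpace ℝ V]

theorem exists_split_nonlinearity {p₁ : ℝ} {W : ℝ} (hW : 0 < W)
    {ι : V →ₗ[ℝ] (Space d → Space d)} (hι : IsC1Embedding ι) {u : ℝ → LSpace d r}
    (hu : MemLp u (ENNReal.ofReal p₁) (volume.restrict (Icc (0 : ℝ) 1))) {v : ℝ → V}
    (hv : MemLp v (ENNReal.ofReal p₁) (volume.restrict (Icc (0 : ℝ) 1))) :
    ∃ (N : ℝ → LSpace d q → (Fin d → LSpace d q) → LSpace d q × LSpace d 1) (w : ℝ → ℝ),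
      (∀ s, 0 ≤ w s) ∧ MemLp w (ENNReal.ofReal p₁) (volume.restrict (Icc (0 : ℝ) 1)) ∧
      (∀ s, N s 0 0 = 0) ∧
      (∀ s y h y' h', ‖N s y h - N s y' h'‖ ≤ w s * (‖y - y'‖ + ‖h - h'‖)) ∧
      (∀ (y : ℝ → LSpace d q) (h : ℝ → Fin d → LSpace d q), ContinuousOn y (Ioc 0 1) →
        ContinuousOn h (Ioc 0 1) →
        AEStronglyMeasurable (fun s => N s (y s) (h s)) (volume.restrict (Ioc (0 : ℝ) 1))) ∧
      ∀ s y h, (∀ i, h i = weakPartial i y) →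
        (fun x => (N s y h).1 x + (N s y h).2 x) =ᵐ[volume]
          nonlinearity W (u s) (ι (v s)) y := by
  obtain ⟨L, hL⟩ := exists_lipschitzWith_reaction hW
  obtain ⟨E, hE⟩ := exists_embedding_top hι
  obtain ⟨C, hC0, hC⟩ := exists_norm_splitNonlinearity_sub_le (d := d) (q := q) (r := r) hL
  obtain ⟨b, hbE⟩ : ∃ b : ℝ → Lp (Space d) ⊤ (volume : Measure (Space d)), ∀ s, b s = E (v s) :=
    ⟨fun s => E (v s), fun _ => rfl⟩
  have hb : MemLp b (ENNReal.ofReal p₁) (volume.restrict (Icc (0 : ℝ) 1)) := by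
    rw [funext hbE]
    exact E.comp_memLp' hv
  have hsub : volume.restrict (Ioc (0 : ℝ) 1) ≤ volume.restrict (Icc (0 : ℝ) 1) :=
    Measure.restrict_mono Ioc_subset_Icc_self le_rfl
  have hum := hu.1.mono_measure hsub
  have hbm := hb.1.mono_measure hsub
  refine ⟨fun s y h => splitNonlinearity hL (u s) (b s) y h, fun s => C * (1 + ‖u s‖ + ‖b s‖),
    fun s => mul_one_add_norm_add_norm_nonneg hC0 (u s) (b s),
    memLp_mul_one_add_norm_add_norm hu hb C, fun s => splitNonlinearity_zero hL (u s) (b s),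
    fun s => hC (u s) (b s), fun y h hy hh => ?_, fun s y h hh => ?_⟩
  · exact aestronglyMeasurable_splitNonlinearity hL hum hbm
      (hy.aestronglyMeasurable measurableSet_Ioc) (hh.aestronglyMeasurable measurableSet_Ioc)
  · refine splitNonlinearity_ae_eq hL (u s) ?_ y hh
    rw [hbE]
    exact hE (v s)

theorem exists_system (hq : q ≠ ⊤) {p₁ ρ : ℝ} (hp₁ : 2 < p₁) (hρ : (d : ℝ) - d / q.toReal = ρ)
    (hρ0 : 0 ≤ ρ) (hγ : 1 / 2 + ρ / 2 < 1 - 1 / p₁) {σ W : ℝ} (hσ : 0 < σ) (hW : 0 < W)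
    {ι : V →ₗ[ℝ] (Space d → Space d)} (hι : IsC1Embedding ι) {u : ℝ → LSpace d r}
    (hu : MemLp u (ENNReal.ofReal p₁) (volume.restrict (Icc (0 : ℝ) 1))) {v : ℝ → V}
    (hv : MemLp v (ENNReal.ofReal p₁) (volume.restrict (Icc (0 : ℝ) 1))) :
    ∃ P : SingularSystem (LSpace d q × LSpace d 1) (LSpace d q) (Fin d → LSpace d q),
      P.S = heatOp hq σ ∧ P.D = heatGrad hq σ ∧
      ∀ s y h, (∀ i, h i = weakPartial i y) →
        (fun x => (P.N s y h).1 x + (P.N s y h).2 x) =ᵐ[volume]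
          nonlinearity W (u s) (ι (v s)) y := by
  obtain ⟨A, hA0, hA⟩ := exists_norm_heat_le (d := d) hq hσ hρ hρ0
  obtain ⟨N, w, hw0, hw, hN0, hNl, hNm, hNe⟩ :=
    exists_split_nonlinearity (q := q) hW hι hu hv
  have hSn : ∀ τ ∈ Ioc (0 : ℝ) 1,
      ‖heatOp (d := d) hq σ τ‖ ≤ A * τ ^ (1 / 2 - (1 / 2 + ρ / 2)) := by
    rw [show 1 / 2 - (1 / 2 + ρ / 2) = -(ρ / 2) by ring]
    exact fun τ hτ => (hA τ hτ).1
  exact ⟨{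
    S := heatOp hq σ
    D := heatGrad hq σ
    N := N
    w := w
    p := p₁
    γ := 1 / 2 + ρ / 2
    A := A
    two_lt_p := hp₁
    half_le_γ := by linarith
    γ_lt := hγ
    A_nonneg := hA0
    continuousOn_S := continuousOn_heatOp hq hσ
    continuousOn_D := continuousOn_heatGrad hq hσ
    norm_S_le := hSn
    norm_D_le := fun τ hτ => (hA τ hτ).2
    w_nonneg := hw0
    memLp_w := hw
    N_zero := hN0
    norm_N_sub_le := hNl
    measurable_N := hNm }, rfl, rfl, hNe⟩

end System

/-! ### Mild solutions as solutions of the abstract Duhamel system. -/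

section Solution

variable {d : ℕ} {q r : ℝ≥0∞} [Fact (1 ≤ q)] [Fact (1 ≤ r)] [ENNReal.HolderConjugate r q]

theorem heatOp_ae_eq_heatConv (r : ℝ≥0∞) [Fact (1 ≤ r)] [ENNReal.HolderConjugate r q] (hq : q ≠ ⊤)
    {σ t : ℝ} (hσ : 0 < σ) (ht : 0 < t) (x : LSpace d q × LSpace d 1) {g : Space d → ℝ}
    (hg : (fun z => x.1 z + x.2 z) =ᵐ[volume] g) :
    heatOp hq σ t x =ᵐ[volume] heatConv (σ * √t) g := by
  have := kernelOp_ae_eq r hq (gaussianDecay_gaussian (mul_pos hσ (Real.sqrt_pos.2 ht))) x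
  rw [conv_congr_right hg] at this
  exact this

theorem heatOp_inl_ae_eq_heatConv (r : ℝ≥0∞) [Fact (1 ≤ r)] [ENNReal.HolderConjugate r q]
    (hq : q ≠ ⊤) {σ t : ℝ} (hσ : 0 < σ) (ht : 0 < t) (f : LSpace d q) :
    heatOp hq σ t (f, 0) =ᵐ[volume] heatConv (σ * √t) f := by
  refine heatOp_ae_eq_heatConv r hq hσ ht _ ?_
  filter_upwards [Lp.coeFn_zero ℝ 1 (volume : Measure (Space d))] with z hz
  rw [hz, Pi.zero_apply, add_zero]

variable {P : SingularSystem (LSpace d q × LSpace d 1) (LSpace d q) (Fin d → LSpace d q)}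
  {σ W : ℝ} {u : ℝ → LSpace d r} {v : ℝ → Space d → Space d}

theorem intervalIntegral_eq_setIntegral_Ioo {E : Type*} [NormedAddCommGroup E] [NormedSpace ℝ E]
    (F : ℝ → E) {a t : ℝ} (hat : a ≤ t) : ∫ s in a..t, F s = ∫ s in Ioo a t, F s := by
  rw [intervalIntegral.integral_of_le hat, integral_Ioc_eq_integral_Ioo]

theorem isMildSolution_of_duhamel (hq : q ≠ ⊤) (hσ : 0 < σ) (hS : P.S = heatOp hq σ)
    (hN : ∀ s y h, (∀ i, h i = weakPartial i y) →
        (fun x => (P.N s y h).1 x + (P.N s y h).2 x) =ᵐ[volume] nonlinearity W (u s) (v s) y)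
    {f₀ : LSpace d q} {y : ℝ → LSpace d q} {h : ℝ → Fin d → LSpace d q}
    (hyh : IsBoundedPath y h)
    (hy : ∀ t ∈ Ioc (0 : ℝ) 1,
      y t = heatOp hq σ t (f₀, 0) + ∫ s in Ioo 0 t, P.S (t - s) (P.N s (y s) (h s)))
    (hh : ∀ t ∈ Ioc (0 : ℝ) 1, ∀ i, h t i = weakPartial i (y t)) :
    IsMildSolution σ W f₀ u v y := by
  intro t ht
  have hint := (P.integrableOn_duhamel hyh ht).1
  refine ⟨fun s => P.S (t - s) (P.N s (y s) (h s)), ?_, ?_, ?_⟩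
  · refine Eventually.of_forall fun s hs => ?_
    rw [hS]
    exact heatOp_ae_eq_heatConv r hq hσ (sub_pos.2 hs.2) _
      (hN s _ _ (hh s ⟨hs.1, by linarith [hs.2, ht.2]⟩))
  · rw [intervalIntegrable_iff_integrableOn_Ioo_of_le ht.1.le]
    exact hint
  · rw [intervalIntegral_eq_setIntegral_Ioo _ ht.1.le, hy t ht]
    filter_upwards [heatOp_inl_ae_eq_heatConv r hq hσ ht.1 f₀,
      Lp.coeFn_add (heatOp hq σ t (f₀, 0)) (∫ s in Ioo 0 t, P.S (t - s) (P.N s (y s) (h s)))]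
      with x h1 h2
    rw [h2, Pi.add_apply, h1]

/-- Integrability down to s = 0 is inherited from the definition of a mild solution, not estimated,
since no rate for the gradient at 0 is available yet. -/
theorem IsMildSolution.duhamel (hq : q ≠ ⊤) (hσ : 0 < σ) (hS : P.S = heatOp hq σ)
    (hN : ∀ s y h, (∀ i, h i = weakPartial i y) →
        (fun x => (P.N s y h).1 x + (P.N s y h).2 x) =ᵐ[volume] nonlinearity W (u s) (v s) y)
    {f₀ : LSpace d q} {g : ℝ → LSpace d q} (hg : IsMildSolution σ W f₀ u v g) {t : ℝ}
    (ht : t ∈ Ioc (0 : ℝ) 1) :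
    IntegrableOn (fun s => P.S (t - s) (P.N s (g s) fun i => weakPartial i (g s))) (Ioo 0 t) ∧
    g t = heatOp hq σ t (f₀, 0) +
      ∫ s in Ioo 0 t, P.S (t - s) (P.N s (g s) fun i => weakPartial i (g s)) := by
  obtain ⟨F, hF, hFi, hFe⟩ := hg t ht
  have hae : ∀ᵐ s ∂(volume.restrict (Ioo 0 t)),
      F s = P.S (t - s) (P.N s (g s) fun i => weakPartial i (g s)) := by
    rw [ae_restrict_iff' measurableSet_Ioo]
    filter_upwards [hF] with s hs hs'
    apply Lp.ext
    rw [hS]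
    exact (hs hs').trans (heatOp_ae_eq_heatConv r hq hσ (sub_pos.2 hs'.2) _
      (hN s _ _ fun i => rfl)).symm
  rw [intervalIntegrable_iff_integrableOn_Ioo_of_le ht.1.le] at hFi
  rw [intervalIntegral_eq_setIntegral_Ioo _ ht.1.le] at hFe
  refine ⟨hFi.congr hae, ?_⟩
  rw [← integral_congr_ae hae]
  apply Lp.ext
  filter_upwards [hFe, heatOp_inl_ae_eq_heatConv r hq hσ ht.1 f₀,
    Lp.coeFn_add (heatOp hq σ t (f₀, 0)) (∫ s in Ioo 0 t, F s)] with x h1 h2 h3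
  rw [h1, h3, Pi.add_apply, h2]

/-- The heat operator at time t - a is applied to the equation at a. It passes through the integral,
and the semigroup law turns the result into the equation at t without the part of the integral over
(a,t). -/
theorem IsMildSolution.restart (hq : q ≠ ⊤) (hσ : 0 < σ) (hS : P.S = heatOp hq σ)
    (hN : ∀ s y h, (∀ i, h i = weakPartial i y) →
        (fun x => (P.N s y h).1 x + (P.N s y h).2 x) =ᵐ[volume] nonlinearity W (u s) (v s) y)
    {f₀ : LSpace d q} {g : ℝ → LSpace d q} (hg : IsMildSolution σ W f₀ u v g) {a t : ℝ}
    (ha : 0 < a) (hat : a < t) (ht : t ≤ 1) :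
    g t = heatOp hq σ (t - a) (g a, 0) +
      ∫ s in Ioo a t, P.S (t - s) (P.N s (g s) fun i => weakPartial i (g s)) := by
  obtain ⟨hit, het⟩ := hg.duhamel hq hσ hS hN (t := t) ⟨ha.trans hat, ht⟩
  obtain ⟨hia, hea⟩ := hg.duhamel hq hσ hS hN (t := a) ⟨ha, hat.le.trans ht⟩
  have hta : 0 < t - a := sub_pos.2 hat
  let T : LSpace d q →L[ℝ] LSpace d q := (heatOp hq σ (t - a)).comp
    (ContinuousLinearMap.inl ℝ (LSpace d q) (LSpace d 1))
  have hT : ∀ f, heatOp hq σ (t - a) (f, 0) = T f := fun f => rfl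
  have h1 : heatOp hq σ (t - a) (g a, 0) = heatOp hq σ t (f₀, 0) +
      ∫ s in Ioo 0 a, P.S (t - s) (P.N s (g s) fun i => weakPartial i (g s)) := by
    rw [hT, hea, map_add, ← T.integral_comp_comm hia, ← hT,
      heatOp_semigroup r hq hσ hta ha, sub_add_cancel]
    congr 1
    refine setIntegral_congr_fun measurableSet_Ioo fun s hs => ?_
    rw [← hT, hS, heatOp_semigroup r hq hσ hta (sub_pos.2 hs.2), sub_add_sub_cancel]
  have h2 : ∫ s in Ioo 0 t, P.S (t - s) (P.N s (g s) fun i => weakPartial i (g s)) =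
      (∫ s in Ioo 0 a, P.S (t - s) (P.N s (g s) fun i => weakPartial i (g s))) +
      ∫ s in Ioo a t, P.S (t - s) (P.N s (g s) fun i => weakPartial i (g s)) := by
    rw [← Ioc_union_Ioo_eq_Ioo ha.le hat, setIntegral_union ?_ measurableSet_Ioo
      (hit.mono_set fun s hs => ⟨hs.1, hs.2.trans_lt hat⟩)
      (hit.mono_set fun s hs => ⟨ha.trans hs.1, hs.2⟩), integral_Ioc_eq_integral_Ioo]
    rw [Set.disjoint_left]
    exact fun s hs hs' => absurd hs.2 (not_le.2 hs'.1)
  rw [het, h1, h2, add_assoc]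

theorem InPathClass.continuousOn_weakPartial (r : ℝ≥0∞) [Fact (1 ≤ r)]
    [ENNReal.HolderConjugate r q] (hq : q ≠ ⊤) {g : ℝ → LSpace d q} (hg : InPathClass g) :
    ContinuousOn (fun t => fun i => weakPartial i (g t)) (Ioc 0 1) := by
  refine continuousOn_pi.2 fun i t₀ ht₀ => ?_
  rw [ContinuousWithinAt, tendsto_iff_norm_sub_tendsto_zero]
  refine squeeze_zero' (Eventually.of_forall fun _ => norm_nonneg _) ?_ (hg.continuousW1 t₀ ht₀)
  filter_upwards [self_mem_nhdsWithin] with t ht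
  rw [← (((hg.memW1 t ht).hasWeakPartial i).sub r ((hg.memW1 t₀ ht₀).hasWeakPartial i)).weakPartial_eq]
  exact norm_weakPartial_le_sobolevNorm hq _ i

/-- Every mild solution in the path class automatically has a gradient of order t^(-1/2), so
uniqueness holds without imposing this rate. -/
theorem IsMildSolution.isBoundedPath (hq : q ≠ ⊤) (hσ : 0 < σ) (hS : P.S = heatOp hq σ)
    (hD : P.D = heatGrad hq σ)
    (hN : ∀ s y h, (∀ i, h i = weakPartial i y) →
        (fun x => (P.N s y h).1 x + (P.N s y h).2 x) =ᵐ[volume] nonlinearity W (u s) (v s) y)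
    {f₀ : LSpace d q} {g : ℝ → LSpace d q} (hg : IsMildSolution σ W f₀ u v g)
    (hgc : InPathClass g) :
    IsBoundedPath g (fun t i => weakPartial i (g t)) := by
  obtain ⟨C, hC0, hC⟩ := exists_norm_heat_inl_le (d := d) hq hσ
  obtain ⟨B, hB⟩ := isCompact_Icc.exists_bound_of_continuousOn hgc.continuousOn
  have hB0 : 0 ≤ B := (norm_nonneg _).trans (hB 0 ⟨le_rfl, zero_le_one⟩)
  have hyc := hgc.continuousOn.mono Ioc_subset_Icc_self
  have hhc := hgc.continuousOn_weakPartial r hq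
  refine P.norm_snd_le_of_restart hB0 hC0 hyc hhc
    (S₀ := fun τ z => heatOp hq σ τ (z, 0)) (D₀ := fun τ z => heatGrad hq σ τ (z, 0))
    (fun τ hτ z => (hC τ hτ.1 z).1) (fun τ hτ z => (hC τ hτ.1 z).2)
    (fun t ht => hB t (Ioc_subset_Icc_self ht))
    (fun a t ha hat ht => hg.restart hq hσ hS hN ha hat ht) fun a t ha hat ht => ?_
  funext i
  have hi := P.integrableOn_duhamel_of_pos hyc hhc ha hat ht
  have heq := hg.restart hq hσ hS hN ha hat ht
  rw [hS] at hi heq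
  rw [hD] at hi
  have := hasWeakPartial_duhamel r hq hσ (sub_pos.2 hat) (g a) hi.1 hi.2 i
  rw [← heq] at this
  rw [hD]
  exact this.weakPartial_eq

end Solution

/-! ### Regularity of solutions of the Duhamel equation -/

section Regularity

variable {d : ℕ} {q : ℝ≥0∞} [Fact (1 ≤ q)]

theorem IsBoundedPath.continuousOn_Icc {Y H : Type*} [NormedAddCommGroup Y]
    [NormedAddCommGroup H] {f : ℝ → Y} {h : ℝ → H} (hfh : IsBoundedPath f h)
    (h0 : Tendsto f (𝓝[>] 0) (𝓝 (f 0))) : ContinuousOn f (Icc 0 1) := by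
  intro t ht
  rcases ht.1.eq_or_lt with rfl | ht0
  · refine (continuousWithinAt_Ioi_iff_Ici.1 h0).mono Icc_subset_Ici_self
  · refine (hfh.continuousOn_fst t ⟨ht0, ht.2⟩).mono_of_mem_nhdsWithin ?_
    rw [← Ioi_inter_Iic, mem_nhdsWithin]
    exact ⟨Ioi 0, isOpen_Ioi, ht0, fun s hs => ⟨hs.1, hs.2.2⟩⟩

theorem inPathClass_of_isBoundedPath (r : ℝ≥0∞) [Fact (1 ≤ r)] [ENNReal.HolderConjugate r q]
    (hq : q ≠ ⊤) {f : ℝ → LSpace d q} {h : ℝ → Fin d → LSpace d q} (hfh : IsBoundedPath f h)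
    (h0 : Tendsto f (𝓝[>] 0) (𝓝 (f 0)))
    (hw : ∀ t ∈ Ioc (0 : ℝ) 1, ∀ i, HasWeakPartial i (f t) (h t i)) : InPathClass f := by
  refine ⟨hfh.continuousOn_Icc h0, fun t ht i => ⟨_, hw t ht i⟩, fun t₀ ht₀ => ?_⟩
  have h1 : Tendsto (fun t => ‖f t - f t₀‖ + ∑ i, ‖h t i - h t₀ i‖) (𝓝[Ioc 0 1] t₀) (𝓝 0) := by
    have hf : Tendsto (fun t => ‖f t - f t₀‖) (𝓝[Ioc 0 1] t₀) (𝓝 0) :=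
      tendsto_iff_norm_sub_tendsto_zero.1 (hfh.continuousOn_fst t₀ ht₀)
    have hh : ∀ i, Tendsto (fun t => ‖h t i - h t₀ i‖) (𝓝[Ioc 0 1] t₀) (𝓝 0) := fun i =>
      tendsto_iff_norm_sub_tendsto_zero.1 (tendsto_pi_nhds.1 (hfh.continuousOn_snd t₀ ht₀) i)
    simpa using hf.add (tendsto_finsetSum Finset.univ fun i _ => hh i)
  refine squeeze_zero' (Eventually.of_forall fun t => ?_) ?_ h1
  · refine Real.rpow_nonneg (add_nonneg (by positivity) (Finset.sum_nonneg fun i _ => ?_)) _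
    positivity
  · filter_upwards [self_mem_nhdsWithin] with t ht
    refine (sobolevNorm_le hq _).trans_eq ?_
    congr 1
    refine Finset.sum_congr rfl fun i _ => ?_
    rw [((hw t ht i).sub r (hw t₀ ht₀ i)).weakPartial_eq]

theorem pathNorm_lt_top (hq : q ≠ ⊤) {f : ℝ → LSpace d q}
    (hf : IsBoundedPath f fun t i => weakPartial i (f t)) : pathNorm f < ⊤ := by
  obtain ⟨B, hB0, hB⟩ := hf.bound
  refine max_lt (lt_of_le_of_lt (b := ENNReal.ofReal (max B ‖f 0‖)) (iSup₂_le fun t ht => ?_)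
    ENNReal.ofReal_lt_top) (lt_of_le_of_lt (b := ENNReal.ofReal (B + d * B))
    (iSup₂_le fun t ht => ?_) ENNReal.ofReal_lt_top)
  · apply ENNReal.ofReal_le_ofReal
    rcases ht.1.eq_or_lt with rfl | ht0
    · exact le_max_right _ _
    · exact (hB t ⟨ht0, ht.2⟩).1.trans (le_max_left _ _)
  · apply ENNReal.ofReal_le_ofReal
    obtain ⟨h1, h2⟩ := hB t ht
    have hs0 : 0 < √t := Real.sqrt_pos.2 ht.1
    have hs1 : √t ≤ 1 := Real.sqrt_le_one.2 ht.2
    have e : t ^ (-(1 / 2 : ℝ)) = (√t)⁻¹ := by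
      rw [Real.sqrt_eq_rpow, Real.rpow_neg ht.1.le]
    rw [e] at h2
    have h3 : ∑ i, ‖weakPartial i (f t)‖ ≤ d * (B * (√t)⁻¹) := by
      calc _ ≤ ∑ _i : Fin d, B * (√t)⁻¹ :=
            Finset.sum_le_sum fun i _ =>
              (norm_le_pi_norm (fun j => weakPartial j (f t)) i).trans h2
        _ = _ := by simp
    calc √t * sobolevNorm (f t) ≤ √t * (B + d * (B * (√t)⁻¹)) :=
          mul_le_mul_of_nonneg_left ((sobolevNorm_le hq _).trans (add_le_add h1 h3)) hs0.le
      _ = √t * B + d * B := by field_simp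
      _ ≤ B + d * B := by
          gcongr
          exact mul_le_of_le_one_left hB0 hs1

end Regularity

/-! ### Initial value and gradient of solutions of the Duhamel system. -/

section Duhamel

variable {d : ℕ} {q : ℝ≥0∞} [Fact (1 ≤ q)]
  {P : SingularSystem (LSpace d q × LSpace d 1) (LSpace d q) (Fin d → LSpace d q)} {σ : ℝ}
  {f₀ : LSpace d q} {f : ℝ → LSpace d q} {h : ℝ → Fin d → LSpace d q}

theorem tendsto_of_duhamel (hq : q ≠ ⊤) (hσ : 0 < σ) (hfh : IsBoundedPath f h)
    (hf : ∀ t ∈ Ioc (0 : ℝ) 1,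
      f t = heatOp hq σ t (f₀, 0) + ∫ s in Ioo 0 t, P.S (t - s) (P.N s (f s) (h s))) :
    Tendsto f (𝓝[>] 0) (𝓝 f₀) := by
  have := (tendsto_heatOp hq hσ f₀).add (P.tendsto_duhamel_zero hfh)
  rw [add_zero] at this
  refine this.congr' ?_
  filter_upwards [Ioc_mem_nhdsGT (one_pos : (0 : ℝ) < 1)] with t ht
  exact (hf t ht).symm

theorem hasWeakPartial_of_duhamel (r : ℝ≥0∞) [Fact (1 ≤ r)] [ENNReal.HolderConjugate r q]
    (hq : q ≠ ⊤) (hσ : 0 < σ) (hS : P.S = heatOp hq σ) (hD : P.D = heatGrad hq σ)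
    (hfh : IsBoundedPath f h) {t : ℝ} (ht : t ∈ Ioc (0 : ℝ) 1)
    (hf : f t = heatOp hq σ t (f₀, 0) + ∫ s in Ioo 0 t, P.S (t - s) (P.N s (f s) (h s)))
    (i : Fin d) :
    HasWeakPartial i (f t)
      ((heatGrad hq σ t (f₀, 0) + ∫ s in Ioo 0 t, P.D (t - s) (P.N s (f s) (h s))) i) := by
  obtain ⟨h1, h2⟩ := P.integrableOn_duhamel hfh ht
  rw [hS] at h1 hf
  rw [hD] at h2 ⊢
  rw [hf]
  exact hasWeakPartial_duhamel r hq hσ ht.1 f₀ h1 h2 i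

/-- The fixed point is determined on (0,1] only. Its value at 0 is reset to the initial datum, which
leaves the equations intact because the integrals run over open intervals. -/
theorem exists_duhamel_eq_at_zero (P : SingularSystem (LSpace d q × LSpace d 1) (LSpace d q)
    (Fin d → LSpace d q)) (hq : q ≠ ⊤) (hσ : 0 < σ) (f₀ : LSpace d q) :
    ∃ (f : ℝ → LSpace d q) (h : ℝ → Fin d → LSpace d q), f 0 = f₀ ∧ IsBoundedPath f h ∧
      (∀ t ∈ Ioc (0 : ℝ) 1,
        f t = heatOp hq σ t (f₀, 0) + ∫ s in Ioo 0 t, P.S (t - s) (P.N s (f s) (h s))) ∧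
      (∀ t ∈ Ioc (0 : ℝ) 1,
        h t = heatGrad hq σ t (f₀, 0) + ∫ s in Ioo 0 t, P.D (t - s) (P.N s (f s) (h s))) := by
  obtain ⟨y, h, hyh, hy, hh⟩ := P.exists_duhamel (isBoundedPath_heat hq hσ f₀)
  have hf : ∀ t, 0 < t → Function.update y 0 f₀ t = y t := fun t ht =>
    Function.update_of_ne ht.ne' _ _
  refine ⟨Function.update y 0 f₀, h, Function.update_self _ _ _, ⟨?_, hyh.2, ?_⟩, fun t ht => ?_,
    fun t ht => ?_⟩
  · exact hyh.1.congr fun t ht => hf t ht.1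
  · obtain ⟨B, hB0, hB⟩ := hyh.bound
    exact ⟨B, hB0, fun t ht => by rw [hf t ht.1]; exact hB t ht⟩
  · rw [hf t ht.1, hy t ht]
    congr 1
    exact setIntegral_congr_fun measurableSet_Ioo fun s hs => by simp only [hf s hs.1]
  · rw [hh t ht]
    congr 1
    exact setIntegral_congr_fun measurableSet_Ioo fun s hs => by simp only [hf s hs.1]

end Duhamel

end AllenCahn

end

/-! ### Existence, bounds and uniqueness of the mild solution. -/

theorem mainTheorem1 {d : ℕ} (hd : 1 ≤ d) (p r q : ℝ≥0∞) [Fact (1 ≤ r)] [Fact (1 ≤ q)]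
    [ENNReal.HolderConjugate r q]
    (hp : 2 < p) (hr : (d : ℝ≥0∞) / (1 - 2 / p) < r)
    (σ W : ℝ) (hσ : 0 < σ) (hW : 0 < W)
    {V : Type*} [NormedAddCommGroup V] [InnerProductSpace ℝ V] [CompleteSpace V]
    (ι : V →ₗ[ℝ] (AllenCahn.Space d → AllenCahn.Space d)) (hι : AllenCahn.IsC1Embedding ι)
    (f₀ : AllenCahn.LSpace d q)
    (u : ℝ → AllenCahn.LSpace d r) (hu : MemLp u p (volume.restrict (Icc (0 : ℝ) 1)))
    (v : ℝ → V) (hv : MemLp v p (volume.restrict (Icc (0 : ℝ) 1))) :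
    ∃ f : ℝ → AllenCahn.LSpace d q,
      (AllenCahn.InPathClass f ∧
        AllenCahn.IsMildSolution σ W f₀ u (fun s => ι (v s)) f ∧
        AllenCahn.pathNorm f < ⊤ ∧
        f 0 = f₀ ∧
        Tendsto f (𝓝[>] 0) (𝓝 f₀)) ∧
      ∀ g : ℝ → AllenCahn.LSpace d q,
        AllenCahn.InPathClass g →
        AllenCahn.IsMildSolution σ W f₀ u (fun s => ι (v s)) g →
        EqOn g f (Icc 0 1) := by
  obtain ⟨hq, p₁, ρ, hp₁, hp₁p, hρ, hρ0, hγ⟩ := AllenCahn.exists_real_exponent (q := q) hd hp hr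
  obtain ⟨P, hS, hD, hN⟩ := AllenCahn.exists_system hq hp₁ hρ hρ0 hγ hσ hW hι
    (hu.mono_exponent hp₁p) (hv.mono_exponent hp₁p)
  obtain ⟨f, h, hf0, hfh, hf, hh⟩ := AllenCahn.exists_duhamel_eq_at_zero P hq hσ f₀
  have hlim : Tendsto f (𝓝[>] 0) (𝓝 f₀) := AllenCahn.tendsto_of_duhamel hq hσ hfh hf
  have hw : ∀ t ∈ Ioc (0 : ℝ) 1, ∀ i, AllenCahn.HasWeakPartial i (f t) (h t i) := by
    intro t ht i
    rw [hh t ht]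
    exact AllenCahn.hasWeakPartial_of_duhamel r hq hσ hS hD hfh ht (hf t ht) i
  have hhw : ∀ t ∈ Ioc (0 : ℝ) 1, ∀ i, h t i = AllenCahn.weakPartial i (f t) :=
    fun t ht i => (hw t ht i).weakPartial_eq.symm
  have hfc : AllenCahn.InPathClass f :=
    AllenCahn.inPathClass_of_isBoundedPath r hq hfh (by rwa [hf0]) hw
  have hfm : AllenCahn.IsMildSolution σ W f₀ u (fun s => ι (v s)) f :=
    AllenCahn.isMildSolution_of_duhamel hq hσ hS hN hfh hf hhw
  refine ⟨f, ⟨hfc, hfm, AllenCahn.pathNorm_lt_top hq (hfm.isBoundedPath hq hσ hS hD hN hfc), hf0,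
    hlim⟩, fun g hgc hgm => ?_⟩
  have hgb := hgm.isBoundedPath hq hσ hS hD hN hgc
  have hge := fun t ht => (hgm.duhamel hq hσ hS hN (t := t) ht).2
  have hIoc : EqOn g f (Ioc 0 1) := P.eqOn_of_duhamel hgb hfh hge (fun t ht => funext fun i =>
    (AllenCahn.hasWeakPartial_of_duhamel r hq hσ hS hD hgb ht (hge t ht) i).weakPartial_eq) hf hh
  intro t ht
  rcases ht.1.eq_or_lt with rfl | ht0
  -- No equation is imposed at t = 0, so there `g` is identified by its continuity and the limit of
  -- the Duhamel formula.
  · have hg0 : Tendsto g (𝓝[>] 0) (𝓝 (g 0)) := by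
      have := (hgc.continuousOn 0 ht).mono Ioc_subset_Icc_self
      rwa [ContinuousWithinAt, nhdsWithin_Ioc_eq_nhdsGT one_pos] at this
    rw [hf0]
    exact tendsto_nhds_unique hg0 (AllenCahn.tendsto_of_duhamel hq hσ hgb hge)
  · exact hIoc ⟨ht0, ht.2⟩
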